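/- All logarithms are to the base two. **Source.** Let $B$ be a perfect square and $A=L=\sqrt B$. Draw $A$ source symbols $X_1,\dots,X_A$ uniformly at random without replacement from $\{0,1\}^L$ and, independently, draw $B$ blocks $Y_1,\dots,Y_B$ i.i.d. uniformly from $\{X_1,\dots,X_A\}$. The source sequence is the concatenation $S=Y_1Y_2\cdots Y_B\in\{0,1\}^{BL}$, without delimiters. Let $R^\star$ be the smallest expected length of a binary prefix-free source code for the random variable $S$. **Schemes.** Fix a prefix-free binary code for the positive integers which spends at most $2\log n+3$ bits on $n$ (such as an Elias code). Let $M\ge1$ be the anchor length. *Variable-length deduplication.* Parse $S$ from left to right into chunks $Z_1Z_2\cdots Z_C$, where each chunk (except perhaps the last) ends at the first appearance in it of the anchor $0^M$. Encode the length of $S$ with the integer code. Then encode the chunks one after the other. If $Z_c$ is new (different from $Z_1,\dots,Z_{c-1}$), encode it as the bit $1$ followed by $Z_c$. Otherwise encode it as the bit $0$ followed by a pointer of $\lceil\log|\{Z_1,\dots,Z_{c-1}\}|\rceil$ bits into the dictionary of distinct earlier chunks. The expected number of bits is $R_{\mathsf{VL}}(M)$. *Multi-chunk deduplication.* Parse $S$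 from left to right into chunks such that each chunk (except perhaps the last) is the shortest string of length at least $2^{M-1}$ ending in $0^M$. Encode the length of $S$ with the integer code. Then repeat the following, starting at $c=1$. If $Z_c$ is new, let $V$ be the largest integer such that $Z_c,\dots,Z_{c+V-1}$ are all new (each differs from all chunks before it). Write the bit $1$, the codeword of $V$, and $Z_cZ_{c+1}\cdots Z_{c+V-1}$, and continue with chunk $c+V$. Otherwise let $\tilde c<c$ be the smallest index with $Z_{\tilde c}=Z_c$, and let $W$ be the largest integer such that $Z_{\tilde c+i}=Z_{c+i}$ for $0\le i<W$. Write the bit $0$, the codeword of $W$, and a pointer of $\lceil\log|\{Z_1,\dots,Z_{c-1}\}|\rceil$ bits to $Z_{\tilde c}$ in the dictionary of distinct earlier chunks, and continue with chunk $c+W$. The expected number of bits is $R_{\mathsf{MC}}(M)$. **Claim.** There are constants $c,C>0$ and $B_0$ such that for every perfect square $B\ge B_0$ (with $A=L=\sqrt B$) we have $R^\star>0$ and, for every such integer code: 1. for every anchor length $M\ge1$, $\dfrac{R_{\mathsf{VL}}(M)}{R^\star}\ge c\,B^{1/4}\log^{-2}B$, and also $\dfrac{R_{\mathsf{VL}}(M)}{R^\star}\ge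 c\,B^{1/5}$; 2. for some (optimized) anchor length $M\ge1$, $\dfrac{R_{\mathsf{VL}}(M)}{R^\star}\le C\,B^{1/4}$; 3. for some (optimized) anchor length $M\ge1$, $\dfrac{R_{\mathsf{MC}}(M)}{R^\star}\le C$. Hence variable-length deduplication is polynomially suboptimal whatever the anchor length, and its ratio with optimized anchor length lies between $\Omega(B^{1/4}\log^{-2}B)$ and $O(B^{1/4})$, whereas multi-chunk deduplication with optimized anchor length is order optimal. -/

import Mathlib

namespace Dedup

/-! ### Source model with constant symbol length

Bits are Booleans (`false` is `0`, `true` is `1`), and `{0,1}^*` is `List Bool`. -/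

/-- The randomness of the source: the `A` symbols of length `L`, drawn uniformly without
replacement from `{0,1}^L` (an injective family), and, independently, the indices of the `B`
blocks, drawn uniformly with replacement. All outcomes are equally likely. -/
abbrev Outcome (A L B : ℕ) : Type := (Fin A ↪ (Fin L → Bool)) × (Fin B → Fin A)

/-- The source sequence `S = Y_1 Y_2 ⋯ Y_B`, where `Y_b = X_{y b}`; block boundaries are lost. -/
def sourceSequence {A L B : ℕ} (ω : Outcome A L B) : List Bool :=
  (List.ofFn fun b : Fin B => List.ofFn (ω.1 (ω.2 b))).flatten

/-- The expectation of `f S` over the uniformly distributed outcome. -/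
noncomputable def expectation (A L B : ℕ) (f : List Bool → ℝ) : ℝ :=
  (∑ ω : Outcome A L B, f (sourceSequence ω)) / (Fintype.card (Outcome A L B) : ℝ)

/-- The values that `S` takes with positive probability. -/
def sourceSupport (A L B : ℕ) : Set (List Bool) :=
  Set.range (sourceSequence : Outcome A L B → List Bool)

/-- `enc` is prefix free on `T`: no codeword is a prefix of the codeword of another element. -/
def PrefixFreeOn {α : Type*} (T : Set α) (enc : α → List Bool) : Prop :=
  ∀ s ∈ T, ∀ t ∈ T, s ≠ t → ¬ enc s <+: enc t

/-- `R*`: the least expected length of a prefix-free binary source code for `S`. -/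
noncomputable def optimalRate (A L B : ℕ) : ℝ :=
  sInf {r : ℝ | ∃ enc : List Bool → List Bool, PrefixFreeOn (sourceSupport A L B) enc ∧
    r = expectation A L B fun s => ((enc s).length : ℝ)}

/-! ### Prefix-free codes for the positive integers -/

/-- A prefix-free code for the positive integers that spends at most `2 log₂ n + 3` bits on `n`.
The value at `0` is irrelevant. -/
structure IntegerCode where
  enc : ℕ → List Bool
  prefixFree : PrefixFreeOn {n : ℕ | 1 ≤ n} enc
  length_le : ∀ n : ℕ, 1 ≤ n → ((enc n).length : ℝ) ≤ 2 * Real.logb 2 n + 3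

/-- The `w`-bit binary representation of `i`, most significant bit first. -/
def binary (w i : ℕ) : List Bool :=
  (List.range w).map fun k => i.testBit (w - 1 - k)

theorem binary_length (w i : ℕ) : (binary w i).length = w := by
  simp [binary]

theorem binary_inj {w i j : ℕ} (hi : i < 2 ^ w) (hj : j < 2 ^ w)
    (h : binary w i = binary w j) : i = j := by
  refine Nat.eq_of_testBit_eq fun k => ?_
  by_cases hk : k < w
  · have h1 := List.map_inj_left.1 h (w - 1 - k) (by simp; omega)
    have e : w - 1 - (w - 1 - k) = k := by omega
    rwa [e] at h1
  · have hw : 2 ^ w ≤ 2 ^ k := Nat.pow_le_pow_right (by norm_num) (by omega)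
    rw [Nat.testBit_lt_two_pow (hi.trans_le hw), Nat.testBit_lt_two_pow (hj.trans_le hw)]

/-- The Elias gamma codeword: `⌊log₂ n⌋` zeros followed by the binary expansion of `n`. -/
def eliasGammaWord (n : ℕ) : List Bool :=
  List.replicate (Nat.log 2 n) false ++ binary (Nat.log 2 n + 1) n

/-- The Elias gamma code is an example of such a code. -/
def eliasGamma : IntegerCode where
  enc := eliasGammaWord
  prefixFree := by
    have key : ∀ n : ℕ, 1 ≤ n → ∀ k : ℕ, k ≤ Nat.log 2 n →
        (eliasGammaWord n)[k]? = some (decide (k = Nat.log 2 n)) := by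
      intro n hn k hk
      unfold eliasGammaWord
      rcases hk.lt_or_eq with h | h
      · rw [List.getElem?_append_left (by simpa using h)]
        simp [h, h.ne]
      · subst h
        rw [List.getElem?_append_right (by simp)]
        have hb : n.testBit (Nat.log 2 n) = true := by
          rw [Nat.testBit_eq_decide_div_mod_eq]
          have h1 : n / 2 ^ Nat.log 2 n = 1 := by
            apply Nat.div_eq_of_lt_le
            · simpa using Nat.pow_log_le_self 2 (by omega : n ≠ 0)
            · have := Nat.lt_pow_succ_log_self (by norm_num : 1 < 2) n
              rw [pow_succ] at this
              omega
          simp [h1]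
        simp [binary, hb]
    intro m hm n hn hne hp
    have hm' : 1 ≤ m := hm
    have hn' : 1 ≤ n := hn
    obtain ⟨t, ht⟩ := hp
    have hlog : Nat.log 2 m = Nat.log 2 n := by
      have hlen : ∀ k, (eliasGammaWord k).length = Nat.log 2 k + (Nat.log 2 k + 1) := by
        intro k; simp [eliasGammaWord, binary_length]
      have same : ∀ k, k ≤ Nat.log 2 m → (eliasGammaWord n)[k]? = (eliasGammaWord m)[k]? := by
        intro k hk
        rw [← ht, List.getElem?_append_left (by rw [hlen]; omega)]
      rcases lt_trichotomy (Nat.log 2 m) (Nat.log 2 n) with h | h | h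
      · have := same _ le_rfl
        rw [key n hn' _ h.le, key m hm' _ le_rfl] at this
        simp [h.ne] at this
      · exact h
      · have := same _ h.le
        rw [key n hn' _ le_rfl, key m hm' _ h.le] at this
        simp [h.ne] at this
    have ht0 : t = [] := by
      have := congrArg List.length ht
      simp only [eliasGammaWord, List.length_append, List.length_replicate, binary_length,
        hlog] at this
      exact List.length_eq_zero_iff.1 (by omega)
    subst ht0
    simp only [eliasGammaWord, hlog, List.append_nil, List.append_cancel_left_eq] at ht
    apply hne
    refine binary_inj ?_ (Nat.lt_pow_succ_log_self (by norm_num) n) ht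
    rw [← hlog]
    exact Nat.lt_pow_succ_log_self (by norm_num) m
  length_le := by
    intro n hn
    have h : (Nat.log 2 n : ℝ) ≤ Real.logb 2 n := by
      rw [Real.le_logb_iff_rpow_le (by norm_num) (by exact_mod_cast hn)]
      have := Nat.pow_log_le_self 2 (by omega : n ≠ 0)
      rw [Real.rpow_natCast]
      exact_mod_cast this
    simp only [eliasGammaWord, List.length_append, List.length_replicate, binary_length]
    push_cast
    linarith

/-! ### Chunking -/

/-- Parse a sequence from left to right. A chunk is closed as soon as it satisfies `closes`, and the
next chunk starts afresh; the last chunk may be incomplete. `cur` is the chunk under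
construction. -/
def chunkWith (closes : List Bool → Bool) : List Bool → List Bool → List (List Bool)
  | cur, [] => if cur = [] then [] else [cur]
  | cur, b :: s =>
    if closes (cur ++ [b]) then (cur ++ [b]) :: chunkWith closes [] s
    else chunkWith closes (cur ++ [b]) s

/-- Variable-length chunks: each chunk (except perhaps the last) ends at the first appearance in it
of the anchor `0^M`. -/
def chunksVL (M : ℕ) (s : List Bool) : List (List Bool) :=
  chunkWith (fun z => decide (List.replicate M false <:+ z)) [] s

/-- Chunks of the multi-chunk scheme: each chunk (except perhaps the last) is the shortest string of
length at least `2^(M-1)` ending in the anchor `0^M`. -/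
def chunksMC (M : ℕ) (s : List Bool) : List (List Bool) :=
  chunkWith (fun z => decide (2 ^ (M - 1) ≤ z.length ∧ List.replicate M false <:+ z)) [] s

/-! ### Encoders -/

/-- The dictionary after the chunks `past`: the distinct chunks in the order of their first
appearance. -/
def dictionary (past : List (List Bool)) : List (List Bool) :=
  past.foldl (fun d z => if z ∈ d then d else d ++ [z]) []

/-- A pointer to the entry `z` of the dictionary `d`, using `⌈log₂ |d|⌉` bits. -/
def pointer (d : List (List Bool)) (z : List Bool) : List Bool :=
  binary (Nat.clog 2 d.length) (d.idxOf z)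

/-- Variable-length deduplication of a list of chunks, after the chunks `past`: a new chunk is
encoded as `1` followed by itself, an old one as `0` followed by a pointer. -/
def encodeChunksVL : List (List Bool) → List (List Bool) → List Bool
  | _, [] => []
  | past, z :: zs =>
    (if z ∈ past then false :: pointer (dictionary past) z else true :: z) ++
      encodeChunksVL (past ++ [z]) zs

/-- Variable-length deduplication with anchor length `M`. -/
def encodeVL (code : IntegerCode) (M : ℕ) (s : List Bool) : List Bool :=
  code.enc s.length ++ encodeChunksVL [] (chunksVL M s)

/-- The number of chunks at the start of the list that are all new, after the chunks `past`. A chunk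
is new if it differs from all chunks before it. -/
def newRun : List (List Bool) → List (List Bool) → ℕ
  | _, [] => 0
  | past, z :: zs => if z ∈ past then 0 else newRun (past ++ [z]) zs + 1

/-- The length of the longest common prefix of two lists of chunks. -/
def matchLength : List (List Bool) → List (List Bool) → ℕ
  | x :: xs, z :: zs => if x = z then matchLength xs zs + 1 else 0
  | _, _ => 0

/-- Multi-chunk deduplication of a list of chunks, after the chunks `past`. Let `z` be the next
chunk. If `z` is new, then `V = v + 1` is the number of consecutive new chunks starting at `z`; they
are encoded jointly as `1`, the codeword of `V`, and their concatenation. If `z` is old, then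
`W = w + 1` is the largest number of consecutive chunks starting at `z` which agree with those
starting at the first appearance of `z`; they are encoded jointly as `0`, the codeword of `W`, and
a pointer to `z`. -/
def encodeChunksMC (code : IntegerCode) : List (List Bool) → List (List Bool) → List Bool
  | _, [] => []
  | past, z :: zs =>
    if z ∈ past then
      let w := matchLength ((past ++ z :: zs).drop (past.idxOf z + 1)) zs
      (false :: code.enc (w + 1)) ++ pointer (dictionary past) z ++
        encodeChunksMC code (past ++ z :: zs.take w) (zs.drop w)
    else
      let v := newRun (past ++ [z]) zs
      (true :: code.enc (v + 1)) ++ (z :: zs.take v).flatten ++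
        encodeChunksMC code (past ++ z :: zs.take v) (zs.drop v)
  termination_by _ rest => rest.length
  decreasing_by all_goals (simp only [List.length_drop, List.length_cons]; omega)

/-- Multi-chunk deduplication with anchor length `M`. -/
def encodeMC (code : IntegerCode) (M : ℕ) (s : List Bool) : List Bool :=
  code.enc s.length ++ encodeChunksMC code [] (chunksMC M s)

/-! ### Rates -/

/-- `R_VL`: the expected number of bits of variable-length deduplication with anchor length `M`. -/
noncomputable def rateVL (code : IntegerCode) (M A L B : ℕ) : ℝ :=
  expectation A L B fun s => ((encodeVL code M s).length : ℝ)

/-- `R_MC`: the expected number of bits of multi-chunk deduplication with anchor length `M`. -/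
noncomputable def rateMC (code : IntegerCode) (M A L B : ℕ) : ℝ :=
  expectation A L B fun s => ((encodeMC code M s).length : ℝ)

end Dedup

/-!
Write `A = L = n` and `B = n ^ 2`, so that the source sequence has `n ^ 3` bits. Logarithms enter
through the integer part `ν` of `log₂ n`, and `√n` through a power `2 ^ m` (`Dedup.Scales`).

*The optimal rate* is `n ^ 2 log n` up to constants. An outcome can be described by the bits of the
symbols and the indices of the blocks (`optimalRate_le`), while for given symbols the `n ^ 2` block
indices can be recovered from the source sequence (`le_optimalRate`).

*Upper bounds.* Both chunking rules close a chunk at the first anchor `0^M` after at least `h` bits,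
with `h = M` and `h = 2 ^ (M - 1)` respectively. A stretch of `h` bits in which no anchor ends forces
a cut at the next anchor, whatever came before (`cut_of_gap`). Such a synchronising stretch is found
in each window of length `O(2 ^ M)` of a symbol with probability at least `1 / 4`. Between the first
and the last of them, all blocks with the same symbol are cut into the same chunks, so each block
contributes only `O(2 ^ M)` bits of new chunks on average (`newLength_chunks_le`,
`sum_card_unsynced_le`).

For variable-length deduplication there are about `n ^ 3 / 2 ^ M` chunks, each of which costs at most
`O(log n)` bits in addition; with `2 ^ M ≈ √n` the total is `O(n ^ 2 √n log n)`.

For multi-chunk deduplication, `2 ^ M` is chosen of order `log n`, so that with high probability all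
substrings of half the minimal chunk length in the symbols differ. Then a chunk inside a block
determines its symbol and its offset there, and a phrase that starts with an old chunk inside a block
covers all chunks inside this block. Hence each block has `O(1)` phrases, of `O(log n)` bits each, in
addition to `O(log n)` new bits (`phraseCount_chunks_le`).

*Lower bound.* If `2 ^ M ≤ √n`, then there are at least about `n ^ 3 / (M 2 ^ M)` chunks, and each
costs at least one bit (`le_rateVL_of_short`). If `2 ^ M` is larger, then the stretches of length of
order `√n` around most block boundaries contain no anchor, and so each lies in one chunk. Among the
first `n ^ 2 / 4` boundaries, a positive fraction separate a pair of symbols that has not been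
adjacent before, and the substrings across these boundaries are distinct. Since the distinct chunks
have at least as many bits as they have distinct substrings of one length, a total of order
`n ^ 2 √n` new bits must be written (`mul_card_le_newLength`, `le_rateVL_of_long`).

The source draws its symbols without replacement. Expectations are computed for independent symbols,
which are distinct with probability at least `1 / 2`, and transferred by
`expectation_le_two_mul_mean` and `mean_le_expectation`.
-/

namespace Dedup

/-! ### Lengths of the encodings in terms of the chunk list -/

/-- The total length of the distinct chunks of `zs` that do not occur in `past`. -/
def newLength (past zs : List (List Bool)) : ℕ :=
  ∑ z ∈ zs.toFinset \ past.toFinset, z.length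

theorem newLength_nil (past : List (List Bool)) : newLength past [] = 0 := by
  simp [newLength]

theorem newLength_append (past T R : List (List Bool)) :
    newLength past (T ++ R) = newLength past T + newLength (past ++ T) R := by
  unfold newLength
  rw [← Finset.sum_union]
  · congr 1
    ext z
    simp only [List.toFinset_append, Finset.mem_sdiff, Finset.mem_union, List.mem_toFinset]
    tauto
  · rw [Finset.disjoint_left]
    intro z
    simp only [List.toFinset_append, Finset.mem_sdiff, Finset.mem_union, List.mem_toFinset]
    tauto

theorem newLength_singleton (past : List (List Bool)) (z : List Bool) :
    newLength past [z] = if z ∈ past then 0 else z.length := by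
  unfold newLength
  split_ifs with h
  · apply Finset.sum_eq_zero
    intro x hx
    simp only [List.toFinset_cons, List.toFinset_nil, insert_empty_eq, Finset.mem_sdiff,
      Finset.mem_singleton, List.mem_toFinset] at hx
    exact absurd (hx.1 ▸ h) hx.2
  · have : [z].toFinset \ past.toFinset = {z} := by
      ext x
      simp only [List.toFinset_cons, List.toFinset_nil, insert_empty_eq, Finset.mem_sdiff,
        Finset.mem_singleton, List.mem_toFinset]
      constructor
      · exact fun hx => hx.1
      · rintro rfl
        exact ⟨rfl, h⟩
    rw [this, Finset.sum_singleton]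

theorem newLength_cons (past : List (List Bool)) (z : List Bool) (zs : List (List Bool)) :
    newLength past (z :: zs) =
      (if z ∈ past then 0 else z.length) + newLength (past ++ [z]) zs := by
  rw [← newLength_singleton, ← newLength_append]
  rfl

theorem length_dictionary_le (past : List (List Bool)) :
    (dictionary past).length ≤ past.length := by
  have key : ∀ (l d : List (List Bool)),
      (l.foldl (fun d z => if z ∈ d then d else d ++ [z]) d).length ≤ d.length + l.length := by
    intro l
    induction l with
    | nil => intro d; simp
    | cons z l ih =>
      intro d
      rw [List.foldl_cons]
      refine (ih _).trans ?_
      split_ifs <;> simp <;> omega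
  simpa [dictionary] using key past []

theorem length_pointer_le {past : List (List Bool)} (z : List Bool) {D : ℕ}
    (hD : past.length ≤ D) : (pointer (dictionary past) z).length ≤ Nat.clog 2 D := by
  rw [pointer, binary_length]
  exact Nat.clog_mono_right 2 ((length_dictionary_le past).trans hD)

theorem length_le_length_encodeChunksVL (past zs : List (List Bool)) :
    zs.length ≤ (encodeChunksVL past zs).length := by
  induction zs generalizing past with
  | nil => simp
  | cons z zs ih =>
    have := ih (past ++ [z])
    rw [encodeChunksVL]
    split_ifs <;> simp only [List.length_append, List.length_cons] <;> omega

theorem newLength_le_length_encodeChunksVL (past zs : List (List Bool)) :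
    newLength past zs ≤ (encodeChunksVL past zs).length := by
  induction zs generalizing past with
  | nil => simp [newLength_nil]
  | cons z zs ih =>
    have := ih (past ++ [z])
    rw [encodeChunksVL, newLength_cons]
    split_ifs <;> simp only [List.length_append, List.length_cons] <;> omega

theorem length_encodeChunksVL_le (past zs : List (List Bool)) {D : ℕ}
    (hD : past.length + zs.length ≤ D) :
    (encodeChunksVL past zs).length ≤ zs.length * (1 + Nat.clog 2 D) + newLength past zs := by
  induction zs generalizing past with
  | nil => simp [encodeChunksVL]
  | cons z zs ih =>
    simp only [List.length_cons] at hD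
    have h1 := ih (past ++ [z]) (by simp; omega)
    have h2 := length_pointer_le (past := past) z (D := D) (by omega)
    rw [encodeChunksVL, newLength_cons, List.length_cons, Nat.succ_mul]
    split_ifs <;> simp only [List.length_append, List.length_cons] <;> omega

/-- The number of phrases (jointly encoded runs of chunks) that multi-chunk deduplication writes
for the chunks `zs` after the chunks `past`. -/
def phraseCount : List (List Bool) → List (List Bool) → ℕ
  | _, [] => 0
  | past, z :: zs =>
    if z ∈ past then
      let w := matchLength ((past ++ z :: zs).drop (past.idxOf z + 1)) zs
      phraseCount (past ++ z :: zs.take w) (zs.drop w) + 1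
    else
      let v := newRun (past ++ [z]) zs
      phraseCount (past ++ z :: zs.take v) (zs.drop v) + 1
  termination_by _ rest => rest.length
  decreasing_by all_goals (simp only [List.length_drop, List.length_cons]; omega)

theorem newRun_le (past zs : List (List Bool)) : newRun past zs ≤ zs.length := by
  induction zs generalizing past with
  | nil => simp [newRun]
  | cons z zs ih =>
    have := ih (past ++ [z])
    rw [newRun]
    split_ifs
    · simp
    · simpa using this

theorem matchLength_le (xs zs : List (List Bool)) : matchLength xs zs ≤ zs.length := by
  induction zs generalizing xs with
  | nil => cases xs <;> simp [matchLength]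
  | cons z zs ih =>
    cases xs with
    | nil => simp [matchLength]
    | cons x xs =>
      have := ih xs
      rw [matchLength]
      split_ifs
      · simpa using this
      · simp

theorem phraseCount_le_length (past zs : List (List Bool)) :
    phraseCount past zs ≤ zs.length := by
  induction hn : zs.length using Nat.strong_induction_on generalizing past zs with
  | _ n ih =>
    cases zs with
    | nil => simp [phraseCount]
    | cons z zs =>
      simp only [List.length_cons] at hn
      rw [phraseCount]
      have key : ∀ p k, phraseCount p (zs.drop k) ≤ zs.length := by
        intro p k
        have h1 : (zs.drop k).length ≤ zs.length := by simp
        exact (ih _ (by omega) p _ rfl).trans h1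
      split_ifs
      · have := key (past ++ z :: zs.take (matchLength ((past ++ z :: zs).drop
          (past.idxOf z + 1)) zs)) (matchLength ((past ++ z :: zs).drop (past.idxOf z + 1)) zs)
        simp only
        omega
      · have := key (past ++ z :: zs.take (newRun (past ++ [z]) zs)) (newRun (past ++ [z]) zs)
        simp only
        omega

/-- The chunks of a run of new chunks are distinct, so that their concatenation is as long as the
distinct new chunks together. -/
theorem length_flatten_take_newRun (past zs : List (List Bool)) :
    ((zs.take (newRun past zs)).flatten).length = newLength past (zs.take (newRun past zs)) := by
  induction zs generalizing past with
  | nil => simp [newLength_nil]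
  | cons z zs ih =>
    rw [newRun]
    split_ifs with h
    · simp [newLength_nil]
    · rw [List.take_succ_cons, newLength_cons, if_neg h, ← ih]
      simp

theorem length_encodeChunksMC_le (code : IntegerCode) {D K : ℕ}
    (hK : ∀ v, 1 ≤ v → v ≤ D → 1 + (code.enc v).length + Nat.clog 2 D ≤ K)
    (past zs : List (List Bool)) (hD : past.length + zs.length ≤ D) :
    (encodeChunksMC code past zs).length ≤ phraseCount past zs * K + newLength past zs := by
  induction hn : zs.length using Nat.strong_induction_on generalizing past zs with
  | _ n ih =>
    cases zs with
    | nil => simp [encodeChunksMC]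
    | cons z zs =>
      simp only [List.length_cons] at hn hD
      have split : ∀ k, newLength past (z :: zs) =
          newLength past (z :: zs.take k) + newLength (past ++ z :: zs.take k) (zs.drop k) := by
        intro k
        rw [← newLength_append, List.cons_append, List.take_append_drop]
      have key : ∀ k, (encodeChunksMC code (past ++ z :: zs.take k) (zs.drop k)).length ≤
          phraseCount (past ++ z :: zs.take k) (zs.drop k) * K +
            newLength (past ++ z :: zs.take k) (zs.drop k) := by
        intro k
        have h1 : (zs.take k).length + (zs.drop k).length = zs.length := by
          rw [← List.length_append, List.take_append_drop]
        refine ih (zs.drop k).length (by omega) _ _ ?_ rfl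
        simp only [List.length_append, List.length_cons]
        omega
      have hp := length_pointer_le (past := past) z (D := D) (by omega)
      rw [encodeChunksMC, phraseCount]
      by_cases hz : z ∈ past
      · rw [if_pos hz, if_pos hz]
        have hw := matchLength_le ((past ++ z :: zs).drop (past.idxOf z + 1)) zs
        simp only
        generalize matchLength ((past ++ z :: zs).drop (past.idxOf z + 1)) zs = w at *
        have h1 := key w
        have h2 := hK (w + 1) (by omega) (by omega)
        rw [split w, Nat.succ_mul]
        simp only [List.length_append, List.length_cons]
        omega
      · rw [if_neg hz, if_neg hz]
        have hv := newRun_le (past ++ [z]) zs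
        have hf := length_flatten_take_newRun (past ++ [z]) zs
        simp only
        generalize newRun (past ++ [z]) zs = v at *
        have h1 := key v
        have h2 := hK (v + 1) (by omega) (by omega)
        have h3 : newLength past (z :: zs.take v) = (z :: zs.take v).flatten.length := by
          rw [newLength_cons, if_neg hz, ← hf]
          simp
        rw [split v, Nat.succ_mul, h3]
        simp only [List.length_append, List.length_cons]
        omega

/-! ### Parsing a bit sequence: cuts and synchronisation -/

/-- The substring of `k` bits of the sequence `σ` that starts at position `a`. -/
def slice (σ : ℕ → Bool) (a k : ℕ) : List Bool := (List.range' a k).map σ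

@[simp] theorem slice_length (σ : ℕ → Bool) (a k : ℕ) : (slice σ a k).length = k := by
  simp [slice]

theorem slice_append (σ : ℕ → Bool) (a j k : ℕ) :
    slice σ a j ++ slice σ (a + j) k = slice σ a (j + k) := by
  rw [slice, slice, slice, ← List.map_append, List.range'_append_1]

theorem slice_eq_slice {σ τ : ℕ → Bool} {a b k : ℕ} :
    slice σ a k = slice τ b k ↔ ∀ t < k, σ (a + t) = τ (b + t) := by
  constructor
  · intro h t ht
    have := congrArg (fun l => l[t]?) h
    simpa [slice, ht] using this
  · intro h
    apply List.ext_getElem (by simp)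
    intro t h1 h2
    simp only [slice_length] at h1
    simpa [slice] using h t h1

theorem eq_slice_of_append {σ : ℕ → Bool} {a k : ℕ} {u v : List Bool}
    (h : slice σ a k = u ++ v) :
    u = slice σ a u.length ∧ v = slice σ (a + u.length) v.length ∧ u.length + v.length = k := by
  have hk : u.length + v.length = k := by
    rw [← List.length_append, ← h, slice_length]
  rw [← hk, ← slice_append] at h
  have := List.append_inj h (by simp)
  exact ⟨this.1.symm, this.2.symm, hk⟩

/-- The anchor `0^M` ends right before position `e` of the sequence `σ`. -/
def AnchorEnd (σ : ℕ → Bool) (M e : ℕ) : Prop :=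
  M ≤ e ∧ ∀ t, e ≤ t + M → t < e → σ t = false

theorem AnchorEnd.mono {σ : ℕ → Bool} {M m e : ℕ} (h : AnchorEnd σ M e) (hm : m ≤ M) :
    AnchorEnd σ m e :=
  ⟨hm.trans h.1, fun t h1 h2 => h.2 t (by omega) h2⟩

theorem AnchorEnd.shift {σ τ : ℕ → Bool} {M a b k m : ℕ}
    (hστ : ∀ t < m, σ (a + t) = τ (b + t)) (h : AnchorEnd σ M (a + k)) (hM : M ≤ k)
    (hk : k ≤ m) : AnchorEnd τ M (b + k) := by
  refine ⟨by omega, fun t h1 h2 => ?_⟩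
  obtain ⟨s, rfl⟩ : ∃ s, t = b + s := ⟨t - b, by omega⟩
  rw [← hστ s (by omega)]
  exact h.2 _ (by omega) (by omega)

/-- The common form of the two chunking rules: a chunk is closed once it has at least `h` bits and
ends in `0^M`. -/
def closes (M h : ℕ) (z : List Bool) : Bool :=
  decide (h ≤ z.length ∧ List.replicate M false <:+ z)

theorem closes_slice {σ : ℕ → Bool} {M h a k : ℕ} (hM : M ≤ h) :
    closes M h (slice σ a k) = true ↔ h ≤ k ∧ AnchorEnd σ M (a + k) := by
  simp only [closes, decide_eq_true_eq, slice_length]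
  refine and_congr_right fun hk => ?_
  obtain ⟨j, rfl⟩ : ∃ j, k = j + M := ⟨k - M, by omega⟩
  rw [List.suffix_iff_eq_drop, ← slice_append]
  simp only [List.length_append, slice_length, List.length_replicate, Nat.add_sub_cancel]
  rw [List.drop_left' (by simp), eq_comm, List.eq_replicate_iff]
  rw [and_iff_right (slice_length _ _ _)]
  simp only [slice, List.mem_map, List.mem_range'_1]
  constructor
  · intro h
    exact ⟨by omega, fun t h1 h2 => h _ ⟨t, ⟨by omega, by omega⟩, rfl⟩⟩
  · rintro ⟨-, h⟩ b ⟨t, ⟨h1, h2⟩, rfl⟩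
    exact h t (by omega) (by omega)

/-- The chunks of the first `N` bits of the sequence `σ`, with anchor `0^M` and least chunk
length `h`. -/
def chunks (M h : ℕ) (σ : ℕ → Bool) (N : ℕ) : List (List Bool) :=
  chunkWith (closes M h) [] (slice σ 0 N)

theorem chunksVL_slice (M : ℕ) (σ : ℕ → Bool) (N : ℕ) :
    chunksVL M (slice σ 0 N) = chunks M M σ N := by
  unfold chunksVL chunks
  congr 1
  funext z
  simp only [closes, decide_eq_decide]
  refine ⟨fun h => ⟨?_, h⟩, fun h => h.2⟩
  simpa using h.length_le

theorem chunksMC_slice (M : ℕ) (σ : ℕ → Bool) (N : ℕ) :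
    chunksMC M (slice σ 0 N) = chunks M (2 ^ (M - 1)) σ N := rfl

/-- The first chunk of a parse: no proper extension of `cur` inside it closes, and it closes unless
the sequence is exhausted. -/
theorem chunkWith_spec (c : List Bool → Bool) (s cur : List Bool) (hne : cur ++ s ≠ []) :
    ∃ z s', cur ++ s = z ++ s' ∧ z ≠ [] ∧
      chunkWith c cur s = z :: chunkWith c [] s' ∧ cur.length ≤ z.length ∧
      (∀ u, u <+: z → cur.length < u.length → u.length < z.length → c u = false) ∧
      (s' ≠ [] → c z = true) := by
  induction s generalizing cur with
  | nil =>
    simp only [List.append_nil] at hne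
    exact ⟨cur, [], rfl, hne, by simp [chunkWith, hne], le_rfl,
      fun u _ h1 h2 => absurd h1 (by omega), by simp⟩
  | cons b s ih =>
    by_cases hc : c (cur ++ [b]) = true
    · refine ⟨cur ++ [b], s, by simp, by simp, by simp [chunkWith, hc], by simp,
        fun u _ h1 h2 => ?_, fun _ => hc⟩
      simp at h2
      omega
    · obtain ⟨z, s', h1, h2, h3, h4, h5, h6⟩ := ih (cur ++ [b]) (by simp)
      have h4' : cur.length + 1 ≤ z.length := by simpa using h4
      refine ⟨z, s', by simpa using h1, h2, by simp [chunkWith, hc, h3], by omega,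
        fun u hu hl hl' => ?_, h6⟩
      rcases Nat.lt_or_ge (cur.length + 1) u.length with h | h
      · exact h5 u hu (by simpa using h) hl'
      · have hp : cur ++ [b] <+: z := by
          refine List.prefix_of_prefix_length_le (List.prefix_append _ s) ?_ h4
          rw [h1]
          exact List.prefix_append _ _
        have : u = cur ++ [b] := by
          refine (List.prefix_of_prefix_length_le hu hp (by simpa using h)).eq_of_length ?_
          simp
          omega
        rw [this]
        simpa using hc

/-- The interval `[a, e)` is what the parse of `N` bits yields as the chunk that starts at `a`. -/
structure IsChunk (M h : ℕ) (σ : ℕ → Bool) (N a e : ℕ) : Prop where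
  lt : a < e
  le : e ≤ N
  not_anchorEnd : ∀ e', a + h ≤ e' → e' < e → ¬ AnchorEnd σ M e'
  min_le : e < N → a + h ≤ e
  anchorEnd : e < N → AnchorEnd σ M e

theorem IsChunk.le_of_anchorEnd {M h : ℕ} {σ : ℕ → Bool} {N a e e' : ℕ}
    (hc : IsChunk M h σ N a e) (h1 : a + h ≤ e') (h2 : AnchorEnd σ M e') : e ≤ e' := by
  by_contra hlt
  exact hc.not_anchorEnd e' h1 (by omega) h2

section

variable {M h : ℕ} {σ : ℕ → Bool} {N : ℕ}

/-- The parse is memoryless: after the chunks `P`, it starts afresh at the position where they end,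
which is `P.flatten.length`. -/
theorem chunks_append {P Q : List (List Bool)} (hZ : chunks M h σ N = P ++ Q) :
    P.flatten.length ≤ N ∧
      Q = chunkWith (closes M h) [] (slice σ P.flatten.length (N - P.flatten.length)) := by
  induction P using List.reverseRecOn generalizing Q with
  | nil => exact ⟨by simp, by simpa [chunks] using hZ.symm⟩
  | append_singleton P z ih =>
    rw [List.append_assoc] at hZ
    obtain ⟨h1, h2⟩ := ih hZ
    set a := P.flatten.length
    by_cases hs : slice σ a (N - a) = []
    · rw [hs] at h2
      simp [chunkWith] at h2
    · obtain ⟨z', s', e1, -, e2, -⟩ := chunkWith_spec (closes M h) _ [] (by simpa using hs)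
      rw [e2] at h2
      simp only [List.cons_append, List.nil_append, List.cons.injEq] at h2
      obtain ⟨rfl, h2⟩ := h2
      rw [List.nil_append] at e1
      obtain ⟨-, e3, e4⟩ := eq_slice_of_append e1
      have e5 : (P ++ [z]).flatten.length = a + z.length := by
        simp only [List.flatten_append, List.length_append]
        simp [a]
      rw [e5]
      refine ⟨by omega, ?_⟩
      rw [h2, e3]
      congr 2
      omega

theorem chunks_append_cons (hM : 1 ≤ M) (hMh : M ≤ h) {P Q : List (List Bool)} {z : List Bool}
    (hZ : chunks M h σ N = P ++ z :: Q) :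
    IsChunk M h σ N P.flatten.length (P.flatten.length + z.length) ∧
      z = slice σ P.flatten.length z.length := by
  obtain ⟨h1, h2⟩ := chunks_append hZ
  set a := P.flatten.length
  by_cases hs : slice σ a (N - a) = []
  · rw [hs] at h2
    simp [chunkWith] at h2
  obtain ⟨z', s', e1, e0, e2, -, e6, e7⟩ := chunkWith_spec (closes M h) _ [] (by simpa using hs)
  rw [e2] at h2
  obtain ⟨rfl, h2⟩ := List.cons.inj h2
  rw [List.nil_append] at e1
  obtain ⟨e3, e4, e5⟩ := eq_slice_of_append e1
  have hpos := List.length_pos_iff.2 e0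
  have hcl : a + z.length < N → closes M h z = true := by
    intro hlt
    apply e7
    intro hs'
    rw [hs'] at e5
    simp at e5
    omega
  have hcl' : a + z.length < N → h ≤ z.length ∧ AnchorEnd σ M (a + z.length) := by
    intro hlt
    have := hcl hlt
    rwa [e3, closes_slice hMh] at this
  refine ⟨⟨by omega, by omega, ?_, ?_, ?_⟩, e3⟩
  · intro e' ha he hA
    obtain ⟨k, rfl⟩ : ∃ k, e' = a + k := ⟨e' - a, by omega⟩
    have hu := e6 (slice σ a k) ?_ (by simp; omega) (by simp; omega)
    · have := (closes_slice (σ := σ) (a := a) (k := k) hMh).2 ⟨by omega, hA⟩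
      simp [this] at hu
    · rw [e3]
      obtain ⟨j, hj⟩ : ∃ j, z.length = k + j := ⟨z.length - k, by omega⟩
      rw [hj, ← slice_append]
      exact List.prefix_append _ _
  · intro hlt
    have := (hcl' hlt).1
    omega
  · exact fun hlt => (hcl' hlt).2

theorem chunks_append_nil {P : List (List Bool)} (hZ : chunks M h σ N = P) :
    P.flatten.length = N := by
  obtain ⟨h1, h2⟩ := chunks_append (Q := []) (by simpa using hZ)
  by_contra hne
  obtain ⟨z', s', -, -, e2, -⟩ := chunkWith_spec (closes M h)
    (slice σ P.flatten.length (N - P.flatten.length)) [] (by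
      intro h
      have := congrArg List.length h
      rw [List.nil_append, slice_length, List.length_nil] at this
      omega)
  rw [e2] at h2
  simp at h2

/-- The position `g` lies in a chunk. -/
theorem exists_chunk_at {Z : List (List Bool)} {g : ℕ} (hg : g < Z.flatten.length) :
    ∃ P z Q, Z = P ++ z :: Q ∧ P.flatten.length ≤ g ∧ g < P.flatten.length + z.length := by
  induction Z generalizing g with
  | nil => simp at hg
  | cons x Z ih =>
    rw [List.flatten_cons, List.length_append] at hg
    rcases Nat.lt_or_ge g x.length with h | h
    · exact ⟨[], x, Z, rfl, by simp, by simpa using h⟩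
    · obtain ⟨P, z, Q, h1, h2, h3⟩ := ih (g := g - x.length) (by omega)
      refine ⟨x :: P, z, Q, by rw [h1]; rfl, ?_, ?_⟩ <;>
      · rw [List.flatten_cons, List.length_append]
        omega

theorem exists_chunk_containing (hM : 1 ≤ M) (hMh : M ≤ h) {g : ℕ} (hg : g < N) :
    ∃ P z Q, chunks M h σ N = P ++ z :: Q ∧ P.flatten.length ≤ g ∧
      g < P.flatten.length + z.length ∧
      IsChunk M h σ N P.flatten.length (P.flatten.length + z.length) ∧
      z = slice σ P.flatten.length z.length := by
  obtain ⟨P, z, Q, h1, h2, h3⟩ := exists_chunk_at (Z := chunks M h σ N) (g := g)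
    (by rwa [chunks_append_nil rfl])
  exact ⟨P, z, Q, h1, h2, h3, chunks_append_cons hM hMh h1⟩

/-- Synchronisation: a stretch of length `h` without ends of anchors forces a cut at the next end of
an anchor, whatever came before. -/
theorem cut_of_gap (hM : 1 ≤ M) (hMh : M ≤ h) {g e : ℕ} (hge : g + h ≤ e) (heN : e ≤ N)
    (hgap : ∀ e', g < e' → e' < e → ¬ AnchorEnd σ M e') (he : AnchorEnd σ M e) :
    ∃ P Q, chunks M h σ N = P ++ Q ∧ P.flatten.length = e := by
  obtain ⟨P, z, Q, h1, h2, h3, h4, -⟩ :=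
    exists_chunk_containing (σ := σ) (N := N) hM hMh (g := g) (by omega)
  refine ⟨P ++ [z], Q, by simpa using h1, ?_⟩
  have h5 := h4.le_of_anchorEnd (by omega) he
  have h6 : ¬ P.flatten.length + z.length < e := by
    intro hlt
    exact hgap _ h3 hlt (h4.anchorEnd (by omega))
  simp only [List.flatten_append, List.length_append, List.flatten_cons, List.flatten_nil,
    List.length_nil]
  omega

/-- Two cuts followed by the same bits are followed by the same chunks. -/
theorem chunks_append_of_agree (hM : 1 ≤ M) (hMh : M ≤ h) {P P' T R : List (List Bool)}
    (hZ : chunks M h σ N = P ++ (T ++ R)) (hR : R ≠ [])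
    {Q' : List (List Bool)} (hZ' : chunks M h σ N = P' ++ Q')
    (hag : ∀ t < T.flatten.length, σ (P.flatten.length + t) = σ (P'.flatten.length + t))
    (hN : P'.flatten.length + T.flatten.length ≤ N) :
    ∃ R', chunks M h σ N = P' ++ (T ++ R') := by
  induction T generalizing P P' Q' with
  | nil => exact ⟨Q', hZ'⟩
  | cons z T ih =>
    rw [List.cons_append] at hZ
    obtain ⟨hc, hz⟩ := chunks_append_cons hM hMh hZ
    rw [List.flatten_cons, List.length_append] at hag hN
    set a := P.flatten.length with ha
    set b := P'.flatten.length with hb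
    have hza : z.length ≥ 1 := by have := hc.lt; omega
    have haz : (P ++ [z]).flatten.length = a + z.length := by
      simp [ha]
    -- the chunk `z` is not the last one, so it ends in an anchor
    have hlt : a + z.length < N := by
      obtain ⟨w, W, hw⟩ : ∃ w W, T ++ R = w :: W := by
        cases T with
        | nil => cases R with
          | nil => exact absurd rfl hR
          | cons w W => exact ⟨w, W, rfl⟩
        | cons w W => exact ⟨w, W ++ R, rfl⟩
      have h1 := (chunks_append_cons (P := P ++ [z]) (z := w) (Q := W) hM hMh
        (by rw [hZ, hw]; simp)).1
      have h2 := h1.lt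
      have h3 := h1.le
      omega
    cases Q' with
    | nil =>
      have := chunks_append_nil hZ'
      simp only [List.append_nil] at this
      omega
    | cons z' Q' =>
      obtain ⟨hc', hz'⟩ := chunks_append_cons hM hMh hZ'
      rw [← hb] at hc' hz'
      have hle : z'.length ≤ z.length := by
        have := hc'.le_of_anchorEnd (e' := b + z.length) (by have := hc.min_le hlt; omega)
          ((hc.anchorEnd hlt).shift hag (by have := hc.min_le hlt; omega) (by omega))
        omega
      have hge : z.length ≤ z'.length := by
        by_contra hlt'
        have h1 := hc'.anchorEnd (by omega)
        have h2 := hc'.min_le (by omega)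
        refine hc.not_anchorEnd (a + z'.length) (by omega) (by omega) ?_
        exact h1.shift (m := z.length + T.flatten.length) (fun t ht => (hag t ht).symm) (by omega)
          (by omega)
      have hzz : z' = z := by
        rw [hz', hz, le_antisymm hle hge]
        exact slice_eq_slice.2 fun t ht => (hag t (by omega)).symm
      subst hzz
      have hbz : (P' ++ [z']).flatten.length = b + z'.length := by
        simp [hb]
      obtain ⟨R', hR'⟩ := ih (P := P ++ [z']) (P' := P' ++ [z']) (Q' := Q')
        (by rw [hZ]; simp) (by rw [hZ']; simp)
        (by
          intro t ht
          rw [haz, hbz, Nat.add_assoc, Nat.add_assoc]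
          exact hag _ (by omega))
        (by rw [hbz]; omega)
      exact ⟨R', by rw [hR']; simp⟩

/-- Among two initial segments of the chunk list, the one that ends earlier is a prefix of the
other. -/
theorem prefix_of_flatten_length_le (hM : 1 ≤ M) (hMh : M ≤ h) {P Q P' Q' : List (List Bool)}
    (hZ : chunks M h σ N = P ++ Q) (hZ' : chunks M h σ N = P' ++ Q')
    (hle : P.flatten.length ≤ P'.flatten.length) : P <+: P' := by
  have h1 : P <+: chunks M h σ N := ⟨Q, hZ.symm⟩
  have h2 : P' <+: chunks M h σ N := ⟨Q', hZ'.symm⟩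
  rcases List.prefix_or_prefix_of_prefix h1 h2 with h3 | ⟨T, rfl⟩
  · exact h3
  · cases T with
    | nil => simp
    | cons z T =>
      have := (chunks_append_cons (P := P') (z := z) (Q := T ++ Q) hM hMh (by rw [hZ]; simp)).1.lt
      rw [List.flatten_append, List.length_append, List.flatten_cons, List.length_append] at hle
      omega

end

/-! ### Counting chunks, and the total length of the distinct ones -/

theorem flatten_length_concat (Z : List (List Bool)) (z : List Bool) :
    (Z ++ [z]).flatten.length = Z.flatten.length + z.length := by
  rw [List.flatten_append, List.length_append, List.flatten_singleton]

/-- If each chunk contains at most one of the positions `W`, then there are at least as many chunks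
as positions. -/
theorem card_filter_lt_le_length (W : Finset ℕ) (Z : List (List Bool))
    (h : ∀ P z Q, Z = P ++ z :: Q → ∀ p ∈ W, ∀ p' ∈ W, P.flatten.length ≤ p → p < p' →
      p' < P.flatten.length + z.length → False) :
    (W.filter (· < Z.flatten.length)).card ≤ Z.length := by
  induction Z using List.reverseRecOn with
  | nil => simp
  | append_singleton Z z ih =>
    have h1 := ih fun P z' Q hZ => h P z' (Q ++ [z]) (by simp [hZ])
    have h2 : (W.filter fun p => Z.flatten.length ≤ p ∧ p < Z.flatten.length + z.length).card ≤
        1 := by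
      rw [Finset.card_le_one]
      intro p hp p' hp'
      rw [Finset.mem_filter] at hp hp'
      rcases lt_trichotomy p p' with hlt | heq | hlt
      · exact (h Z z [] rfl p hp.1 p' hp'.1 hp.2.1 hlt hp'.2.2).elim
      · exact heq
      · exact (h Z z [] rfl p' hp'.1 p hp.1 hp'.2.1 hlt hp.2.2).elim
    rw [flatten_length_concat, List.length_append, List.length_singleton]
    refine le_trans (Finset.card_le_card ?_)
      ((Finset.card_union_le _ _).trans (Nat.add_le_add h1 h2))
    intro p hp
    simp only [Finset.mem_union, Finset.mem_filter] at hp ⊢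
    by_cases hlt : p < Z.flatten.length
    · exact Or.inl ⟨hp.1, hlt⟩
    · exact Or.inr ⟨hp.1, by omega, hp.2⟩

/-- If each chunk is nonempty and ends at one of the positions `W`, then there are at most as many
chunks as positions. -/
theorem length_le_card_filter_le (W : Finset ℕ) (Z : List (List Bool))
    (h : ∀ P z Q, Z = P ++ z :: Q → z ≠ [] ∧ P.flatten.length + z.length ∈ W) :
    Z.length ≤ (W.filter (· ≤ Z.flatten.length)).card := by
  induction Z using List.reverseRecOn with
  | nil => simp
  | append_singleton Z z ih =>
    have h1 := ih fun P z' Q hZ => h P z' (Q ++ [z]) (by simp [hZ])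
    obtain ⟨h2, h3⟩ := h Z z [] rfl
    have h4 := List.length_pos_iff.2 h2
    rw [flatten_length_concat, List.length_append, List.length_singleton]
    have h5 : Z.flatten.length + z.length ∉ W.filter (· ≤ Z.flatten.length) := by
      rw [Finset.mem_filter]
      omega
    refine (Nat.add_le_add_right h1 1).trans ?_
    rw [← Finset.card_insert_of_notMem h5]
    apply Finset.card_le_card
    intro p hp
    rw [Finset.mem_insert, Finset.mem_filter] at hp
    rw [Finset.mem_filter]
    rcases hp with rfl | hp
    · exact ⟨h3, le_rfl⟩
    · exact ⟨hp.1, by omega⟩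

/-- The distinct chunks are no longer together than a set of positions that covers the first
appearance of each. -/
theorem newLength_le_card (W : Finset ℕ) (Z : List (List Bool))
    (h : ∀ P z Q, Z = P ++ z :: Q → z ∉ P → ∀ t, P.flatten.length ≤ t →
      t < P.flatten.length + z.length → t ∈ W) :
    newLength [] Z ≤ (W.filter (· < Z.flatten.length)).card := by
  induction Z using List.reverseRecOn with
  | nil => simp [newLength_nil]
  | append_singleton Z z ih =>
    have h1 := ih fun P z' Q hZ => h P z' (Q ++ [z]) (by simp [hZ])
    rw [newLength_append, List.nil_append, newLength_singleton, flatten_length_concat]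
    split_ifs with hz
    · refine h1.trans (Finset.card_le_card fun p hp => ?_)
      rw [Finset.mem_filter] at hp ⊢
      exact ⟨hp.1, by omega⟩
    · have h2 := h Z z [] rfl hz
      have h3 : Disjoint (W.filter (· < Z.flatten.length))
          (Finset.Ico Z.flatten.length (Z.flatten.length + z.length)) := by
        rw [Finset.disjoint_left]
        intro p hp hp'
        rw [Finset.mem_filter] at hp
        rw [Finset.mem_Ico] at hp'
        omega
      have h4 : z.length = (Finset.Ico Z.flatten.length (Z.flatten.length + z.length)).card := by
        simp
      rw [h4]
      refine (Nat.add_le_add_right h1 _).trans ?_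
      rw [← Finset.card_union_of_disjoint h3]
      refine Finset.card_le_card fun p hp => ?_
      rw [Finset.mem_union, Finset.mem_filter, Finset.mem_Ico] at hp
      rw [Finset.mem_filter, ← h4]
      rcases hp with hp | hp
      · exact ⟨hp.1, by omega⟩
      · exact ⟨h2 p hp.1 hp.2, hp.2⟩

/-- The chunks have no more distinct substrings of a given length than their distinct values have
bits. -/
theorem card_infix_le_newLength (F : Finset (List Bool)) {l : ℕ} (hl : 1 ≤ l)
    (Z : List (List Bool)) (h : ∀ w ∈ F, w.length = l ∧ ∃ z ∈ Z, w <:+: z) :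
    F.card ≤ newLength [] Z := by
  have hsub : F ⊆ Z.toFinset.biUnion fun z =>
      (Finset.range z.length).image fun p => (z.drop p).take l := by
    intro w hw
    obtain ⟨h1, z, hz, s, t, rfl⟩ := h w hw
    simp only [Finset.mem_biUnion, List.mem_toFinset, Finset.mem_image, Finset.mem_range]
    refine ⟨_, hz, s.length, ?_, ?_⟩
    · simp only [List.length_append]
      omega
    · rw [List.append_assoc, List.drop_left, ← h1, List.take_left]
  refine (Finset.card_le_card hsub).trans (Finset.card_biUnion_le.trans ?_)
  unfold newLength
  rw [List.toFinset_nil, Finset.sdiff_empty]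
  refine Finset.sum_le_sum fun z _ => Finset.card_image_le.trans ?_
  simp

section

variable {M h : ℕ} {σ : ℕ → Bool} {N : ℕ}

/-- Each of a family of disjoint occurrences of the anchor meets another variable-length chunk. -/
theorem card_le_length_chunks (hM : 1 ≤ M) (W : Finset ℕ)
    (hW : ∀ p ∈ W, p + M ≤ N ∧ AnchorEnd σ M (p + M))
    (hsep : ∀ p ∈ W, ∀ p' ∈ W, p < p' → p + M ≤ p') :
    W.card ≤ (chunks M M σ N).length := by
  have h1 := card_filter_lt_le_length W (chunks M M σ N) (by
    intro P z Q hZ p hp p' hp' h1 h2 h3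
    have h4 := (chunks_append_cons hM le_rfl hZ).1.le_of_anchorEnd (by omega) (hW p hp).2
    have h5 := hsep p hp p' hp' h2
    omega)
  rwa [chunks_append_nil rfl, Finset.filter_true_of_mem] at h1
  intro p hp
  have := (hW p hp).1
  omega

open Classical in
theorem length_chunks_le (hM : 1 ≤ M) (hMh : M ≤ h) :
    (chunks M h σ N).length ≤
      ((Finset.range (N + 1)).filter fun e => AnchorEnd σ M e).card + 1 := by
  set Z := chunks M h σ N with hZ
  have hsplit : ∀ P z Q, Z.dropLast = P ++ z :: Q → z ≠ [] ∧ P.flatten.length + z.length ∈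
      (Finset.range (N + 1)).filter fun e => AnchorEnd σ M e := by
    intro P z Q hPQ
    have hne : Z ≠ [] := by
      intro h0
      rw [h0] at hPQ
      simp at hPQ
    have hZ2 : chunks M h σ N = P ++ z :: (Q ++ [Z.getLast hne]) := by
      rw [← hZ]
      conv_lhs => rw [← List.dropLast_append_getLast hne, hPQ]
      simp
    obtain ⟨hc, -⟩ := chunks_append_cons hM hMh hZ2
    have hc2 : ∃ w W, Q ++ [Z.getLast hne] = w :: W := by
      cases Q <;> simp
    obtain ⟨w, W, hw⟩ := hc2
    have hc' := (chunks_append_cons (P := P ++ [z]) (z := w) (Q := W) hM hMh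
        (by rw [hZ2, hw]; simp)).1
    rw [flatten_length_concat] at hc'
    have hlt : P.flatten.length + z.length < N := by
      have := hc'.lt
      have := hc'.le
      omega
    refine ⟨?_, ?_⟩
    · rintro rfl
      have := hc.lt
      simp at this
    · rw [Finset.mem_filter, Finset.mem_range]
      exact ⟨by omega, hc.anchorEnd hlt⟩
  have h1 := length_le_card_filter_le _ _ hsplit
  have h2 : Z.length ≤ Z.dropLast.length + 1 := by
    rw [List.length_dropLast]
    omega
  refine h2.trans (Nat.add_le_add_right (h1.trans (Finset.card_le_card ?_)) 1)
  exact Finset.filter_subset _ _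

theorem length_chunks_le_self (hM : 1 ≤ M) (hMh : M ≤ h) : (chunks M h σ N).length ≤ N := by
  have h1 := length_le_card_filter_le (Finset.Icc 1 N) (chunks M h σ N) (by
    intro P z Q hZ
    obtain ⟨hc, -⟩ := chunks_append_cons hM hMh hZ
    have h1 := hc.lt
    have h2 := hc.le
    refine ⟨?_, Finset.mem_Icc.2 ⟨by omega, by omega⟩⟩
    rintro rfl
    simp at h1)
  refine h1.trans ((Finset.card_filter_le _ _).trans ?_)
  simp

/-- A stretch without ends of anchors lies in one chunk. -/
theorem exists_infix_chunk (hM : 1 ≤ M) (hMh : M ≤ h) {α β p l : ℕ} (hαβ : α < β) (hβ : β ≤ N)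
    (hgap : ∀ e, α < e → e < β → ¬ AnchorEnd σ M e) (hp : α ≤ p) (hpl : p + l ≤ β) :
    ∃ z ∈ chunks M h σ N, slice σ p l <:+: z := by
  obtain ⟨P, z, Q, h1, h2, h3, h4, h5⟩ :=
    exists_chunk_containing (σ := σ) (N := N) hM hMh (g := α) (by omega)
  refine ⟨z, by rw [h1]; simp, ?_⟩
  have h6 : β ≤ P.flatten.length + z.length := by
    by_contra hlt
    exact hgap _ h3 (by omega) (h4.anchorEnd (by omega))
  set a := P.flatten.length
  refine ⟨slice σ a (p - a), slice σ (p + l) (a + z.length - (p + l)), ?_⟩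
  have e1 : p = a + (p - a) := by omega
  have e2 : p + l = a + (p - a + l) := by omega
  have e3 : p - a + l + (a + z.length - (p + l)) = z.length := by omega
  conv_rhs => rw [h5, ← e3, ← slice_append, ← slice_append, ← e1, ← e2]

end

/-! ### The block structure of the source sequence -/

/-- The bit sequence whose block `b`, of length `L`, is the symbol `X (y b)`. -/
def blockSeq (X : ℕ → ℕ → Bool) (y : ℕ → ℕ) (L t : ℕ) : Bool := X (y (t / L)) (t % L)

theorem blockSeq_add (X : ℕ → ℕ → Bool) (y : ℕ → ℕ) {L b o : ℕ} (ho : o < L) :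
    blockSeq X y L (b * L + o) = X (y b) o := by
  unfold blockSeq
  rw [Nat.mul_comm, Nat.mul_add_div (by omega), Nat.div_eq_of_lt ho, Nat.mul_add_mod,
    Nat.mod_eq_of_lt ho, Nat.add_zero]

theorem anchorEnd_blockSeq {X : ℕ → ℕ → Bool} {y : ℕ → ℕ} {L M b e : ℕ} (h1 : M ≤ e)
    (h2 : e ≤ L) : AnchorEnd (blockSeq X y L) M (b * L + e) ↔ AnchorEnd (X (y b)) M e := by
  have key : ∀ t < L, blockSeq X y L (b * L + t) = X (y b) (0 + t) := by
    intro t ht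
    rw [blockSeq_add X y ht, Nat.zero_add]
  constructor
  · intro h
    simpa using h.shift key h1 h2
  · intro h
    refine AnchorEnd.shift (a := 0) (fun t ht => (key t ht).symm) (by simpa using h) h1 h2

/-- All substrings of length `g` of the `A` symbols of length `L` differ. -/
def DistinctSubstrings (g A L : ℕ) (X : ℕ → ℕ → Bool) : Prop :=
  ∀ i < A, ∀ k < A, ∀ p q, p + g ≤ L → q + g ≤ L → (∀ t < g, X i (p + t) = X k (q + t)) →
    i = k ∧ p = q

/-- If all substrings of length `g` differ, then a substring of length `2 * g` of a symbol occurs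
in the source sequence only at the same offset in blocks with that symbol: an occurrence across a
block boundary would have one half inside a block. -/
theorem DistinctSubstrings.occurrence {g A L : ℕ} {X : ℕ → ℕ → Bool} {y : ℕ → ℕ}
    (hX : DistinctSubstrings g A L X) (hy : ∀ b, y b < A) {b o a : ℕ} (ho : o + 2 * g ≤ L)
    (hg : 1 ≤ g) (h : ∀ t < 2 * g, blockSeq X y L (b * L + o + t) = blockSeq X y L (a + t)) :
    ∃ b', a = b' * L + o ∧ y b' = y b := by
  have hL : 0 < L := by omega
  have ha : a = a / L * L + a % L := (Nat.div_add_mod' a L).symm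
  set b' := a / L
  set p := a % L
  have hp : p < L := Nat.mod_lt _ hL
  have h1 : ∀ t < 2 * g, blockSeq X y L (b * L + o + t) = X (y b) (o + t) := by
    intro t ht
    rw [Nat.add_assoc, blockSeq_add X y (by omega)]
  rcases Nat.lt_or_ge L (p + g) with hlt | hle
  · exfalso
    have := (hX _ (hy b) _ (hy (b' + 1)) (o + g) (p + g - L) (by omega) (by omega) (by
      intro t ht
      have h2 := h (g + t) (by omega)
      rw [h1 _ (by omega)] at h2
      have h3 : a + (g + t) = (b' + 1) * L + (p + g - L + t) := by
        rw [Nat.add_mul]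
        omega
      rw [h3, blockSeq_add X y (by omega)] at h2
      rwa [Nat.add_assoc])).2
    omega
  · have := hX _ (hy b) _ (hy b') o p (by omega) (by omega) (by
      intro t ht
      have h2 := h t (by omega)
      rw [h1 _ (by omega), ha, Nat.add_assoc, blockSeq_add X y (by omega)] at h2
      exact h2)
    exact ⟨b', by rw [this.2]; exact ha, this.1.symm⟩

/-! ### Synchronisation inside a block, and the positions in new chunks -/

/-- The length of a window in which the parse is forced to synchronise with constant
probability. -/
def windowLength (M h : ℕ) : ℕ := 2 * M + h + 2 ^ (M + 3) + 1

/-- The `k`th window of the symbol `τ` starts with a stretch without anchors, as long as the minimal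
chunk length `h`, and contains an anchor afterwards. A cut is then forced in this window, at a place
that depends on the symbol only. -/
def SyncWindow (M h : ℕ) (τ : ℕ → Bool) (k : ℕ) : Prop :=
  (∀ e, k * windowLength M h + M < e → e < k * windowLength M h + M + h → ¬ AnchorEnd τ M e) ∧
    ∃ e, k * windowLength M h + M + h ≤ e ∧ e ≤ (k + 1) * windowLength M h ∧ AnchorEnd τ M e

/-- The offset `o` of the symbol `τ` has no synchronising window before it, or none after it. -/
def Unsynced (M h L : ℕ) (τ : ℕ → Bool) (o : ℕ) : Prop :=
  (∀ k < o / windowLength M h, ¬ SyncWindow M h τ k) ∨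
    ∀ k, o / windowLength M h < k → k < (L - 1) / windowLength M h → ¬ SyncWindow M h τ k

theorem windowLength_pos (M h : ℕ) : 0 < windowLength M h :=
  Nat.succ_pos _

theorem exists_cut_of_syncWindow {M h : ℕ} (hM : 1 ≤ M) (hMh : M ≤ h) {X : ℕ → ℕ → Bool} {L i k : ℕ}
    (hk : SyncWindow M h (X i) k) (hkL : (k + 1) * windowLength M h ≤ L) :
    ∃ e, k * windowLength M h < e ∧ e ≤ (k + 1) * windowLength M h ∧
      ∀ (y : ℕ → ℕ) (B b : ℕ), b < B → y b = i →
        ∃ P Q, chunks M h (blockSeq X y L) (B * L) = P ++ Q ∧ P.flatten.length = b * L + e := by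
  classical
  obtain ⟨h1, h2⟩ := hk
  set s := k * windowLength M h + M with hs
  have he := Nat.find_spec h2
  have hmin : ∀ e', s + h ≤ e' → e' < Nat.find h2 → ¬ AnchorEnd (X i) M e' := by
    intro e' h3 h4 h5
    exact Nat.find_min h2 h4 ⟨h3, by omega, h5⟩
  generalize Nat.find h2 = e at *
  refine ⟨e, by omega, he.2.1, fun y B b hb hyb => ?_⟩
  subst hyb
  have h6 : b * L + L ≤ B * L := by
    rw [← Nat.succ_mul]
    exact Nat.mul_le_mul_right L hb
  refine cut_of_gap hM hMh (g := b * L + s) (e := b * L + e) (by omega) (by omega) ?_ ?_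
  · intro e' h3 h4
    obtain ⟨j, rfl⟩ : ∃ j, e' = b * L + j := ⟨e' - b * L, by omega⟩
    rw [anchorEnd_blockSeq (by omega) (by omega)]
    rcases Nat.lt_or_ge j (s + h) with h5 | h5
    · exact h1 j (by omega) h5
    · exact hmin j h5 (by omega)
  · rw [anchorEnd_blockSeq (by omega) (by omega)]
    exact he.2.2

/-- A chunk between two synchronising windows of a block has appeared before if the symbol of the
block has. -/
theorem mem_past_of_synced {M h : ℕ} (hM : 1 ≤ M) (hMh : M ≤ h) {X : ℕ → ℕ → Bool} {y : ℕ → ℕ}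
    {L B b b' o : ℕ} (hb : b < B) (ho : o < L) (hb' : b' < b) (hy : y b' = y b)
    (hsync : ¬ Unsynced M h L (X (y b)) o) {P Q : List (List Bool)} {z : List Bool}
    (hZ : chunks M h (blockSeq X y L) (B * L) = P ++ z :: Q)
    (h1 : P.flatten.length ≤ b * L + o) (h2 : b * L + o < P.flatten.length + z.length) :
    z ∈ P := by
  unfold Unsynced at hsync
  push Not at hsync
  obtain ⟨⟨k1, hk1, hs1⟩, k2, hk2, hk2L, hs2⟩ := hsync
  have hr := windowLength_pos M h
  have hcut1 := exists_cut_of_syncWindow hM hMh (L := L) hs1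
  have hcut2 := exists_cut_of_syncWindow hM hMh (L := L) hs2
  set r := windowLength M h with hrdef
  have hb1 : (k1 + 1) * r ≤ o := by
    have : (k1 + 1) * r ≤ o / r * r := Nat.mul_le_mul_right r hk1
    exact this.trans (Nat.div_mul_le_self o r)
  have hb2 : o < k2 * r := by
    have : (o / r + 1) * r ≤ k2 * r := Nat.mul_le_mul_right r hk2
    have h4 := Nat.div_add_mod' o r
    have h5 := Nat.mod_lt o hr
    rw [Nat.add_mul] at this
    omega
  have hb3 : (k2 + 1) * r < L := by
    have : (k2 + 1) * r ≤ (L - 1) / r * r := Nat.mul_le_mul_right r hk2L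
    have := this.trans (Nat.div_mul_le_self (L - 1) r)
    omega
  obtain ⟨e1, h3, h4, h5⟩ := hcut1 (by omega)
  obtain ⟨e2, h6, h7, h8⟩ := hcut2 (by omega)
  obtain ⟨P0, Q0, hPQ0, hl0⟩ := h5 y B b hb rfl
  obtain ⟨P2, Q2, hPQ2, hl2⟩ := h8 y B b hb rfl
  obtain ⟨P1, Q1, hPQ1, hl1⟩ := h5 y B b' (by omega) hy
  have hbL : b' * L + L ≤ b * L := by
    rw [← Nat.succ_mul]
    exact Nat.mul_le_mul_right L hb'
  have hBL : b * L + L ≤ B * L := by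
    rw [← Nat.succ_mul]
    exact Nat.mul_le_mul_right L hb
  -- the chunk starts after the first of the two cuts
  have ha1 : b * L + e1 ≤ P.flatten.length := by
    by_contra hlt
    have hp := prefix_of_flatten_length_le (P := P0) (P' := P ++ [z]) (Q := Q0) (Q' := Q) hM hMh
      hPQ0 (by rw [hZ]; simp) (by rw [flatten_length_concat]; omega)
    rcases List.prefix_concat_iff.1 hp with h9 | h9
    · rw [h9, flatten_length_concat] at hl0
      omega
    · obtain ⟨T, rfl⟩ := h9
      rw [List.flatten_append, List.length_append] at hlt
      omega
  obtain ⟨T, hT⟩ := prefix_of_flatten_length_le hM hMh hPQ0 hZ (by omega)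
  -- the chunk ends before the second of the two cuts
  have he2 : P.flatten.length + z.length ≤ b * L + e2 := by
    by_contra hlt
    have hp := prefix_of_flatten_length_le (P := P2) (P' := P ++ [z]) (Q := Q2) (Q' := Q) hM hMh
      hPQ2 (by rw [hZ]; simp) (by rw [flatten_length_concat]; omega)
    rcases List.prefix_concat_iff.1 hp with h9 | h9
    · rw [h9, flatten_length_concat] at hl2
      omega
    · obtain ⟨T, rfl⟩ := h9
      rw [List.flatten_append, List.length_append] at h1
      omega
  have hTl : (T ++ [z]).flatten.length + (b * L + e1) = P.flatten.length + z.length := by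
    rw [flatten_length_concat, ← hT, List.flatten_append, List.length_append]
    omega
  have hQ : Q ≠ [] := by
    rintro rfl
    have := chunks_append_nil hZ
    rw [flatten_length_concat] at this
    omega
  obtain ⟨R', hR'⟩ := chunks_append_of_agree (P := P0) (P' := P1) (T := T ++ [z]) (R := Q) hM hMh
    (by rw [hZ, ← hT]; simp) hQ hPQ1 (by
      intro t ht
      rw [hl0, hl1, Nat.add_assoc, Nat.add_assoc, blockSeq_add X y (by omega),
        blockSeq_add X y (by omega), hy]) (by omega)
  have hp := prefix_of_flatten_length_le (P := P1 ++ (T ++ [z])) (P' := P) (Q := R') hM hMh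
    (by rw [hR']; simp) hZ (by
      rw [List.flatten_append, List.length_append]
      omega)
  exact hp.subset (by simp)

open Classical in
/-- The distinct chunks cost at most one copy of each symbol, and the unsynchronised offsets of each
block. -/
theorem newLength_chunks_le {M h : ℕ} (hM : 1 ≤ M) (hMh : M ≤ h) {X : ℕ → ℕ → Bool} {y : ℕ → ℕ}
    {A L B : ℕ} (hy : ∀ b, y b < A) :
    newLength [] (chunks M h (blockSeq X y L) (B * L)) ≤
      A * L + ∑ b ∈ Finset.range B,
        ((Finset.range L).filter fun o => Unsynced M h L (X (y b)) o).card := by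
  set first := (Finset.range B).filter fun b => ∀ b' < b, y b' ≠ y b with hfirst
  have hcard : first.card ≤ A := by
    rw [← Finset.card_range A]
    apply Finset.card_le_card_of_injOn y
    · intro b _
      simpa using hy b
    · intro b hb b' hb' hbb
      rw [hfirst, Finset.mem_coe, Finset.mem_filter] at hb hb'
      rcases lt_trichotomy b b' with hlt | heq | hlt
      · exact absurd hbb (hb'.2 b hlt)
      · exact heq
      · exact absurd hbb.symm (hb.2 b' hlt)
  set W : Finset ℕ := (first.biUnion fun b => (Finset.range L).image fun o => b * L + o) ∪
    (Finset.range B).biUnion fun b =>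
      ((Finset.range L).filter fun o => Unsynced M h L (X (y b)) o).image fun o => b * L + o
    with hW
  refine (newLength_le_card W _ ?_).trans ((Finset.card_filter_le _ _).trans ?_)
  · intro P z Q hZ hz t h1 h2
    have h3 := (chunks_append_cons hM hMh hZ).1.le
    have hL : 0 < L := by
      rcases Nat.eq_zero_or_pos L with rfl | h
      · simp at h3
        rw [h3.2] at h2
        simp at h2
        omega
      · exact h
    have ht : t / L * L + t % L = t := Nat.div_add_mod' t L
    have htL := Nat.mod_lt t hL
    have hb : t / L < B := (Nat.div_lt_iff_lt_mul hL).2 (by omega)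
    simp only [hW, hfirst, Finset.mem_union, Finset.mem_biUnion, Finset.mem_image,
      Finset.mem_filter, Finset.mem_range]
    by_contra hcon
    push Not at hcon
    obtain ⟨hc1, hc2⟩ := hcon
    have hc2' : ¬ Unsynced M h L (X (y (t / L))) (t % L) := fun hu =>
      hc2 _ hb _ ⟨htL, hu⟩ ht
    have hc1' : ∃ b' < t / L, y b' = y (t / L) := by
      by_contra hno
      push Not at hno
      exact hc1 _ ⟨hb, hno⟩ _ htL ht
    obtain ⟨b', hb', hyb⟩ := hc1'
    exact hz (mem_past_of_synced hM hMh hb htL hb' hyb hc2' hZ (by omega) (by omega))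
  · refine (Finset.card_union_le _ _).trans (Nat.add_le_add ?_ ?_)
    · refine Finset.card_biUnion_le.trans ((Finset.sum_le_card_nsmul _ _ L fun b _ => ?_).trans ?_)
      · exact Finset.card_image_le.trans (by simp)
      · rw [smul_eq_mul]
        exact Nat.mul_le_mul_right L hcard
    · exact Finset.card_biUnion_le.trans (Finset.sum_le_sum fun b _ => Finset.card_image_le)

/-! ### Phrases of multi-chunk deduplication -/

theorem length_le_matchLength (T R R' : List (List Bool)) :
    T.length ≤ matchLength (T ++ R') (T ++ R) := by
  induction T with
  | nil => simp
  | cons x T ih => simpa [matchLength] using ih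

/-- The chunk after a run of new chunks is not new. -/
theorem mem_of_drop_newRun (past zs : List (List Bool)) {w : List Bool} {ws : List (List Bool)}
    (h : zs.drop (newRun past zs) = w :: ws) : w ∈ past ++ zs.take (newRun past zs) := by
  induction zs generalizing past with
  | nil => simp at h
  | cons z zs ih =>
    rw [newRun] at h ⊢
    split_ifs at h ⊢ with hz
    · simp only [List.drop_zero, List.cons.injEq] at h
      simpa [h.1] using hz
    · rw [List.drop_succ_cons] at h
      have := ih (past ++ [z]) h
      simpa using this

section

variable {M g : ℕ} {X : ℕ → ℕ → Bool} {y : ℕ → ℕ} {A L B : ℕ}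

/-- A phrase that starts with an old chunk inside block `b` covers all chunks that lie inside this
block: the first appearance of this chunk is at the same place of a block with the same symbol. -/
theorem le_matchLength (hM : 1 ≤ M) (hMg : M ≤ 2 * g) (hX : DistinctSubstrings g A L X)
    (hy : ∀ b, y b < A) {b : ℕ} {past T R : List (List Bool)} {z : List Bool}
    (hZ : chunks M (2 * g) (blockSeq X y L) (B * L) = past ++ z :: (T ++ R)) (hR : R ≠ [])
    (hz : z ∈ past) (h1 : b * L ≤ past.flatten.length)
    (h2 : past.flatten.length + (z :: T).flatten.length ≤ b * L + L) :
    T.length ≤ matchLength ((past ++ z :: (T ++ R)).drop (past.idxOf z + 1)) (T ++ R) := by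
  have hlen : past.idxOf z < past.length := List.idxOf_lt_length_iff.2 hz
  obtain ⟨P1, P2, hP, hPl⟩ : ∃ P1 P2, past = P1 ++ z :: P2 ∧ P1.length = past.idxOf z := by
    refine ⟨past.take (past.idxOf z), past.drop (past.idxOf z + 1), ?_, by simp; omega⟩
    have h3 : past[past.idxOf z] = z := List.getElem_idxOf hlen
    conv_lhs => rw [← List.take_append_drop (past.idxOf z) past, List.drop_eq_getElem_cons hlen, h3]
  have hdrop : (past ++ z :: (T ++ R)).drop (past.idxOf z + 1) = P2 ++ z :: (T ++ R) := by
    rw [← hPl]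
    conv_lhs => rw [hP]
    rw [List.append_assoc, List.cons_append]
    have : P1 ++ z :: (P2 ++ z :: (T ++ R)) = (P1 ++ [z]) ++ (P2 ++ z :: (T ++ R)) := by simp
    rw [this]
    apply List.drop_left'
    simp
  rw [hdrop]
  -- the chunk `z` at its first and at its current position
  obtain ⟨hc, hzs⟩ := chunks_append_cons hM hMg hZ
  have hZ1 : chunks M (2 * g) (blockSeq X y L) (B * L) =
      P1 ++ z :: (P2 ++ z :: (T ++ R)) := by
    rw [hZ]
    conv_lhs => rw [hP]
    simp
  obtain ⟨hc1, hzs1⟩ := chunks_append_cons hM hMg hZ1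
  have hlt : past.flatten.length + z.length < B * L := by
    obtain ⟨w, W, hw⟩ : ∃ w W, T ++ R = w :: W := by
      cases T with
      | nil => cases R with
        | nil => exact absurd rfl hR
        | cons w W => exact ⟨w, W, rfl⟩
      | cons w W => exact ⟨w, W ++ R, rfl⟩
    have h3 := (chunks_append_cons (P := past ++ [z]) (z := w) (Q := W) hM hMg
      (by rw [hZ, hw]; simp)).1
    rw [flatten_length_concat] at h3
    exact h3.lt.trans_le h3.le
  have hzg : 2 * g ≤ z.length := by
    have := hc.min_le hlt
    omega
  rw [List.flatten_cons, List.length_append] at h2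
  set a := past.flatten.length with ha
  set a1 := P1.flatten.length with ha1
  obtain ⟨o, ho⟩ : ∃ o, a = b * L + o := ⟨a - b * L, by omega⟩
  have heq : ∀ t < z.length, blockSeq X y L (a + t) = blockSeq X y L (a1 + t) :=
    slice_eq_slice.1 (hzs.symm.trans hzs1)
  obtain ⟨b', hb', hyb⟩ := hX.occurrence (y := y) hy (b := b) (o := o) (a := a1) (by omega)
    (by omega) (fun t ht => by rw [← ho]; exact heq t (by omega))
  have hb'B : b' < B := by
    have h3 := hc1.lt
    have h4 := hc1.le
    by_contra hge
    have := Nat.mul_le_mul_right L (Nat.le_of_not_lt hge)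
    omega
  have hBL : b' * L + L ≤ B * L := by
    rw [← Nat.succ_mul]
    exact Nat.mul_le_mul_right L hb'B
  have hfl : (z :: T).flatten.length = z.length + T.flatten.length := by
    rw [List.flatten_cons, List.length_append]
  obtain ⟨R', hR'⟩ := chunks_append_of_agree (P := past) (P' := P1) (T := z :: T) (R := R) hM hMg
    (by rw [hZ]; simp) hR hZ1 (by
      intro t ht
      rw [hfl] at ht
      rw [← ha, ← ha1, ho, hb', Nat.add_assoc, Nat.add_assoc, blockSeq_add X y (by omega),
        blockSeq_add X y (by omega), hyb]) (by rw [hfl]; omega)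
  rw [hZ1] at hR'
  have h5 := List.append_cancel_left hR'
  rw [List.cons_append, List.cons.injEq] at h5
  rw [h5.2]
  exact length_le_matchLength T R R'

/-- The potential that bounds the number of phrases: each block accounts for at most one old phrase
that starts inside it and one that starts across its right boundary, and each old phrase for at most
one new phrase before it. -/
theorem phraseCount_le_potential (hM : 1 ≤ M) (hMg : M ≤ 2 * g) (hX : DistinctSubstrings g A L X)
    (hy : ∀ b, y b < A) (past zs : List (List Bool)) (z : List Bool)
    (hZ : chunks M (2 * g) (blockSeq X y L) (B * L) = past ++ z :: zs) :
    phraseCount past (z :: zs) + 4 * (past.flatten.length / L) ≤ 4 * B +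
      (if past.flatten.length + z.length ≤ past.flatten.length / L * L + L then 2 else 0) +
      (if z ∈ past then 0 else 1) := by
  induction hn : zs.length using Nat.strong_induction_on generalizing past zs z with
  | _ n ih =>
    have blockLt : ∀ past' zs' z', chunks M (2 * g) (blockSeq X y L) (B * L) =
        past' ++ z' :: zs' → past'.flatten.length / L < B := by
      intro past' zs' z' hZ'
      obtain ⟨hc, -⟩ := chunks_append_cons hM hMg hZ'
      have h1 := hc.lt
      have h2 := hc.le
      refine (Nat.div_lt_iff_lt_mul ?_).2 (by omega)
      rcases Nat.eq_zero_or_pos L with rfl | h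
      · simp only [Nat.mul_zero] at h2
        omega
      · exact h
    have hb := blockLt _ _ _ hZ
    have hL : 0 < L := by
      rcases Nat.eq_zero_or_pos L with rfl | h
      · obtain ⟨hc, -⟩ := chunks_append_cons hM hMg hZ
        have h1 := hc.lt
        have h2 := hc.le
        simp only [Nat.mul_zero] at h2
        omega
      · exact h
    -- the position after a phrase
    have hpos : ∀ k, (past ++ z :: zs.take k).flatten.length =
        past.flatten.length + z.length + (zs.take k).flatten.length := by
      intro k
      rw [List.flatten_append, List.length_append, List.flatten_cons, List.length_append,
        Nat.add_assoc]
    have hsplit : ∀ k, past ++ z :: zs = (past ++ z :: zs.take k) ++ zs.drop k := by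
      intro k
      rw [List.append_assoc, List.cons_append, List.take_append_drop]
    set a := past.flatten.length with ha
    have haL := Nat.div_add_mod' a L
    have haL' := Nat.mod_lt a hL
    rw [phraseCount]
    by_cases hz : z ∈ past
    · rw [if_pos hz, if_pos hz]
      simp only
      set k := matchLength ((past ++ z :: zs).drop (past.idxOf z + 1)) zs with hk
      rcases hd : zs.drop k with _ | ⟨w, ws⟩
      · rw [phraseCount]
        omega
      · have hZ' : chunks M (2 * g) (blockSeq X y L) (B * L) =
            (past ++ z :: zs.take k) ++ w :: ws := by
          rw [hZ, hsplit k, hd]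
        rcases ws with _ | ⟨w', ws⟩
        · have := phraseCount_le_length (past ++ z :: zs.take k) [w]
          simp only [List.length_singleton] at this
          omega
        · have hlen : (w' :: ws).length < n := by
            have := congrArg List.length hd
            rw [List.length_drop, List.length_cons] at this
            omega
          have hi := ih _ hlen _ _ _ hZ' rfl
          have hb' := blockLt _ _ _ hZ'
          have hge : a / L ≤ (past ++ z :: zs.take k).flatten.length / L :=
            Nat.div_le_div_right (by rw [hpos]; omega)
          have h01 : (if w ∈ past ++ z :: zs.take k then 0 else 1) ≤ 1 := by split_ifs <;> omega
          rcases hge.eq_or_lt with heq | hlt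
          · rw [← heq] at hi
            have ha' := Nat.lt_mul_div_succ (past ++ z :: zs.take k).flatten.length hL
            rw [← heq, Nat.mul_comm, Nat.add_mul, hpos] at ha'
            rw [if_pos (by omega)]
            rw [if_neg] at hi
            · omega
            · intro hins
              rw [hpos] at hins
              -- otherwise the phrase would extend over the next chunk
              have hzs : zs = (zs.take k ++ [w]) ++ (w' :: ws) := by
                conv_lhs => rw [← List.take_append_drop k zs, hd]
                simp
              have hfin := le_matchLength (T := zs.take k ++ [w]) (R := w' :: ws) (b := a / L)
                (past := past) (z := z) hM hMg hX hy (by rw [hZ, ← hzs]) (by simp) hz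
                (by omega) (by
                  rw [List.flatten_cons, List.length_append, flatten_length_concat]
                  omega)
              rw [← hzs, ← hk, List.length_append, List.length_take, List.length_singleton] at hfin
              have := congrArg List.length hd
              rw [List.length_drop, List.length_cons] at this
              omega
          · have h02 : (if (past ++ z :: zs.take k).flatten.length + w.length ≤
                (past ++ z :: zs.take k).flatten.length / L * L + L then 2 else 0) ≤ 2 := by
              split_ifs <;> omega
            omega
    · rw [if_neg hz, if_neg hz]
      simp only
      set k := newRun (past ++ [z]) zs with hk
      rcases hd : zs.drop k with _ | ⟨w, ws⟩
      · rw [phraseCount]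
        omega
      · have hZ' : chunks M (2 * g) (blockSeq X y L) (B * L) =
            (past ++ z :: zs.take k) ++ w :: ws := by
          rw [hZ, hsplit k, hd]
        have hlen : ws.length < n := by
          have := congrArg List.length hd
          rw [List.length_drop, List.length_cons] at this
          omega
        have hi := ih _ hlen _ _ _ hZ' rfl
        have hb' := blockLt _ _ _ hZ'
        have hge : a / L ≤ (past ++ z :: zs.take k).flatten.length / L :=
          Nat.div_le_div_right (by rw [hpos]; omega)
        have hw : w ∈ past ++ z :: zs.take k := by
          simpa using mem_of_drop_newRun (past ++ [z]) zs hd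
        rw [if_pos hw] at hi
        have h02 : (if (past ++ z :: zs.take k).flatten.length + w.length ≤
            (past ++ z :: zs.take k).flatten.length / L * L + L then 2 else 0) ≤ 2 := by
          split_ifs <;> omega
        rcases hge.eq_or_lt with heq | hlt
        · have ha' := Nat.lt_mul_div_succ (past ++ z :: zs.take k).flatten.length hL
          rw [← heq, Nat.mul_comm, Nat.add_mul, hpos] at ha'
          rw [if_pos (by omega)]
          omega
        · omega

theorem phraseCount_chunks_le (hM : 1 ≤ M) (hMg : M ≤ 2 * g) (hX : DistinctSubstrings g A L X)
    (hy : ∀ b, y b < A) :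
    phraseCount [] (chunks M (2 * g) (blockSeq X y L) (B * L)) ≤ 4 * B + 3 := by
  rcases hZ : chunks M (2 * g) (blockSeq X y L) (B * L) with _ | ⟨z, zs⟩
  · simp [phraseCount]
  · have := phraseCount_le_potential (past := []) hM hMg hX hy zs z (by simpa using hZ)
    have h1 : (if z ∈ ([] : List (List Bool)) then 0 else 1) ≤ 1 := by split_ifs <;> omega
    have h2 : (if ([] : List (List Bool)).flatten.length + z.length ≤
        ([] : List (List Bool)).flatten.length / L * L + L then 2 else 0) ≤ 2 := by
      split_ifs <;> omega
    omega

/-! ### Distinct chunks across block boundaries -/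

open Classical in
/-- If the neighbourhoods of many block boundaries, between different pairs of symbols, contain no
anchor, then the distinct chunks are long. -/
theorem mul_card_le_newLength {h m q : ℕ} (hM : 1 ≤ M) (hMh : M ≤ h) (hm : m ≤ M) (hq : 1 ≤ q)
    (hqL : 2 * q ≤ L) (hX : DistinctSubstrings q A L X) (hy : ∀ b, y b < A) (W : Finset ℕ)
    (hW : ∀ b ∈ W, 1 ≤ b ∧ b < B)
    (hcalm : ∀ b ∈ W, ∀ e, b * L < e + 2 * q → e < b * L + 2 * q →
      ¬ AnchorEnd (blockSeq X y L) m e)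
    (hfresh : ∀ b ∈ W, ∀ b' ∈ W, b' < b → ¬ (y (b' - 1) = y (b - 1) ∧ y b' = y b)) :
    q * W.card ≤ newLength [] (chunks M h (blockSeq X y L) (B * L)) := by
  set f : ℕ × ℕ → List Bool := fun p => slice (blockSeq X y L) (p.1 * L - q - p.2) (3 * q) with hf
  have hBL : ∀ b, 1 ≤ b → b < B → L ≤ b * L ∧ b * L + L ≤ B * L := by
    intro b h1 h2
    constructor
    · exact Nat.le_mul_of_pos_left L h1
    · rw [← Nat.succ_mul]
      exact Nat.mul_le_mul_right L h2
  have hinj : Set.InjOn f (W ×ˢ Finset.range q : Finset (ℕ × ℕ)) := by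
    rintro ⟨b, d⟩ hbd ⟨b', d'⟩ hbd' heq
    simp only [Finset.coe_product, Set.mem_prod, Finset.mem_coe, Finset.mem_range] at hbd hbd'
    obtain ⟨hb, hd⟩ := hbd
    obtain ⟨hb', hd'⟩ := hbd'
    have h1 := slice_eq_slice.1 heq
    obtain ⟨hb1, hbB⟩ := hW b hb
    obtain ⟨hb1', hbB'⟩ := hW b' hb'
    simp only at h1
    have before : ∀ b d, 1 ≤ b → b < B → d < q → ∀ t < q,
        blockSeq X y L (b * L - q - d + t) = X (y (b - 1)) (L - q - d + t) := by
      intro b d hb1 hbB hd t ht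
      have h2 := hBL b hb1 hbB
      have h3 : b * L - q - d + t = (b - 1) * L + (L - q - d + t) := by
        rw [Nat.sub_mul]
        omega
      rw [h3, blockSeq_add X y (by omega)]
    have after : ∀ b d, 1 ≤ b → b < B → d < q → ∀ t < q,
        blockSeq X y L (b * L - q - d + (2 * q + t)) = X (y b) (q - d + t) := by
      intro b d hb1 hbB hd t ht
      have h2 := hBL b hb1 hbB
      have h3 : b * L - q - d + (2 * q + t) = b * L + (q - d + t) := by omega
      rw [h3, blockSeq_add X y (by omega)]
    obtain ⟨e1, e2⟩ := hX _ (hy (b - 1)) _ (hy (b' - 1)) (L - q - d) (L - q - d') (by omega)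
      (by omega) (by
        intro t ht
        rw [← before b d hb1 hbB hd t ht, ← before b' d' hb1' hbB' hd' t ht]
        exact h1 t (by omega))
    obtain ⟨e3, -⟩ := hX _ (hy b) _ (hy b') (q - d) (q - d') (by omega)
      (by omega) (by
        intro t ht
        rw [← after b d hb1 hbB hd t ht, ← after b' d' hb1' hbB' hd' t ht]
        exact h1 _ (by omega))
    have hbb : b = b' := by
      rcases lt_trichotomy b b' with hlt | heq | hlt
      · exact absurd ⟨e1, e3⟩ (hfresh b' hb' b hb hlt)
      · exact heq
      · exact absurd ⟨e1.symm, e3.symm⟩ (hfresh b hb b' hb' hlt)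
    rw [Prod.mk.injEq]
    exact ⟨hbb, by omega⟩
  have hcard : q * W.card = ((W ×ˢ Finset.range q).image f).card := by
    rw [Finset.card_image_of_injOn hinj, Finset.card_product, Finset.card_range, Nat.mul_comm]
  rw [hcard]
  refine card_infix_le_newLength _ (l := 3 * q) (by omega) _ ?_
  intro w hw
  rw [Finset.mem_image] at hw
  obtain ⟨⟨b, d⟩, hbd, rfl⟩ := hw
  rw [Finset.mem_product, Finset.mem_range] at hbd
  obtain ⟨hb, hd⟩ := hbd
  obtain ⟨hb1, hbB⟩ := hW b hb
  have h2 := hBL b hb1 hbB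
  simp only at hd hb
  refine ⟨by simp [hf], ?_⟩
  exact exists_infix_chunk hM hMh (α := b * L - 2 * q) (β := b * L + 2 * q) (by omega) (by omega)
    (fun e he1 he2 hA => hcalm b hb e (by omega) he2 (hA.mono hm)) (by simp only; omega)
    (by simp only; omega)

end

/-! ### Counting functions with prescribed values -/

section

variable {ι α : Type*} [DecidableEq ι] [Fintype α]

/-- If the values on `T` are determined by the others on the event `P`, then `P` has probability at
most `|α| ^ (-|T|)`. -/
theorem card_mul_pow_le_of_determined [Fintype ι] (T : Finset ι) (P : Finset (ι → α))
    (h : ∀ x ∈ P, ∀ x' ∈ P, (∀ i ∉ T, x i = x' i) → x = x') :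
    P.card * Fintype.card α ^ T.card ≤ Fintype.card (ι → α) := by
  classical
  have h1 : P.card * Fintype.card α ^ T.card =
      (P ×ˢ (Finset.univ : Finset (T → α))).card := by
    rw [Finset.card_product, Finset.card_univ, Fintype.card_fun, Fintype.card_coe]
  rw [h1, ← Finset.card_univ]
  apply Finset.card_le_card_of_injOn
    (fun p : (ι → α) × (T → α) => fun i => if hi : i ∈ T then p.2 ⟨i, hi⟩ else p.1 i)
  · intro p _
    simp
  · rintro ⟨x, v⟩ hx ⟨x', v'⟩ hx' heq
    simp only [Finset.coe_product, Set.mem_prod, Finset.mem_coe] at hx hx'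
    have hxx : x = x' := by
      apply h x hx.1 x' hx'.1
      intro i hi
      simpa [hi] using congrFun heq i
    have hvv : v = v' := by
      funext ⟨i, hi⟩
      simpa [hi] using congrFun heq i
    rw [hxx, hvv]

/-- An event `P` that does not depend on the values on `T` is independent of them: it loses at most
a factor `|α| ^ |T|` if these values are prescribed. -/
theorem card_le_card_inter_mul_pow (T : Finset ι) (P G : Finset (ι → α)) (v : ι → α)
    [DecidableEq (ι → α)]
    (h : ∀ x x', (∀ i ∉ T, x i = x' i) → x ∈ P → x' ∈ P)
    (hG : ∀ x, (∀ i ∈ T, x i = v i) → x ∈ G) :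
    P.card ≤ (P ∩ G).card * Fintype.card α ^ T.card := by
  have h1 : (P ∩ G).card * Fintype.card α ^ T.card =
      ((P ∩ G) ×ˢ (Finset.univ : Finset (T → α))).card := by
    rw [Finset.card_product, Finset.card_univ, Fintype.card_fun, Fintype.card_coe]
  rw [h1]
  apply Finset.card_le_card_of_injOn
    (fun x : ι → α => ((fun i => if i ∈ T then v i else x i), fun i : T => x i))
  · intro x hx
    simp only [Finset.coe_product, Set.mem_prod, Finset.mem_coe, Finset.mem_inter,
      Finset.mem_univ, and_true]
    exact ⟨h x _ (fun i hi => by simp [hi]) hx, hG _ fun i hi => by simp [hi]⟩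
  · intro x _ x' _ heq
    simp only [Prod.mk.injEq] at heq
    funext i
    by_cases hi : i ∈ T
    · exact congrFun heq.2 ⟨i, hi⟩
    · simpa [hi] using congrFun heq.1 i

/-- Events that depend on disjoint sets of coordinates are independent: the coordinates in `T` of
two functions are exchanged. -/
theorem card_mul_card_le_of_independent [Fintype ι] (T : Finset ι) (P Q : Finset (ι → α))
    [DecidableEq (ι → α)]
    (hP : ∀ x x', (∀ i ∉ T, x i = x' i) → x ∈ P → x' ∈ P)
    (hQ : ∀ x x', (∀ i ∈ T, x i = x' i) → x ∈ Q → x' ∈ Q) :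
    P.card * Q.card ≤ (P ∩ Q).card * Fintype.card (ι → α) := by
  rw [← Finset.card_univ, ← Finset.card_product, ← Finset.card_product]
  apply Finset.card_le_card_of_injOn (fun p : (ι → α) × (ι → α) =>
    ((fun i => if i ∈ T then p.2 i else p.1 i), fun i => if i ∈ T then p.1 i else p.2 i))
  · rintro ⟨x, x'⟩ hx
    simp only [Finset.coe_product, Set.mem_prod, Finset.mem_coe, Finset.mem_inter,
      Finset.mem_univ, and_true] at hx ⊢
    exact ⟨hP x _ (fun i hi => by simp [hi]) hx.1, hQ x' _ (fun i hi => by simp [hi]) hx.2⟩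
  · rintro ⟨x, x'⟩ _ ⟨u, u'⟩ _ heq
    simp only [Prod.mk.injEq] at heq
    rw [Prod.mk.injEq]
    constructor
    · funext i
      by_cases hi : i ∈ T
      · simpa [hi] using congrFun heq.2 i
      · simpa [hi] using congrFun heq.1 i
    · funext i
      by_cases hi : i ∈ T
      · simpa [hi] using congrFun heq.1 i
      · simpa [hi] using congrFun heq.2 i

end

/-- A renewal inequality: if the event `P k` (nothing has happened before `k`) is followed by the
event `G k` (it happens at `k`) with conditional probability at least `1 / K`, then the expected
waiting time is at most `K`, since the events `P k ∩ G k` are disjoint. -/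
theorem sum_card_le_of_disjoint {Ω : Type*} [Fintype Ω] [DecidableEq Ω] (N K : ℕ)
    (P G : ℕ → Finset Ω) (h : ∀ k < N, (P k).card ≤ K * (P k ∩ G k).card)
    (hd : ∀ j < N, ∀ k < N, j < k → Disjoint (P j ∩ G j) (P k ∩ G k)) :
    ∑ k ∈ Finset.range N, (P k).card ≤ K * Fintype.card Ω := by
  calc ∑ k ∈ Finset.range N, (P k).card
      ≤ ∑ k ∈ Finset.range N, K * (P k ∩ G k).card :=
        Finset.sum_le_sum fun k hk => h k (Finset.mem_range.1 hk)
    _ = K * ((Finset.range N).biUnion fun k => P k ∩ G k).card := by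
        rw [← Finset.mul_sum, Finset.card_biUnion]
        intro j hj k hk hjk
        rw [Finset.mem_coe, Finset.mem_range] at hj hk
        rcases lt_or_gt_of_ne hjk with hlt | hlt
        · exact hd j hj k hk hlt
        · exact (hd k hk j hj hlt).symm
    _ ≤ K * Fintype.card Ω := Nat.mul_le_mul_left K (Finset.card_le_univ _)

/-! ### Random symbols -/

/-- The bits of `A` symbols of length `L`, extended by zeros to all indices and positions. -/
def symbols {A L : ℕ} (x : Fin A × Fin L → Bool) (i p : ℕ) : Bool :=
  if h : i < A ∧ p < L then x (⟨i, h.1⟩, ⟨p, h.2⟩) else false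

/-- The cells of the array of bits with indices in `s`. -/
def cells (A L : ℕ) (s : Finset (ℕ × ℕ)) : Finset (Fin A × Fin L) :=
  Finset.univ.filter fun c => ((c.1 : ℕ), (c.2 : ℕ)) ∈ s

section

variable {A L : ℕ}

theorem card_cells {s : Finset (ℕ × ℕ)} (hs : ∀ c ∈ s, c.1 < A ∧ c.2 < L) :
    (cells A L s).card = s.card := by
  apply Finset.card_bij (fun c _ => ((c.1 : ℕ), (c.2 : ℕ)))
  · intro c hc
    simpa [cells] using hc
  · rintro ⟨a, b⟩ _ ⟨c, d⟩ _ heq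
    simp only [Prod.mk.injEq] at heq
    rw [Prod.mk.injEq]
    exact ⟨Fin.ext heq.1, Fin.ext heq.2⟩
  · rintro ⟨i, p⟩ hc
    have := hs _ hc
    exact ⟨(⟨i, this.1⟩, ⟨p, this.2⟩), by simpa [cells] using hc, rfl⟩

theorem symbols_congr_of_notMem {s : Finset (ℕ × ℕ)} {x x' : Fin A × Fin L → Bool}
    (h : ∀ c ∉ cells A L s, x c = x' c) {i p : ℕ} (hip : (i, p) ∉ s) :
    symbols x i p = symbols x' i p := by
  unfold symbols
  split_ifs with hlt
  · exact h _ (by simpa [cells] using hip)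
  · rfl

theorem symbols_congr_of_mem {s : Finset (ℕ × ℕ)} {x x' : Fin A × Fin L → Bool}
    (h : ∀ c ∈ cells A L s, x c = x' c) {i p : ℕ} (hip : (i, p) ∈ s) :
    symbols x i p = symbols x' i p := by
  unfold symbols
  split_ifs with hlt
  · exact h _ (by simpa [cells] using hip)
  · rfl

theorem symbols_fin (x : Fin A × Fin L → Bool) (c : Fin A × Fin L) :
    symbols x c.1 c.2 = x c := by
  simp [symbols]

open Classical in
/-- An event on which the bits of the cells `s` are determined by the other bits has probability at
most `2 ^ (-|s|)`. -/
theorem card_filter_mul_two_pow_le (s : Finset (ℕ × ℕ)) (hs : ∀ c ∈ s, c.1 < A ∧ c.2 < L)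
    (E : (Fin A × Fin L → Bool) → Prop)
    (h : ∀ x x', E x → E x' → (∀ i p, (i, p) ∉ s → symbols x i p = symbols x' i p) →
      ∀ i p, (i, p) ∈ s → symbols x i p = symbols x' i p) :
    (Finset.univ.filter E).card * 2 ^ s.card ≤ Fintype.card (Fin A × Fin L → Bool) := by
  have := card_mul_pow_le_of_determined (cells A L s) (Finset.univ.filter E) (by
    intro x hx x' hx' hxx
    rw [Finset.mem_filter] at hx hx'
    funext c
    by_cases hc : c ∈ cells A L s
    · rw [← symbols_fin x c, ← symbols_fin x' c]
      refine h x x' hx.2 hx'.2 (fun i p hip => symbols_congr_of_notMem hxx hip) _ _ ?_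
      simpa [cells] using hc
    · exact hxx c hc)
  rwa [card_cells hs, Fintype.card_bool] at this

open Classical in
/-- An anchor ends at a given position of the source sequence with probability at most `2 ^ (-M)`,
even across a block boundary. -/
theorem card_anchorEnd_mul_le {M e : ℕ} {y : ℕ → ℕ} (hy : ∀ b, y b < A) (hML : M ≤ L) :
    (Finset.univ.filter fun x : Fin A × Fin L → Bool =>
      AnchorEnd (blockSeq (symbols x) y L) M e).card * 2 ^ M ≤
      Fintype.card (Fin A × Fin L → Bool) := by
  by_cases hMe : M ≤ e
  swap
  · rw [Finset.filter_false_of_mem (fun x _ hA => hMe hA.1)]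
    simp
  set s : Finset (ℕ × ℕ) := (Finset.range M).image fun t => (y ((e - M + t) / L), (e - M + t) % L)
    with hs
  rcases Nat.eq_zero_or_pos M with rfl | hM
  · simpa using Finset.card_le_univ (Finset.univ.filter fun x : Fin A × Fin L → Bool =>
      AnchorEnd (blockSeq (symbols x) y L) 0 e)
  have hcard : s.card = M := by
    rw [hs, Finset.card_image_of_injOn, Finset.card_range]
    intro t ht t' ht' heq
    rw [Finset.mem_coe, Finset.mem_range] at ht ht'
    simp only [Prod.mk.injEq] at heq
    have h1 : t ≡ t' [MOD L] := Nat.ModEq.add_left_cancel' (e - M) heq.2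
    exact h1.eq_of_lt_of_lt (by omega) (by omega)
  have := card_filter_mul_two_pow_le (A := A) (L := L) s (by
    intro c hc
    rw [hs, Finset.mem_image] at hc
    obtain ⟨t, -, rfl⟩ := hc
    exact ⟨hy _, Nat.mod_lt _ (by omega)⟩)
    (fun x => AnchorEnd (blockSeq (symbols x) y L) M e) (by
      intro x x' hx hx' _ i p hip
      rw [hs, Finset.mem_image] at hip
      obtain ⟨t, ht, heq⟩ := hip
      rw [Finset.mem_range] at ht
      rw [Prod.mk.injEq] at heq
      have h1 := hx.2 (e - M + t) (by omega) (by omega)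
      have h2 := hx'.2 (e - M + t) (by omega) (by omega)
      unfold blockSeq at h1 h2
      rw [heq.1, heq.2] at h1 h2
      rw [h1, h2])
  rwa [hcard] at this

open Classical in
theorem card_anchorEnd_symbol_mul_le {M e i : ℕ} (hi : i < A) (heL : e ≤ L) :
    (Finset.univ.filter fun x : Fin A × Fin L → Bool =>
      AnchorEnd (symbols x i) M e).card * 2 ^ M ≤ Fintype.card (Fin A × Fin L → Bool) := by
  by_cases hMe : M ≤ e
  · refine le_trans (Nat.mul_le_mul_right _ (Finset.card_le_card ?_))
      (card_anchorEnd_mul_le (M := M) (e := e) (y := fun _ => i) (fun _ => hi) (by omega))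
    intro x hx
    rw [Finset.mem_filter] at hx ⊢
    refine ⟨hx.1, ?_⟩
    have := (anchorEnd_blockSeq (X := symbols x) (y := fun _ => i) (b := 0) hMe heL).2 hx.2
    simpa using this
  · rw [Finset.filter_false_of_mem (fun x _ hA => hMe hA.1)]
    simp

open Classical in
/-- By the union bound, all substrings of length `g` of the random symbols differ, up to probability
`(A * L) ^ 2 * 2 ^ (-g)`; overlapping substrings of one symbol are as unlikely to agree as disjoint
ones. -/
theorem card_not_distinctSubstrings_mul_le {g : ℕ} (hg : 1 ≤ g) :
    (Finset.univ.filter fun x : Fin A × Fin L → Bool =>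
      ¬ DistinctSubstrings g A L (symbols x)).card * 2 ^ g ≤
      (A * L) ^ 2 * Fintype.card (Fin A × Fin L → Bool) := by
  set I := (Finset.range A ×ˢ Finset.range L) ×ˢ (Finset.range A ×ˢ Finset.range L) with hI
  set agree : (ℕ × ℕ) × (ℕ × ℕ) → (Fin A × Fin L → Bool) → Prop := fun c x =>
    (c.1.2 + g ≤ L ∧ c.2.2 + g ≤ L ∧ (c.1.1 ≠ c.2.1 ∨ c.1.2 < c.2.2)) ∧
      ∀ t < g, symbols x c.1.1 (c.1.2 + t) = symbols x c.2.1 (c.2.2 + t) with hagree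
  set E : (ℕ × ℕ) × (ℕ × ℕ) → Finset (Fin A × Fin L → Bool) := fun c =>
    Finset.univ.filter (agree c) with hE
  have hsub : (Finset.univ.filter fun x : Fin A × Fin L → Bool =>
      ¬ DistinctSubstrings g A L (symbols x)) ⊆ I.biUnion E := by
    intro x hx
    rw [Finset.mem_filter] at hx
    have hx := hx.2
    unfold DistinctSubstrings at hx
    push Not at hx
    obtain ⟨i, hi, k, hk, p, q, hp, hq, h, hne⟩ := hx
    simp only [hI, hE, hagree, Finset.mem_biUnion, Finset.mem_product, Finset.mem_range,
      Finset.mem_filter, Finset.mem_univ, true_and]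
    by_cases hik : i = k
    · rcases lt_or_gt_of_ne (hne hik) with hlt | hlt
      · exact ⟨((i, p), (k, q)), ⟨⟨hi, by simp only; omega⟩, hk, by simp only; omega⟩,
          ⟨hp, hq, Or.inr hlt⟩, h⟩
      · exact ⟨((k, q), (i, p)), ⟨⟨hk, by simp only; omega⟩, hi, by simp only; omega⟩,
          ⟨hq, hp, Or.inr hlt⟩, fun t ht => (h t ht).symm⟩
    · exact ⟨((i, p), (k, q)), ⟨⟨hi, by simp only; omega⟩, hk, by simp only; omega⟩,
          ⟨hp, hq, Or.inl hik⟩, h⟩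
  have hcardI : I.card = (A * L) ^ 2 := by
    simp [hI, sq]
  calc _ ≤ (I.biUnion E).card * 2 ^ g := Nat.mul_le_mul_right _ (Finset.card_le_card hsub)
    _ ≤ (∑ c ∈ I, (E c).card) * 2 ^ g := Nat.mul_le_mul_right _ Finset.card_biUnion_le
    _ = ∑ c ∈ I, (E c).card * 2 ^ g := Finset.sum_mul _ _ _
    _ ≤ ∑ c ∈ I, Fintype.card (Fin A × Fin L → Bool) := Finset.sum_le_sum ?_
    _ = _ := by rw [Finset.sum_const, smul_eq_mul, hcardI]
  rintro ⟨⟨i, p⟩, ⟨k, q⟩⟩ hc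
  simp only [hI, Finset.mem_product, Finset.mem_range] at hc
  by_cases hcond : p + g ≤ L ∧ q + g ≤ L ∧ (i ≠ k ∨ p < q)
  swap
  · have : E ((i, p), (k, q)) = ∅ := by
      rw [hE]
      exact Finset.filter_false_of_mem fun x _ hx => hcond hx.1
    rw [this]
    simp
  obtain ⟨hp, hq, hne⟩ := hcond
  set s : Finset (ℕ × ℕ) := (Finset.range g).image fun t => (k, q + t) with hs
  have hcard : s.card = g := by
    rw [hs, Finset.card_image_of_injective, Finset.card_range]
    intro t t' heq
    simpa using heq
  have := card_filter_mul_two_pow_le (A := A) (L := L) s (by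
    intro c hc'
    rw [hs, Finset.mem_image] at hc'
    obtain ⟨t, ht, rfl⟩ := hc'
    rw [Finset.mem_range] at ht
    exact ⟨hc.2.1, by simp only; omega⟩)
    (agree ((i, p), (k, q))) (by
    intro x x' hx hx' hoff
    -- the bits of the second substring are recovered one after the other
    have key : ∀ t < g, symbols x k (q + t) = symbols x' k (q + t) := by
      intro t
      induction t using Nat.strong_induction_on with
      | _ t ih =>
        intro ht
        rw [← hx.2 t ht, ← hx'.2 t ht]
        by_cases hmem : (i, p + t) ∈ s
        · rw [hs, Finset.mem_image] at hmem
          obtain ⟨t', ht', heq⟩ := hmem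
          rw [Finset.mem_range] at ht'
          rw [Prod.mk.injEq] at heq
          rw [← heq.1, ← heq.2]
          rcases hne with hne | hne
          · exact absurd heq.1.symm hne
          · exact ih t' (by omega) ht'
        · exact hoff _ _ hmem
    intro i' p' hmem
    rw [hs, Finset.mem_image] at hmem
    obtain ⟨t', ht', heq⟩ := hmem
    rw [Finset.mem_range] at ht'
    rw [Prod.mk.injEq] at heq
    rw [← heq.1, ← heq.2]
    exact key t' ht')
  rw [hcard] at this
  refine (le_of_eq ?_).trans this
  congr!

end

/-! ### Waiting times for anchors and for synchronisation -/

section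

variable {A L : ℕ}

/-- The pattern `1 0^M` occurs at position `p`. Unlike those of the anchor `0^M`, its occurrences do
not overlap. -/
def PatternAt (τ : ℕ → Bool) (M p : ℕ) : Prop :=
  τ p = true ∧ ∀ t, p < t → t ≤ p + M → τ t = false

open Classical in
/-- The expected waiting time for the pattern `1 0^M` is at most `2 ^ (M + 1)`, so a stretch of
length `w` lacks it with probability at most `2 ^ (M + 1) / w`. -/
theorem card_no_pattern_mul_le {M i s w : ℕ} (hi : i < A) (hL : s + w + M ≤ L) :
    (Finset.univ.filter fun x : Fin A × Fin L → Bool =>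
      ∀ j < w, ¬ PatternAt (symbols x i) M (s + j)).card * w ≤
      2 ^ (M + 1) * Fintype.card (Fin A × Fin L → Bool) := by
  -- no occurrence has ended before `s + j`, so that this event does not depend on the next bits
  set P : ℕ → Finset (Fin A × Fin L → Bool) := fun j => Finset.univ.filter fun x =>
    ∀ j', j' + M < j → ¬ PatternAt (symbols x i) M (s + j') with hP
  set G : ℕ → Finset (Fin A × Fin L → Bool) := fun j => Finset.univ.filter fun x =>
    PatternAt (symbols x i) M (s + j) with hG
  have hrenew := sum_card_le_of_disjoint w (2 ^ (M + 1)) P G (by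
    intro j hj
    set c : Finset (ℕ × ℕ) := (Finset.range (M + 1)).image fun t => (i, s + j + t) with hc
    have hcard : c.card = M + 1 := by
      rw [hc, Finset.card_image_of_injective, Finset.card_range]
      intro t t' heq
      simpa using heq
    have h1 := card_le_card_inter_mul_pow (cells A L c) (P j) (G j)
      (fun u => decide ((u.2 : ℕ) = s + j)) (by
        intro x x' hxx hx
        simp only [hP, Finset.mem_filter, Finset.mem_univ, true_and] at hx ⊢
        intro j' hj' hpat
        have key : ∀ t, t < s + j → symbols x i t = symbols x' i t := by
          intro t ht
          apply symbols_congr_of_notMem hxx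
          rw [hc, Finset.mem_image]
          rintro ⟨t', -, heq⟩
          simp only [Prod.mk.injEq, true_and] at heq
          omega
        refine hx j' hj' ⟨?_, fun t h1 h2 => ?_⟩
        · rw [key _ (by omega)]
          exact hpat.1
        · rw [key _ (by omega)]
          exact hpat.2 t h1 h2) (by
        intro x hx
        simp only [hG, Finset.mem_filter, Finset.mem_univ, true_and]
        have hval : ∀ t ≤ M, symbols x i (s + j + t) = decide (s + j + t = s + j) := by
          intro t ht
          have h3 := hx (⟨i, hi⟩, ⟨s + j + t, by omega⟩) (by
            simp only [cells, hc, Finset.mem_filter, Finset.mem_univ, true_and, Finset.mem_image,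
              Finset.mem_range]
            exact ⟨t, by omega, rfl⟩)
          rw [← h3, ← symbols_fin x]
        refine ⟨by simpa using hval 0 (by omega), fun t h1 h2 => ?_⟩
        obtain ⟨t, rfl⟩ : ∃ t', t = s + j + t' := ⟨t - (s + j), by omega⟩
        rw [hval t (by omega)]
        simp
        omega)
    rw [card_cells (s := c) (by
      intro u hu
      rw [hc, Finset.mem_image] at hu
      obtain ⟨t, ht, rfl⟩ := hu
      rw [Finset.mem_range] at ht
      exact ⟨hi, by simp only; omega⟩), hcard, Fintype.card_bool] at h1
    rwa [Nat.mul_comm]) (by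
    intro j _ k _ hjk
    rw [Finset.disjoint_left]
    intro x hx hx'
    simp only [hP, hG, Finset.mem_inter, Finset.mem_filter, Finset.mem_univ, true_and] at hx hx'
    by_cases h1 : j + M < k
    · exact hx'.1 j h1 hx.2
    · have h2 := hx.2.2 (s + k) (by omega) (by omega)
      rw [hx'.2.1] at h2
      exact absurd h2 (by simp))
  refine le_trans ?_ hrenew
  rw [Nat.mul_comm]
  have h1 : ∀ k ∈ Finset.range w, (Finset.univ.filter fun x : Fin A × Fin L → Bool =>
      ∀ j < w, ¬ PatternAt (symbols x i) M (s + j)).card ≤ (P k).card := by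
    intro k hk
    rw [Finset.mem_range] at hk
    apply Finset.card_le_card
    intro x hx
    simp only [hP, Finset.mem_filter, Finset.mem_univ, true_and] at hx ⊢
    exact fun j' hj' => hx j' (by omega)
  have h2 := Finset.card_nsmul_le_sum _ _ _ h1
  rwa [Finset.card_range, smul_eq_mul] at h2

open Classical in
/-- Each window is synchronising with probability at least `1 / 4`. -/
theorem card_le_four_mul_card_syncWindow {M h i k : ℕ} (hM : 1 ≤ M)
    (hh : h ≤ 2 ^ (M - 1)) (hi : i < A) (hL : (k + 1) * windowLength M h ≤ L) :
    Fintype.card (Fin A × Fin L → Bool) ≤ 4 * (Finset.univ.filter fun x : Fin A × Fin L → Bool =>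
      SyncWindow M h (symbols x i) k).card := by
  set C := Fintype.card (Fin A × Fin L → Bool) with hC
  set s := k * windowLength M h + M with hs
  have hsr : (k + 1) * windowLength M h = s + M + h + 2 ^ (M + 3) + 1 := by
    rw [Nat.add_mul, hs]
    unfold windowLength
    generalize 2 ^ (M + 3) = w
    ring
  have hsr' : s + M + h + 1 ≤ (k + 1) * windowLength M h := by
    rw [hsr]
    generalize 2 ^ (M + 3) = w
    omega
  -- the two ways to fail: an anchor in the initial stretch, and no anchor in the rest of the window
  set N1 := (Finset.Ioo s (s + h)).biUnion fun e => Finset.univ.filter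
    fun x : Fin A × Fin L → Bool => AnchorEnd (symbols x i) M e with hN1
  set N2 := Finset.univ.filter fun x : Fin A × Fin L → Bool =>
      ∀ j < 2 ^ (M + 3), ¬ PatternAt (symbols x i) M (s + h + j) with hN2
  have h1 : N1.card * 2 ≤ C := by
    have h3 : N1.card * 2 ^ M ≤ h * C := by
      calc N1.card * 2 ^ M ≤ (∑ e ∈ Finset.Ioo s (s + h), (Finset.univ.filter
            fun x : Fin A × Fin L → Bool => AnchorEnd (symbols x i) M e).card) * 2 ^ M :=
            Nat.mul_le_mul_right _ Finset.card_biUnion_le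
        _ = ∑ e ∈ Finset.Ioo s (s + h), (Finset.univ.filter
            fun x : Fin A × Fin L → Bool => AnchorEnd (symbols x i) M e).card * 2 ^ M :=
            Finset.sum_mul _ _ _
        _ ≤ ∑ e ∈ Finset.Ioo s (s + h), C := by
            refine Finset.sum_le_sum fun e he => card_anchorEnd_symbol_mul_le hi ?_
            rw [Finset.mem_Ioo] at he
            omega
        _ ≤ h * C := by
            rw [Finset.sum_const, smul_eq_mul, Nat.card_Ioo]
            exact Nat.mul_le_mul_right _ (by omega)
    have h4 : 2 ^ M = 2 ^ (M - 1) * 2 := by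
      rw [← pow_succ]
      congr 1
      omega
    have h5 : N1.card * 2 * 2 ^ (M - 1) ≤ C * 2 ^ (M - 1) := by
      calc N1.card * 2 * 2 ^ (M - 1) = N1.card * 2 ^ M := by rw [h4]; ring
        _ ≤ h * C := h3
        _ ≤ 2 ^ (M - 1) * C := Nat.mul_le_mul_right _ hh
        _ = _ := Nat.mul_comm _ _
    exact Nat.le_of_mul_le_mul_right h5 (by positivity)
  have h2 : N2.card * 4 ≤ C := by
    have h3 := card_no_pattern_mul_le (A := A) (L := L) (M := M) (i := i) (s := s + h)
      (w := 2 ^ (M + 3)) hi (by omega)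
    have h4 : N2.card * 4 * 2 ^ (M + 1) ≤ C * 2 ^ (M + 1) := by
      calc N2.card * 4 * 2 ^ (M + 1) = N2.card * 2 ^ (M + 3) := by ring
        _ ≤ 2 ^ (M + 1) * C := h3
        _ = _ := Nat.mul_comm _ _
    exact Nat.le_of_mul_le_mul_right h4 (by positivity)
  have hcover : (Finset.univ : Finset (Fin A × Fin L → Bool)) ⊆
      (Finset.univ.filter fun x => SyncWindow M h (symbols x i) k) ∪ (N1 ∪ N2) := by
    intro x _
    rw [Finset.mem_union, Finset.mem_union]
    by_contra hcon
    push Not at hcon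
    obtain ⟨hc1, hc2, hc3⟩ := hcon
    simp only [hN1, hN2, Finset.mem_biUnion, Finset.mem_filter, Finset.mem_univ, true_and,
      Finset.mem_Ioo] at hc1 hc2 hc3
    push Not at hc2 hc3
    obtain ⟨j, hj, hp1, hp2⟩ := hc3
    refine hc1 ⟨fun e he1 he2 => hc2 e ⟨he1, he2⟩, s + h + j + M + 1, by omega, by omega, by omega,
      fun t ht1 ht2 => hp2 t (by omega) (by omega)⟩
  have h3 := (Finset.card_le_card hcover).trans
    ((Finset.card_union_le _ _).trans (Nat.add_le_add_left (Finset.card_union_le _ _) _))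
  rw [Finset.card_univ, ← hC] at h3
  omega

theorem AnchorEnd.congr {σ τ : ℕ → Bool} {M e : ℕ} (h : ∀ t, e ≤ t + M → t < e → σ t = τ t) :
    AnchorEnd σ M e ↔ AnchorEnd τ M e :=
  and_congr_right fun _ => forall_congr' fun t => forall_congr' fun h1 => forall_congr' fun h2 => by
    rw [h t h1 h2]

theorem SyncWindow.congr {M h k : ℕ} {σ τ : ℕ → Bool} (hM : 1 ≤ M)
    (hστ : ∀ t, k * windowLength M h ≤ t → t < (k + 1) * windowLength M h → σ t = τ t) :
    SyncWindow M h σ k ↔ SyncWindow M h τ k := by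
  have hr : (k + 1) * windowLength M h = k * windowLength M h + windowLength M h := Nat.succ_mul _ _
  have hr2 : M + h ≤ windowLength M h := by
    unfold windowLength
    generalize 2 ^ (M + 3) = w
    omega
  refine and_congr (forall_congr' fun e => forall_congr' fun h1 => forall_congr' fun h2 =>
    not_congr (AnchorEnd.congr fun t h3 h4 => hστ t (by omega) (by omega)))
    (exists_congr fun e => and_congr_right fun h1 => and_congr_right fun h2 =>
      AnchorEnd.congr fun t h3 h4 => hστ t (by omega) (by omega))

open Classical in
/-- If windows are inspected one after the other, in the order `f` (where `I j` holds for those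
inspected before step `j`), then on average at most `4` are inspected before a synchronising one is
found. -/
theorem sum_card_no_syncWindow_le {M h i N : ℕ} (hM : 1 ≤ M)
    (hh : h ≤ 2 ^ (M - 1)) (hi : i < A) (f : ℕ → ℕ) (I : ℕ → ℕ → Prop)
    (hf : ∀ j < N, (f j + 1) * windowLength M h ≤ L) (hI : ∀ j < N, ¬ I j (f j))
    (hfI : ∀ j < N, ∀ k < N, j < k → I k (f j)) :
    ∑ j ∈ Finset.range N, (Finset.univ.filter fun x : Fin A × Fin L → Bool =>
      ∀ k, I j k → ¬ SyncWindow M h (symbols x i) k).card ≤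
      4 * Fintype.card (Fin A × Fin L → Bool) := by
  set G : ℕ → Finset (Fin A × Fin L → Bool) := fun j =>
    Finset.univ.filter fun x => SyncWindow M h (symbols x i) (f j) with hG
  refine sum_card_le_of_disjoint N 4 _ G ?_ ?_
  · intro j hj
    set P := Finset.univ.filter fun x : Fin A × Fin L → Bool =>
      ∀ k, I j k → ¬ SyncWindow M h (symbols x i) k with hP
    set c : Finset (ℕ × ℕ) := (Finset.range (windowLength M h)).image
      fun t => (i, f j * windowLength M h + t) with hc
    have hind := card_mul_card_le_of_independent (cells A L c) P (G j) (by
      intro x x' hxx hx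
      simp only [hP, Finset.mem_filter, Finset.mem_univ, true_and] at hx ⊢
      intro k hk
      rw [← SyncWindow.congr (σ := symbols x i) hM]
      · exact hx k hk
      · intro t ht1 ht2
        apply symbols_congr_of_notMem hxx
        rw [hc, Finset.mem_image]
        rintro ⟨t', ht', heq⟩
        rw [Finset.mem_range] at ht'
        simp only [Prod.mk.injEq, true_and] at heq
        have hne : k ≠ f j := by
          rintro rfl
          exact hI j hj hk
        rcases lt_or_gt_of_ne hne with hlt | hlt
        · have := Nat.mul_le_mul_right (windowLength M h) (Nat.succ_le_of_lt hlt)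
          rw [Nat.succ_eq_add_one] at this
          omega
        · have := Nat.mul_le_mul_right (windowLength M h) (Nat.succ_le_of_lt hlt)
          rw [Nat.succ_mul] at this
          omega) (by
      intro x x' hxx hx
      simp only [hG, Finset.mem_filter, Finset.mem_univ, true_and] at hx ⊢
      rw [← SyncWindow.congr (σ := symbols x i) hM]
      · exact hx
      · intro t ht1 ht2
        apply symbols_congr_of_mem hxx
        rw [Nat.succ_mul] at ht2
        rw [hc, Finset.mem_image]
        exact ⟨t - f j * windowLength M h, Finset.mem_range.2 (by omega), by
          rw [Prod.mk.injEq]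
          exact ⟨rfl, by omega⟩⟩)
    have h1 := card_le_four_mul_card_syncWindow (A := A) (L := L) (k := f j) hM hh hi (hf j hj)
    have hpos : 0 < Fintype.card (Fin A × Fin L → Bool) := Fintype.card_pos
    refine Nat.le_of_mul_le_mul_right ?_ hpos
    calc P.card * Fintype.card (Fin A × Fin L → Bool) ≤ P.card * (4 * (G j).card) :=
          Nat.mul_le_mul_left _ h1
      _ = 4 * (P.card * (G j).card) := by ring
      _ ≤ 4 * ((P ∩ G j).card * Fintype.card (Fin A × Fin L → Bool)) := Nat.mul_le_mul_left _ hind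
      _ = _ := by ring
  · intro j hj k hk hjk
    rw [Finset.disjoint_left]
    intro x hx hx'
    simp only [hG, Finset.mem_inter, Finset.mem_filter, Finset.mem_univ, true_and] at hx hx'
    exact hx'.1 (f j) (hfI j hj k hk hjk) hx.2

theorem sum_range_div_le (L r : ℕ) (hr : 0 < r) (f : ℕ → ℕ) :
    ∑ o ∈ Finset.range L, f (o / r) ≤ r * ∑ k ∈ Finset.range ((L - 1) / r + 1), f k := by
  have hmaps : ∀ o ∈ Finset.range L, o / r ∈ Finset.range ((L - 1) / r + 1) := by
    intro o ho
    rw [Finset.mem_range] at ho ⊢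
    exact Nat.lt_succ_of_le (Nat.div_le_div_right (by omega))
  rw [← Finset.sum_fiberwise_of_maps_to hmaps, Finset.mul_sum]
  refine Finset.sum_le_sum fun k _ => ?_
  have h1 : ∀ o ∈ (Finset.range L).filter fun o => o / r = k, f (o / r) ≤ f k := by
    intro o ho
    rw [(Finset.mem_filter.1 ho).2]
  refine (Finset.sum_le_card_nsmul _ _ _ h1).trans ?_
  rw [smul_eq_mul]
  refine Nat.mul_le_mul_right _ ?_
  have h2 : ((Finset.range L).filter fun o => o / r = k) ⊆ Finset.Ico (k * r) (k * r + r) := by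
    intro o ho
    have h3 := (Finset.mem_filter.1 ho).2
    have h4 := Nat.div_add_mod' o r
    have h5 := Nat.mod_lt o hr
    rw [h3] at h4
    rw [Finset.mem_Ico]
    omega
  simpa using Finset.card_le_card h2

open Classical in
/-- On average, a symbol has `O(windowLength M h)` unsynchronised offsets. -/
theorem sum_card_unsynced_le {M h i : ℕ} (hM : 1 ≤ M) (hh : h ≤ 2 ^ (M - 1))
    (hi : i < A) :
    ∑ x : Fin A × Fin L → Bool,
      ((Finset.range L).filter fun o => Unsynced M h L (symbols x i) o).card ≤
      10 * windowLength M h * Fintype.card (Fin A × Fin L → Bool) := by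
  set C := Fintype.card (Fin A × Fin L → Bool) with hC
  set r := windowLength M h with hr
  have hr0 : 0 < r := windowLength_pos M h
  set K := (L - 1) / r with hK
  set before : ℕ → ℕ := fun k => (Finset.univ.filter fun x : Fin A × Fin L → Bool =>
    ∀ k', k' < k → ¬ SyncWindow M h (symbols x i) k').card with hbefore
  set after : ℕ → ℕ := fun k => (Finset.univ.filter fun x : Fin A × Fin L → Bool =>
    ∀ k', k < k' ∧ k' < K → ¬ SyncWindow M h (symbols x i) k').card with hafter
  have hKL : ∀ k < K, (k + 1) * r ≤ L := by
    intro k hk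
    have h1 : (k + 1) * r ≤ (L - 1) / r * r := Nat.mul_le_mul_right r hk
    have h2 := Nat.div_mul_le_self (L - 1) r
    omega
  have hb : ∑ k ∈ Finset.range (K + 1), before k ≤ 5 * C := by
    rw [Finset.sum_range_succ]
    have h1 := sum_card_no_syncWindow_le (A := A) (L := L) (N := K) hM hh hi (fun j => j)
      (fun j k => k < j) (fun j hj => hKL j hj) (fun j _ => lt_irrefl j) (fun j _ k _ hjk => hjk)
    have h2 : before K ≤ C := Finset.card_le_univ _
    have h3 : ∑ k ∈ Finset.range K, before k ≤ 4 * C := by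
      refine (le_of_eq ?_).trans h1
      congr!
    omega
  have ha : ∑ k ∈ Finset.range (K + 1), after k ≤ 5 * C := by
    rw [Finset.sum_range_succ, ← Finset.sum_range_reflect]
    have h1 := sum_card_no_syncWindow_le (A := A) (L := L) (N := K) hM hh hi
      (fun j => K - 1 - j) (fun j k => K - 1 - j < k ∧ k < K) (fun j hj => hKL _ (by omega))
      (fun j _ h => absurd h.1 (lt_irrefl _))
      (fun j hj k hk hjk => ⟨by omega, by omega⟩)
    have h2 : after K ≤ C := Finset.card_le_univ _
    have h3 : ∑ k ∈ Finset.range K, after (K - 1 - k) ≤ 4 * C := by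
      refine (le_of_eq ?_).trans h1
      congr!
    omega
  calc ∑ x : Fin A × Fin L → Bool,
      ((Finset.range L).filter fun o => Unsynced M h L (symbols x i) o).card
      = ∑ o ∈ Finset.range L, (Finset.univ.filter fun x : Fin A × Fin L → Bool =>
          Unsynced M h L (symbols x i) o).card := by
        simp_rw [Finset.card_filter]
        exact Finset.sum_comm
    _ ≤ ∑ o ∈ Finset.range L, (before (o / r) + after (o / r)) := by
        refine Finset.sum_le_sum fun o _ => ?_
        refine (Finset.card_le_card ?_).trans (Finset.card_union_le _ _)
        intro x hx
        rw [Finset.mem_filter] at hx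
        rw [Finset.mem_union, Finset.mem_filter, Finset.mem_filter]
        rcases hx.2 with h1 | h1
        · exact Or.inl ⟨hx.1, h1⟩
        · exact Or.inr ⟨hx.1, fun k' hk' => h1 k' hk'.1 hk'.2⟩
    _ ≤ r * ∑ k ∈ Finset.range (K + 1), (before k + after k) :=
        sum_range_div_le L r hr0 fun k => before k + after k
    _ ≤ r * (5 * C + 5 * C) := by
        rw [Finset.sum_add_distrib]
        exact Nat.mul_le_mul_left _ (Nat.add_le_add hb ha)
    _ = 10 * r * C := by ring

end

/-! ### Random blocks -/

/-- The indices of the blocks, extended by zero. -/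
def blockIndex {A B : ℕ} (y : Fin B → Fin A) (b : ℕ) : ℕ :=
  if h : b < B then y ⟨b, h⟩ else 0

theorem blockIndex_lt {A B : ℕ} (hA : 0 < A) (y : Fin B → Fin A) (b : ℕ) :
    blockIndex y b < A := by
  unfold blockIndex
  split_ifs with h
  · exact (y ⟨b, h⟩).2
  · exact hA

open Classical in
/-- Two pairs of consecutive blocks agree with probability at most `1 / A ^ 2`, even if the pairs
overlap. -/
theorem card_repeated_pair_mul_le {A B b b' : ℕ} (hb' : 1 ≤ b') (hbb : b' < b) (hb : b < B) :
    (Finset.univ.filter fun y : Fin B → Fin A => blockIndex y (b' - 1) = blockIndex y (b - 1) ∧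
      blockIndex y b' = blockIndex y b).card * A ^ 2 ≤ Fintype.card (Fin B → Fin A) := by
  have h1 := card_mul_pow_le_of_determined (α := Fin A)
    ({⟨b - 1, (Nat.sub_le b 1).trans_lt hb⟩, ⟨b, hb⟩} : Finset (Fin B))
    (Finset.univ.filter fun y : Fin B → Fin A => blockIndex y (b' - 1) = blockIndex y (b - 1) ∧
      blockIndex y b' = blockIndex y b) (by
    intro y hy u hu hyu
    have hy := (Finset.mem_filter.1 hy).2
    have hu := (Finset.mem_filter.1 hu).2
    unfold blockIndex at hy hu
    rw [dif_pos (by omega), dif_pos (by omega), dif_pos (by omega), dif_pos (by omega)] at hy hu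
    have hval : ∀ c : Fin B, (c : ℕ) < b - 1 → y c = u c := by
      intro c hc
      apply hyu
      simp only [Finset.mem_insert, Finset.mem_singleton, Fin.ext_iff]
      omega
    have h2 : y ⟨b - 1, by omega⟩ = u ⟨b - 1, by omega⟩ := by
      apply Fin.ext
      rw [← hy.1, ← hu.1, hval ⟨b' - 1, by omega⟩ (by simp only; omega)]
    have h3 : ∀ c : Fin B, (c : ℕ) < b → y c = u c := by
      intro c hc
      rcases Nat.lt_or_ge c (b - 1) with hlt | hge
      · exact hval c hlt
      · have : c = ⟨b - 1, by omega⟩ := Fin.ext (by simp only; omega)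
        rw [this]
        exact h2
    funext c
    by_cases hc : (c : ℕ) < b
    · exact h3 c hc
    · by_cases hcb : (c : ℕ) = b
      · have : c = ⟨b, hb⟩ := Fin.ext hcb
        rw [this]
        apply Fin.ext
        rw [← hy.2, ← hu.2, h3 ⟨b', by omega⟩ hbb]
      · apply hyu
        simp only [Finset.mem_insert, Finset.mem_singleton, Fin.ext_iff]
        omega)
  rw [Finset.card_pair (by
    intro h
    have := Fin.ext_iff.1 h
    simp only at this
    omega), Fintype.card_fin] at h1
  exact h1

/-! ### Expectations over independent symbols -/

/-- The array of bits of independent symbols, and the block indices, are drawn uniformly; `mean F`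
is the expectation of `F`. Unlike in the source, symbols may coincide. -/
noncomputable def mean {A L B : ℕ} (F : (Fin A × Fin L → Bool) → (Fin B → Fin A) → ℝ) : ℝ :=
  (∑ x, ∑ y, F x y) /
    ((Fintype.card (Fin A × Fin L → Bool) : ℝ) * (Fintype.card (Fin B → Fin A) : ℝ))

/-- The source sequence of the symbols `x` and the block indices `y`. -/
def text {A L B : ℕ} (x : Fin A × Fin L → Bool) (y : Fin B → Fin A) : List Bool :=
  slice (blockSeq (symbols x) (blockIndex y) L) 0 (B * L)

section

variable {A L B : ℕ}

theorem card_symbols_pos : (0 : ℝ) < Fintype.card (Fin A × Fin L → Bool) := by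
  exact_mod_cast Fintype.card_pos

theorem card_blocks_pos (hA : 0 < A) : (0 : ℝ) < Fintype.card (Fin B → Fin A) := by
  have : NeZero A := ⟨hA.ne'⟩
  exact_mod_cast Fintype.card_pos

theorem mean_mono {F G : (Fin A × Fin L → Bool) → (Fin B → Fin A) → ℝ}
    (h : ∀ x y, F x y ≤ G x y) : mean F ≤ mean G := by
  unfold mean
  have : ∑ x, ∑ y, F x y ≤ ∑ x, ∑ y, G x y :=
    Finset.sum_le_sum fun x _ => Finset.sum_le_sum fun y _ => h x y
  gcongr

theorem mean_add (F G : (Fin A × Fin L → Bool) → (Fin B → Fin A) → ℝ) :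
    mean (fun x y => F x y + G x y) = mean F + mean G := by
  unfold mean
  simp only [Finset.sum_add_distrib, add_div]

theorem mean_sub (F G : (Fin A × Fin L → Bool) → (Fin B → Fin A) → ℝ) :
    mean (fun x y => F x y - G x y) = mean F - mean G := by
  unfold mean
  simp only [Finset.sum_sub_distrib, sub_div]

theorem mean_const_mul (c : ℝ) (F : (Fin A × Fin L → Bool) → (Fin B → Fin A) → ℝ) :
    mean (fun x y => c * F x y) = c * mean F := by
  unfold mean
  simp only [← Finset.mul_sum, mul_div_assoc]

theorem mean_sum {κ : Type*} (s : Finset κ)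
    (F : κ → (Fin A × Fin L → Bool) → (Fin B → Fin A) → ℝ) :
    mean (fun x y => ∑ k ∈ s, F k x y) = ∑ k ∈ s, mean (F k) := by
  unfold mean
  rw [← Finset.sum_div, Finset.sum_comm (s := s)]
  congr 1
  exact Finset.sum_congr rfl fun x _ => Finset.sum_comm

theorem mean_const (hA : 0 < A) (c : ℝ) :
    mean (fun (_ : Fin A × Fin L → Bool) (_ : Fin B → Fin A) => c) = c := by
  unfold mean
  have h1 := card_symbols_pos (A := A) (L := L)
  have h2 := card_blocks_pos (B := B) hA
  rw [div_eq_iff (by positivity)]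
  simp only [Finset.sum_const, Finset.card_univ, nsmul_eq_mul]
  ring

theorem mean_le_of_forall_blocks (hA : 0 < A) {F : (Fin A × Fin L → Bool) → (Fin B → Fin A) → ℝ}
    {K : ℝ} (h : ∀ y, ∑ x, F x y ≤ K * Fintype.card (Fin A × Fin L → Bool)) : mean F ≤ K := by
  unfold mean
  have h1 := card_symbols_pos (A := A) (L := L)
  have h2 := card_blocks_pos (B := B) hA
  rw [div_le_iff₀ (by positivity), Finset.sum_comm]
  refine (Finset.sum_le_sum fun y _ => h y).trans ?_
  simp only [Finset.sum_const, Finset.card_univ, nsmul_eq_mul]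
  exact le_of_eq (by ring)

theorem le_mean_of_forall_blocks (hA : 0 < A) {F : (Fin A × Fin L → Bool) → (Fin B → Fin A) → ℝ}
    {K : ℝ} (h : ∀ y, K * Fintype.card (Fin A × Fin L → Bool) ≤ ∑ x, F x y) : K ≤ mean F := by
  unfold mean
  have h1 := card_symbols_pos (A := A) (L := L)
  have h2 := card_blocks_pos (B := B) hA
  rw [le_div_iff₀ (by positivity), Finset.sum_comm (s := Finset.univ)]
  refine le_trans ?_ (Finset.sum_le_sum fun y _ => h y)
  simp only [Finset.sum_const, Finset.card_univ, nsmul_eq_mul]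
  exact le_of_eq (by ring)

theorem mean_le_of_forall_symbols (hA : 0 < A) {F : (Fin A × Fin L → Bool) → (Fin B → Fin A) → ℝ}
    {K : ℝ} (h : ∀ x, ∑ y, F x y ≤ K * Fintype.card (Fin B → Fin A)) : mean F ≤ K := by
  unfold mean
  have h1 := card_symbols_pos (A := A) (L := L)
  have h2 := card_blocks_pos (B := B) hA
  rw [div_le_iff₀ (by positivity)]
  refine (Finset.sum_le_sum fun x _ => h x).trans ?_
  simp only [Finset.sum_const, Finset.card_univ, nsmul_eq_mul]
  exact le_of_eq (by ring)

/-! ### The source in terms of independent symbols -/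

theorem sourceSequence_eq_text (ω : Outcome A L B) :
    sourceSequence ω = text (fun c => ω.1 c.1 c.2) ω.2 := by
  have h1 := List.ofFn_mul (m := B) (n := L)
    (fun k => blockSeq (symbols fun c : Fin A × Fin L => ω.1 c.1 c.2) (blockIndex ω.2) L k)
  have h2 : text (fun c => ω.1 c.1 c.2) ω.2 = List.ofFn (fun k : Fin (B * L) =>
      blockSeq (symbols fun c : Fin A × Fin L => ω.1 c.1 c.2) (blockIndex ω.2) L k) := by
    apply List.ext_getElem
    · simp [text]
    · intro t _ _
      simp [text, slice]
  rw [h2, h1, sourceSequence]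
  congr 2
  funext b
  congr 1
  funext j
  simp only
  rw [blockSeq_add _ _ j.2]
  simp [symbols, blockIndex]

theorem sum_outcome (f : List Bool → ℝ) :
    ∑ ω : Outcome A L B, f (sourceSequence ω) =
      ∑ e : Fin A ↪ (Fin L → Bool), ∑ y : Fin B → Fin A, f (text (fun c => e c.1 c.2) y) := by
  rw [Fintype.sum_prod_type]
  simp only [sourceSequence_eq_text]

open Classical in
theorem sum_embedding (F : (Fin A × Fin L → Bool) → ℝ) :
    ∑ e : Fin A ↪ (Fin L → Bool), F (fun c => e c.1 c.2) =
      ∑ x ∈ Finset.univ.filter (fun x : Fin A × Fin L → Bool =>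
        Function.Injective fun i p => x (i, p)), F x := by
  refine Finset.sum_bij (fun e _ c => e c.1 c.2) ?_ ?_ ?_ ?_
  · intro e _
    rw [Finset.mem_filter]
    exact ⟨Finset.mem_univ _, e.injective⟩
  · intro e _ e' _ heq
    apply DFunLike.ext
    intro i
    funext p
    exact congrFun heq (i, p)
  · intro x hx
    rw [Finset.mem_filter] at hx
    exact ⟨⟨fun i p => x (i, p), hx.2⟩, Finset.mem_univ _, rfl⟩
  · intro e _
    rfl

theorem DistinctSubstrings.injective {g : ℕ} {x : Fin A × Fin L → Bool} (hg : g ≤ L)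
    (h : DistinctSubstrings g A L (symbols x)) : Function.Injective fun i p => x (i, p) := by
  intro i k hik
  refine Fin.ext (h i i.2 k k.2 0 0 (by omega) (by omega) fun t ht => ?_).1
  have := congrFun hik ⟨t, by omega⟩
  simp only at this
  rw [← symbols_fin x (i, ⟨t, by omega⟩), ← symbols_fin x (k, ⟨t, by omega⟩)] at this
  simpa using this

theorem card_outcome : (Fintype.card (Outcome A L B) : ℝ) =
    (Fintype.card (Fin A ↪ (Fin L → Bool)) : ℝ) * (Fintype.card (Fin B → Fin A) : ℝ) := by
  rw [Fintype.card_prod, Nat.cast_mul]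

theorem card_embedding_le : (Fintype.card (Fin A ↪ (Fin L → Bool)) : ℝ) ≤
    (Fintype.card (Fin A × Fin L → Bool) : ℝ) := by
  have h := Fintype.card_le_of_injective
    (fun (e : Fin A ↪ (Fin L → Bool)) (c : Fin A × Fin L) => e c.1 c.2) (by
      intro e e' heq
      apply DFunLike.ext
      intro i
      funext p
      exact congrFun heq (i, p))
  exact_mod_cast h

/-- Independent symbols are distinct with probability at least one half. -/
theorem card_symbols_le_two_mul (hL : 1 ≤ L) (h : 2 * (A * L) ^ 2 ≤ 2 ^ L) :
    (Fintype.card (Fin A × Fin L → Bool) : ℝ) ≤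
      2 * (Fintype.card (Fin A ↪ (Fin L → Bool)) : ℝ) := by
  classical
  set C := Fintype.card (Fin A × Fin L → Bool) with hC
  have h1 := card_not_distinctSubstrings_mul_le (A := A) (L := L) hL
  set N := Finset.univ.filter fun x : Fin A × Fin L → Bool =>
      ¬ DistinctSubstrings L A L (symbols x) with hN
  set I := Finset.univ.filter fun x : Fin A × Fin L → Bool =>
        Function.Injective fun i p => x (i, p) with hI
  have h2 : N.card * 2 ≤ C := by
    refine Nat.le_of_mul_le_mul_right (c := 2 ^ L) ?_ (by positivity)
    calc N.card * 2 * 2 ^ L = 2 * (N.card * 2 ^ L) := by ring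
      _ ≤ 2 * ((A * L) ^ 2 * C) := Nat.mul_le_mul_left 2 h1
      _ = 2 * (A * L) ^ 2 * C := by ring
      _ ≤ 2 ^ L * C := Nat.mul_le_mul_right C h
      _ = C * 2 ^ L := Nat.mul_comm _ _
  have h3 : (Finset.univ : Finset (Fin A × Fin L → Bool)) ⊆ I ∪ N := by
    intro x _
    rw [Finset.mem_union]
    by_cases hx : DistinctSubstrings L A L (symbols x)
    · exact Or.inl (Finset.mem_filter.2 ⟨Finset.mem_univ _, hx.injective le_rfl⟩)
    · exact Or.inr (Finset.mem_filter.2 ⟨Finset.mem_univ _, hx⟩)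
  have h4 := (Finset.card_le_card h3).trans (Finset.card_union_le _ _)
  rw [Finset.card_univ, ← hC] at h4
  have h5 : (I.card : ℝ) = Fintype.card (Fin A ↪ (Fin L → Bool)) := by
    have := sum_embedding (A := A) (L := L) fun _ => 1
    simp only [Finset.sum_const, nsmul_eq_mul, mul_one, Finset.card_univ] at this
    rw [this]
  have h6 : C ≤ 2 * I.card := by omega
  rw [← h5]
  exact_mod_cast h6

/-- Sampling without replacement at most doubles expectations. -/
theorem expectation_le_two_mul_mean (hA : 0 < A) (hL : 1 ≤ L) (h : 2 * (A * L) ^ 2 ≤ 2 ^ L)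
    {f : List Bool → ℝ} (hf : ∀ s, 0 ≤ f s) :
    expectation A L B f ≤ 2 * mean (A := A) (L := L) (B := B) fun x y => f (text x y) := by
  classical
  have h1 := card_symbols_le_two_mul hL h
  have h2 := card_symbols_pos (A := A) (L := L)
  have h3 := card_blocks_pos (B := B) hA
  have h4 : (0 : ℝ) < Fintype.card (Fin A ↪ (Fin L → Bool)) := by linarith
  unfold expectation mean
  rw [card_outcome, sum_outcome, ← mul_div_assoc, div_le_div_iff₀ (by positivity) (by positivity),
    sum_embedding fun x => ∑ y : Fin B → Fin A, f (text x y)]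
  have h5 : ∑ x ∈ Finset.univ.filter (fun x : Fin A × Fin L → Bool =>
      Function.Injective fun i p => x (i, p)), ∑ y : Fin B → Fin A, f (text x y) ≤
      ∑ x : Fin A × Fin L → Bool, ∑ y : Fin B → Fin A, f (text x y) :=
    Finset.sum_le_sum_of_subset_of_nonneg (Finset.filter_subset _ _)
      fun x _ _ => Finset.sum_nonneg fun y _ => hf _
  have h6 : (0 : ℝ) ≤ ∑ x : Fin A × Fin L → Bool, ∑ y : Fin B → Fin A, f (text x y) :=
    Finset.sum_nonneg fun x _ => Finset.sum_nonneg fun y _ => hf _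
  calc _ ≤ (∑ x : Fin A × Fin L → Bool, ∑ y : Fin B → Fin A, f (text x y)) *
        ((2 * (Fintype.card (Fin A ↪ (Fin L → Bool)) : ℝ)) *
          (Fintype.card (Fin B → Fin A) : ℝ)) :=
        mul_le_mul h5 (mul_le_mul_of_nonneg_right h1 h3.le) (by positivity) h6
    _ = _ := by ring

/-- Events that imply that the symbols are distinct carry over to the source. -/
theorem mean_le_expectation (hA : 0 < A) {g : ℕ} (hg : g ≤ L)
    (hne : 0 < Fintype.card (Fin A ↪ (Fin L → Bool))) {f : List Bool → ℝ} (hf : ∀ s, 0 ≤ f s)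
    {F : (Fin A × Fin L → Bool) → (Fin B → Fin A) → ℝ}
    (hF : ∀ x y, DistinctSubstrings g A L (symbols x) → F x y ≤ f (text x y))
    (hF0 : ∀ x y, ¬ DistinctSubstrings g A L (symbols x) → F x y ≤ 0) :
    mean F ≤ expectation A L B f := by
  classical
  have h2 := card_symbols_pos (A := A) (L := L)
  have h3 := card_blocks_pos (B := B) hA
  have h4 : (0 : ℝ) < Fintype.card (Fin A ↪ (Fin L → Bool)) := by exact_mod_cast hne
  have h5 := card_embedding_le (A := A) (L := L)
  unfold expectation mean
  rw [card_outcome, sum_outcome, sum_embedding fun x => ∑ y : Fin B → Fin A, f (text x y)]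
  set S := ∑ x ∈ Finset.univ.filter (fun x : Fin A × Fin L → Bool =>
      Function.Injective fun i p => x (i, p)), ∑ y : Fin B → Fin A, f (text x y) with hS
  have h6 : 0 ≤ S := Finset.sum_nonneg fun x _ => Finset.sum_nonneg fun y _ => hf _
  have h7 : ∑ x, ∑ y, F x y ≤ S := by
    rw [hS, Finset.sum_filter]
    refine Finset.sum_le_sum fun x _ => ?_
    by_cases hx : DistinctSubstrings g A L (symbols x)
    · rw [if_pos (hx.injective hg)]
      exact Finset.sum_le_sum fun y _ => hF x y hx
    · refine (Finset.sum_nonpos fun y _ => hF0 x y hx).trans ?_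
      split_ifs
      · exact Finset.sum_nonneg fun y _ => hf _
      · exact le_rfl
  calc _ ≤ S / ((Fintype.card (Fin A × Fin L → Bool) : ℝ) *
        (Fintype.card (Fin B → Fin A) : ℝ)) := by gcongr
    _ ≤ _ := by gcongr

/-! ### The optimal rate -/

/-- Words are numbered by reading them, after a leading `1`, as binary numbers. -/
def wordNumber : List Bool → ℕ
  | [] => 1
  | b :: l => 2 * wordNumber l + b.toNat

theorem wordNumber_pos (l : List Bool) : 1 ≤ wordNumber l := by
  induction l with
  | nil => exact le_rfl
  | cons b l ih =>
    rw [wordNumber]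
    omega

theorem wordNumber_lt (l : List Bool) : wordNumber l < 2 ^ (l.length + 1) := by
  induction l with
  | nil => simp [wordNumber]
  | cons b l ih =>
    have := Bool.toNat_le b
    rw [wordNumber, List.length_cons, pow_succ]
    omega

theorem wordNumber_injective : Function.Injective wordNumber := by
  intro l
  induction l with
  | nil =>
    intro l' h
    cases l' with
    | nil => rfl
    | cons b l' =>
      have := wordNumber_pos l'
      simp only [wordNumber] at h
      omega
  | cons b l ih =>
    intro l' h
    cases l' with
    | nil =>
      have := wordNumber_pos l
      simp only [wordNumber] at h
      omega
    | cons b' l' =>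
      simp only [wordNumber] at h
      have h1 := Bool.toNat_le b
      have h2 := Bool.toNat_le b'
      have hb : b = b' := by
        cases b <;> cases b' <;> simp only [Bool.toNat_true, Bool.toNat_false] at h <;>
          first
          | rfl
          | omega
      rw [ih (show wordNumber l = wordNumber l' by omega), hb]

/-- An injective encoding of `2 ^ (k + 1)` or more values spends at least `k / 2` bits on
average. -/
theorem half_mul_card_le_sum_length {β : Type*} [Fintype β] (k : ℕ)
    (hβ : 2 ^ (k + 1) ≤ Fintype.card β) (enc : β → List Bool) (henc : Function.Injective enc) :
    (k : ℝ) / 2 * Fintype.card β ≤ ∑ b, ((enc b).length : ℝ) := by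
  classical
  set S := Finset.univ.filter fun b => (enc b).length < k with hS
  have h1 : S.card ≤ 2 ^ k := by
    rw [← Finset.card_range (2 ^ k)]
    apply Finset.card_le_card_of_injOn fun b => wordNumber (enc b)
    · intro b hb
      rw [hS, Finset.mem_coe, Finset.mem_filter] at hb
      rw [Finset.mem_coe, Finset.mem_range]
      exact (wordNumber_lt _).trans_le (Nat.pow_le_pow_right (by norm_num) hb.2)
    · exact (wordNumber_injective.comp henc).injOn
  have h2 : Fintype.card β ≤ 2 * Sᶜ.card := by
    rw [Finset.card_compl]
    rw [pow_succ] at hβ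
    omega
  have h3 : (Fintype.card β : ℝ) ≤ 2 * Sᶜ.card := by exact_mod_cast h2
  calc (k : ℝ) / 2 * Fintype.card β ≤ (k : ℝ) / 2 * (2 * Sᶜ.card) := by gcongr
    _ = ∑ b ∈ Sᶜ, (k : ℝ) := by
        rw [Finset.sum_const, nsmul_eq_mul]
        ring
    _ ≤ ∑ b ∈ Sᶜ, ((enc b).length : ℝ) := by
        refine Finset.sum_le_sum fun b hb => ?_
        rw [hS, Finset.mem_compl, Finset.mem_filter] at hb
        have : k ≤ (enc b).length := by
          by_contra hlt
          exact hb ⟨Finset.mem_univ _, by omega⟩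
        exact_mod_cast this
    _ ≤ _ := Finset.sum_le_sum_of_subset_of_nonneg (Finset.subset_univ _)
        fun b _ _ => Nat.cast_nonneg _

/-- The block indices are determined by the source sequence if the symbols are distinct. -/
theorem text_injective (e : Fin A ↪ (Fin L → Bool)) :
    Function.Injective fun y : Fin B → Fin A => text (fun c => e c.1 c.2) y := by
  intro y y' heq
  funext b
  apply e.injective
  funext p
  have h1 := slice_eq_slice.1 heq (b * L + p) (by
    have h2 : (b : ℕ) * L + L ≤ B * L := by
      rw [← Nat.succ_mul]
      exact Nat.mul_le_mul_right L b.2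
    have := p.2
    omega)
  rw [Nat.zero_add, blockSeq_add _ _ p.2, blockSeq_add _ _ p.2] at h1
  simpa [symbols, blockIndex] using h1

/-- Every value of the source sequence can be encoded by the number of an outcome that produces
it, in a fixed number of bits. -/
theorem exists_prefixFreeOn {w : ℕ} (hw : Fintype.card (Outcome A L B) ≤ 2 ^ w) :
    ∃ enc : List Bool → List Bool, PrefixFreeOn (sourceSupport A L B) enc ∧
      ∀ s, (enc s).length = w := by
  classical
  set number : List Bool → ℕ := fun s =>
    if h : ∃ ω : Outcome A L B, sourceSequence ω = s then
      (Fintype.equivFin (Outcome A L B) h.choose : ℕ) else 0 with hnumber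
  refine ⟨fun s => binary w (number s), ?_, fun s => binary_length w _⟩
  intro s hs t ht hne hpre
  have hs' : ∃ ω : Outcome A L B, sourceSequence ω = s := hs
  have ht' : ∃ ω : Outcome A L B, sourceSequence ω = t := ht
  have heq := hpre.eq_of_length (by rw [binary_length, binary_length])
  have h1 : ∀ s (h : ∃ ω : Outcome A L B, sourceSequence ω = s),
      number s = (Fintype.equivFin (Outcome A L B) h.choose : ℕ) := by
    intro s h
    rw [hnumber]
    exact dif_pos h
  have h2 := binary_inj (by rw [h1 s hs']; exact (Fin.is_lt _).trans_le hw)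
    (by rw [h1 t ht']; exact (Fin.is_lt _).trans_le hw) heq
  rw [h1 s hs', h1 t ht'] at h2
  have h3 := (Fintype.equivFin (Outcome A L B)).injective (Fin.ext h2)
  apply hne
  rw [← hs'.choose_spec, ← ht'.choose_spec, h3]

theorem expectation_nonneg {f : List Bool → ℝ} (hf : ∀ s, 0 ≤ f s) : 0 ≤ expectation A L B f :=
  div_nonneg (Finset.sum_nonneg fun _ _ => hf _) (Nat.cast_nonneg _)

theorem expectation_const (hA : 0 < A) (hne : 0 < Fintype.card (Fin A ↪ (Fin L → Bool))) (c : ℝ) :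
    expectation A L B (fun _ => c) = c := by
  have h3 := card_blocks_pos (B := B) hA
  have h4 : (0 : ℝ) < Fintype.card (Fin A ↪ (Fin L → Bool)) := by exact_mod_cast hne
  unfold expectation
  rw [card_outcome, div_eq_iff (by positivity), Finset.sum_const, Finset.card_univ, nsmul_eq_mul,
    card_outcome]
  ring

theorem optimalRate_le (hA : 0 < A) (hne : 0 < Fintype.card (Fin A ↪ (Fin L → Bool))) {ν : ℕ}
    (hν : A ≤ 2 ^ ν) : optimalRate A L B ≤ A * L + B * ν := by
  have hw : Fintype.card (Outcome A L B) ≤ 2 ^ (A * L + B * ν) := by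
    have h1 : Fintype.card (Fin A ↪ (Fin L → Bool)) ≤ 2 ^ (A * L) := by
      have := card_embedding_le (A := A) (L := L)
      have h2 : Fintype.card (Fin A × Fin L → Bool) = 2 ^ (A * L) := by simp
      rw [h2] at this
      exact_mod_cast this
    have h2 : Fintype.card (Fin B → Fin A) ≤ 2 ^ (B * ν) := by
      rw [Fintype.card_fun, Fintype.card_fin, Fintype.card_fin, Nat.mul_comm, pow_mul]
      exact Nat.pow_le_pow_left hν B
    rw [Fintype.card_prod, pow_add]
    exact Nat.mul_le_mul h1 h2
  obtain ⟨enc, henc, hlen⟩ := exists_prefixFreeOn hw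
  unfold optimalRate
  refine csInf_le ⟨0, ?_⟩ ⟨enc, henc, ?_⟩
  · rintro r ⟨enc, -, rfl⟩
    exact expectation_nonneg fun s => Nat.cast_nonneg _
  · simp only [hlen]
    rw [expectation_const hA hne]
    push_cast
    ring

theorem le_optimalRate (hA : 0 < A) (hne : 0 < Fintype.card (Fin A ↪ (Fin L → Bool))) {ν : ℕ}
    (hν : 2 ^ ν ≤ A) (hpos : 1 ≤ ν * B) : ((ν * B : ℝ) - 1) / 2 ≤ optimalRate A L B := by
  have h3 := card_blocks_pos (B := B) hA
  have h4 : (0 : ℝ) < Fintype.card (Fin A ↪ (Fin L → Bool)) := by exact_mod_cast hne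
  unfold optimalRate
  apply le_csInf
  · obtain ⟨enc, henc, -⟩ := exists_prefixFreeOn (A := A) (L := L) (B := B)
      (w := Fintype.card (Outcome A L B)) Nat.lt_two_pow_self.le
    exact ⟨_, enc, henc, rfl⟩
  · rintro r ⟨enc, henc, rfl⟩
    unfold expectation
    rw [card_outcome, le_div_iff₀ (by positivity), sum_outcome fun s => ((enc s).length : ℝ)]
    have hcard : 2 ^ (ν * B - 1 + 1) ≤ Fintype.card (Fin B → Fin A) := by
      rw [Nat.sub_add_cancel hpos, Fintype.card_fun, Fintype.card_fin, Fintype.card_fin, pow_mul]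
      exact Nat.pow_le_pow_left hν B
    have h5 : ∀ e : Fin A ↪ (Fin L → Bool),
        ((ν * B : ℝ) - 1) / 2 * Fintype.card (Fin B → Fin A) ≤
        ∑ y : Fin B → Fin A, ((enc (text (fun c => e c.1 c.2) y)).length : ℝ) := by
      intro e
      have h6 := half_mul_card_le_sum_length (ν * B - 1) hcard
        (fun y : Fin B → Fin A => enc (text (fun c => e c.1 c.2) y)) (by
          intro y y' heq
          by_contra hne
          refine henc (text (fun c => e c.1 c.2) y) ⟨(e, y), sourceSequence_eq_text _⟩
            (text (fun c => e c.1 c.2) y') ⟨(e, y'), sourceSequence_eq_text _⟩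
            (fun h => hne (text_injective e h)) ?_
          simp only at heq
          rw [heq])
      rw [Nat.cast_sub hpos] at h6
      push_cast at h6
      exact h6
    refine le_trans ?_ (Finset.sum_le_sum fun e _ => h5 e)
    rw [Finset.sum_const, Finset.card_univ, nsmul_eq_mul]
    exact le_of_eq (by ring)

end

/-! ### Expected numbers of chunks and phrases, and the rates -/

open Classical in
/-- The indicator of a proposition. -/
noncomputable def indicator (p : Prop) : ℝ := if p then 1 else 0

theorem indicator_of {p : Prop} (h : p) : indicator p = 1 := if_pos h

theorem indicator_of_not {p : Prop} (h : ¬ p) : indicator p = 0 := if_neg h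

theorem indicator_nonneg (p : Prop) : 0 ≤ indicator p := by
  unfold indicator
  split_ifs <;> norm_num

theorem indicator_le_one (p : Prop) : indicator p ≤ 1 := by
  unfold indicator
  split_ifs <;> norm_num

theorem sum_indicator {κ : Type*} (s : Finset κ) (p : κ → Prop) [DecidablePred p] :
    ∑ k ∈ s, indicator (p k) = ((s.filter p).card : ℝ) := by
  rw [← Finset.sum_boole]
  refine Finset.sum_congr rfl fun k _ => ?_
  unfold indicator
  congr

section

variable {A L B : ℕ}

theorem sum_indicator_le_of_mul_le {Ω : Type*} [Fintype Ω] (p : Ω → Prop) [DecidablePred p]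
    {c k : ℕ} (hk : 0 < k) (h : (Finset.univ.filter p).card * k ≤ c * Fintype.card Ω) :
    ∑ x, indicator (p x) ≤ (c : ℝ) / k * Fintype.card Ω := by
  have hk' : (0 : ℝ) < k := by exact_mod_cast hk
  have h' : ((Finset.univ.filter p).card : ℝ) * k ≤ c * Fintype.card Ω := by exact_mod_cast h
  rw [sum_indicator, div_mul_eq_mul_div, le_div_iff₀ hk']
  exact h'

theorem mean_not_distinctSubstrings_le (hA : 0 < A) {g : ℕ} (hg : 1 ≤ g) :
    mean (fun (x : Fin A × Fin L → Bool) (_ : Fin B → Fin A) =>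
      indicator (¬ DistinctSubstrings g A L (symbols x))) ≤ (A * L : ℝ) ^ 2 / 2 ^ g := by
  classical
  refine mean_le_of_forall_blocks hA fun y => ?_
  have h1 := sum_indicator_le_of_mul_le
    (fun x : Fin A × Fin L → Bool => ¬ DistinctSubstrings g A L (symbols x)) (c := (A * L) ^ 2)
    (k := 2 ^ g) (by positivity) (by
      refine le_trans (le_of_eq ?_) (card_not_distinctSubstrings_mul_le hg)
      congr!)
  push_cast at h1
  exact h1

theorem mean_anchorEnd_le (hA : 0 < A) {M e : ℕ} (hM : M ≤ L) :
    mean (fun (x : Fin A × Fin L → Bool) (y : Fin B → Fin A) =>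
      indicator (AnchorEnd (blockSeq (symbols x) (blockIndex y) L) M e)) ≤ 1 / 2 ^ M := by
  classical
  refine mean_le_of_forall_blocks hA fun y => ?_
  have h1 := sum_indicator_le_of_mul_le
    (fun x : Fin A × Fin L → Bool => AnchorEnd (blockSeq (symbols x) (blockIndex y) L) M e) (c := 1)
    (k := 2 ^ M) (by positivity) (by
      rw [Nat.one_mul]
      refine le_trans (le_of_eq ?_) (card_anchorEnd_mul_le (e := e) (blockIndex_lt hA y) hM)
      congr!)
  push_cast at h1
  exact h1

theorem le_mean_anchorEnd (hA : 0 < A) {M e b : ℕ} (hMe : M ≤ e) (he : e ≤ L) :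
    1 / 2 ^ M ≤ mean (fun (x : Fin A × Fin L → Bool) (y : Fin B → Fin A) =>
      indicator (AnchorEnd (blockSeq (symbols x) (blockIndex y) L) M (b * L + e))) := by
  classical
  refine le_mean_of_forall_blocks hA fun y => ?_
  set i := blockIndex y b with hi
  have hiA : i < A := blockIndex_lt hA y b
  set c : Finset (ℕ × ℕ) := (Finset.range M).image fun t => (i, e - M + t) with hc
  have hcard : c.card = M := by
    rw [hc, Finset.card_image_of_injective, Finset.card_range]
    intro t t' heq
    simpa using heq
  rw [sum_indicator]
  have h1 := card_le_card_inter_mul_pow (cells A L c) Finset.univ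
    (Finset.univ.filter fun x : Fin A × Fin L → Bool =>
      AnchorEnd (blockSeq (symbols x) (blockIndex y) L) M (b * L + e)) (fun _ => false)
    (fun _ _ _ _ => Finset.mem_univ _) (by
      intro x hx
      rw [Finset.mem_filter, anchorEnd_blockSeq hMe he]
      refine ⟨Finset.mem_univ _, hMe, fun t h1 h2 => ?_⟩
      rw [← hx (⟨i, hiA⟩, ⟨t, by omega⟩), ← symbols_fin x]
      simp only [cells, hc, Finset.mem_filter, Finset.mem_univ, true_and, Finset.mem_image,
        Finset.mem_range]
      exact ⟨t - (e - M), by omega, by rw [Prod.mk.injEq]; exact ⟨rfl, by omega⟩⟩)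
  rw [card_cells (s := c) (by
    intro u hu
    rw [hc, Finset.mem_image] at hu
    obtain ⟨t, ht, rfl⟩ := hu
    rw [Finset.mem_range] at ht
    exact ⟨hiA, by simp only; omega⟩), hcard, Fintype.card_bool, Finset.univ_inter,
    Finset.card_univ] at h1
  rw [div_mul_eq_mul_div, one_mul, div_le_iff₀ (by positivity)]
  exact_mod_cast h1

theorem mean_repeated_pair_le (hA : 0 < A) {b b' : ℕ} (hb' : 1 ≤ b') (hbb : b' < b) (hb : b < B) :
    mean (fun (_ : Fin A × Fin L → Bool) (y : Fin B → Fin A) =>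
      indicator (blockIndex y (b' - 1) = blockIndex y (b - 1) ∧
        blockIndex y b' = blockIndex y b)) ≤ 1 / (A : ℝ) ^ 2 := by
  classical
  refine mean_le_of_forall_symbols hA fun x => ?_
  have h1 := sum_indicator_le_of_mul_le
    (fun y : Fin B → Fin A => blockIndex y (b' - 1) = blockIndex y (b - 1) ∧
        blockIndex y b' = blockIndex y b) (c := 1)
    (k := A ^ 2) (by positivity) (by
      rw [Nat.one_mul]
      refine le_trans (le_of_eq ?_) (card_repeated_pair_mul_le hb' hbb hb)
      congr!)
  push_cast at h1
  exact h1

theorem mean_newLength_le (hA : 0 < A) {M h : ℕ} (hM : 1 ≤ M) (hMh : M ≤ h)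
    (hh : h ≤ 2 ^ (M - 1)) :
    mean (fun (x : Fin A × Fin L → Bool) (y : Fin B → Fin A) =>
      (newLength [] (chunks M h (blockSeq (symbols x) (blockIndex y) L) (B * L)) : ℝ)) ≤
      A * L + 10 * windowLength M h * B := by
  classical
  refine mean_le_of_forall_blocks hA fun y => ?_
  have h1 : ∑ x : Fin A × Fin L → Bool,
      newLength [] (chunks M h (blockSeq (symbols x) (blockIndex y) L) (B * L)) ≤
      (A * L + 10 * windowLength M h * B) * Fintype.card (Fin A × Fin L → Bool) := by
    refine (Finset.sum_le_sum fun x _ => newLength_chunks_le hM hMh (blockIndex_lt hA y)).trans ?_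
    rw [Finset.sum_add_distrib, Finset.sum_comm, Finset.sum_const, Finset.card_univ, smul_eq_mul]
    have h2 := Finset.sum_le_card_nsmul (Finset.range B) (fun b =>
      ∑ x : Fin A × Fin L → Bool, ((Finset.range L).filter fun o =>
        Unsynced M h L (symbols x (blockIndex y b)) o).card)
      (10 * windowLength M h * Fintype.card (Fin A × Fin L → Bool)) (fun b _ => by
        refine le_trans (le_of_eq ?_) (sum_card_unsynced_le hM hh (blockIndex_lt hA y b))
        congr!)
    rw [Finset.card_range, smul_eq_mul] at h2
    calc _ ≤ Fintype.card (Fin A × Fin L → Bool) * (A * L) +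
          B * (10 * windowLength M h * Fintype.card (Fin A × Fin L → Bool)) := by
          refine Nat.add_le_add_left (le_trans (le_of_eq ?_) h2) _
          congr!
      _ = _ := by ring
  exact_mod_cast h1

theorem mean_length_chunks_le (hA : 0 < A) {M h : ℕ} (hM : 1 ≤ M) (hMh : M ≤ h) (hML : M ≤ L) :
    mean (fun (x : Fin A × Fin L → Bool) (y : Fin B → Fin A) =>
      ((chunks M h (blockSeq (symbols x) (blockIndex y) L) (B * L)).length : ℝ)) ≤
      (B * L + 1) / 2 ^ M + 1 := by
  classical
  calc _ ≤ mean (fun (x : Fin A × Fin L → Bool) (y : Fin B → Fin A) =>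
        (∑ e ∈ Finset.range (B * L + 1),
          indicator (AnchorEnd (blockSeq (symbols x) (blockIndex y) L) M e)) + 1) := by
        refine mean_mono fun x y => ?_
        rw [sum_indicator]
        have := length_chunks_le (σ := blockSeq (symbols x) (blockIndex y) L) (N := B * L) hM hMh
        have h2 : ((chunks M h (blockSeq (symbols x) (blockIndex y) L) (B * L)).length : ℝ) ≤ _ :=
          Nat.cast_le.2 this
        push_cast at h2
        refine h2.trans (le_of_eq ?_)
        congr!
    _ ≤ _ := by
        rw [mean_add, mean_sum, mean_const hA]
        gcongr
        refine (Finset.sum_le_card_nsmul _ _ _ fun e _ => mean_anchorEnd_le hA hML).trans ?_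
        rw [Finset.card_range, nsmul_eq_mul]
        push_cast
        exact le_of_eq (by ring)

theorem length_enc_le (code : IntegerCode) {v D : ℕ} (hv : 1 ≤ v) (hvD : v ≤ D) :
    (code.enc v).length ≤ 2 * Nat.clog 2 D + 3 := by
  have h1 := code.length_le v hv
  have h2 : Real.logb 2 v ≤ Nat.clog 2 D := by
    rw [Real.logb_le_iff_le_rpow (by norm_num) (by exact_mod_cast hv), Real.rpow_natCast]
    exact_mod_cast hvD.trans (Nat.le_pow_clog (by norm_num) D)
  have h3 : ((code.enc v).length : ℝ) ≤ 2 * Nat.clog 2 D + 3 := by linarith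
  exact_mod_cast h3

theorem length_text (x : Fin A × Fin L → Bool) (y : Fin B → Fin A) :
    (text x y).length = B * L := slice_length _ _ _

theorem rateVL_le (code : IntegerCode) (hA : 0 < A) (hL : 1 ≤ L) (hB : 1 ≤ B)
    (hAL : 2 * (A * L) ^ 2 ≤ 2 ^ L) {M : ℕ} (hM : 1 ≤ M) (hML : M ≤ L) (hM2 : M ≤ 2 ^ (M - 1)) :
    rateVL code M A L B ≤ 2 * (2 * Nat.clog 2 (B * L) + 3 +
      ((B * L + 1) / 2 ^ M + 1) * (1 + Nat.clog 2 (B * L)) +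
      (A * L + 10 * windowLength M M * B)) := by
  refine (expectation_le_two_mul_mean hA hL hAL fun s => Nat.cast_nonneg _).trans ?_
  gcongr
  set κ := Nat.clog 2 (B * L) with hκ
  calc _ ≤ mean (fun (x : Fin A × Fin L → Bool) (y : Fin B → Fin A) => (2 * κ + 3 : ℝ) +
        (1 + κ) * ((chunks M M (blockSeq (symbols x) (blockIndex y) L) (B * L)).length : ℝ) +
        (newLength [] (chunks M M (blockSeq (symbols x) (blockIndex y) L) (B * L)) : ℝ)) := by
        refine mean_mono fun x y => ?_
        set Z := chunks M M (blockSeq (symbols x) (blockIndex y) L) (B * L) with hZ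
        have h1 := length_enc_le code (Nat.mul_pos hB hL) le_rfl
        have h2 := length_encodeChunksVL_le [] Z (D := B * L) (by
          rw [List.length_nil, Nat.zero_add]
          exact length_chunks_le_self hM le_rfl)
        have h3 : (encodeVL code M (text x y)).length ≤
            (2 * κ + 3) + (1 + κ) * Z.length + newLength [] Z := by
          rw [encodeVL, List.length_append, length_text, text, chunksVL_slice, ← hZ, hκ]
          rw [Nat.mul_comm Z.length] at h2
          omega
        exact_mod_cast h3
    _ ≤ _ := by
        rw [mean_add, mean_add, mean_const hA, mean_const_mul]
        have h1 := mean_newLength_le (B := B) (L := L) hA hM le_rfl hM2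
        have h2 := mean_length_chunks_le (B := B) (L := L) hA hM le_rfl hML
        rw [mul_comm (1 + (κ : ℝ))]
        gcongr

/-- The phrases are few if all substrings of half the minimal chunk length differ; otherwise each
position is charged a phrase. -/
theorem rateMC_le (code : IntegerCode) (hA : 0 < A) (hL : 1 ≤ L) (hB : 1 ≤ B)
    (hAL : 2 * (A * L) ^ 2 ≤ 2 ^ L) {M : ℕ} (hM : 2 ≤ M) (hM2 : M ≤ 2 ^ (M - 1)) :
    rateMC code M A L B ≤ 2 * (2 * Nat.clog 2 (B * L) + 3 +
      (4 * B + 3 + B * L * ((A * L) ^ 2 / 2 ^ 2 ^ (M - 2))) * (4 + 3 * Nat.clog 2 (B * L)) +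
      (A * L + 10 * windowLength M (2 ^ (M - 1)) * B)) := by
  refine (expectation_le_two_mul_mean hA hL hAL fun s => Nat.cast_nonneg _).trans ?_
  gcongr
  set κ := Nat.clog 2 (B * L) with hκ
  set g := 2 ^ (M - 2) with hg
  have hg2 : 2 ^ (M - 1) = 2 * g := by
    rw [hg, ← pow_succ']
    congr 1
    omega
  rw [hg2] at hM2 ⊢
  calc _ ≤ mean (fun (x : Fin A × Fin L → Bool) (y : Fin B → Fin A) => (2 * κ + 3 : ℝ) +
        (4 + 3 * κ) * (4 * B + 3 + B * L * indicator (¬ DistinctSubstrings g A L (symbols x))) +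
        (newLength [] (chunks M (2 * g) (blockSeq (symbols x) (blockIndex y) L) (B * L)) : ℝ)) := by
        refine mean_mono fun x y => ?_
        set Z := chunks M (2 * g) (blockSeq (symbols x) (blockIndex y) L) (B * L) with hZ
        have hlen : Z.length ≤ B * L := length_chunks_le_self (by omega) hM2
        have h1 := length_enc_le code (Nat.mul_pos hB hL) le_rfl
        have h2 := length_encodeChunksMC_le code (D := B * L) (K := 4 + 3 * κ) (fun v h1 h2 => by
          have := length_enc_le code h1 h2
          omega) [] Z (by simpa using hlen)
        have h3 : (encodeMC code M (text x y)).length ≤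
            (2 * κ + 3) + (4 + 3 * κ) * phraseCount [] Z + newLength [] Z := by
          rw [encodeMC, List.length_append, length_text, text, chunksMC_slice, hg2, ← hZ]
          rw [Nat.mul_comm (phraseCount _ _)] at h2
          omega
        have h4 : (phraseCount [] Z : ℝ) ≤
            4 * B + 3 + B * L * indicator (¬ DistinctSubstrings g A L (symbols x)) := by
          by_cases hd : DistinctSubstrings g A L (symbols x)
          · rw [indicator_of_not (not_not.2 hd), mul_zero, add_zero]
            exact_mod_cast phraseCount_chunks_le (B := B) (by omega) hM2 hd (blockIndex_lt hA y)
          · rw [indicator_of hd, mul_one]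
            have h5 : (phraseCount [] Z : ℝ) ≤ B * L := by
              exact_mod_cast (phraseCount_le_length [] Z).trans hlen
            have h6 : (0 : ℝ) ≤ B := Nat.cast_nonneg B
            linarith
        have h7 : ((encodeMC code M (text x y)).length : ℝ) ≤
            (2 * κ + 3) + (4 + 3 * κ) * phraseCount [] Z + newLength [] Z := by exact_mod_cast h3
        refine h7.trans ?_
        gcongr
    _ ≤ _ := by
        rw [mean_add, mean_add, mean_const hA, mean_const_mul, mean_add, mean_const hA,
          mean_const_mul]
        have h1 := mean_newLength_le (B := B) (L := L) hA (h := 2 * g) (by omega) hM2 hg2.symm.le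
        have h2 := mean_not_distinctSubstrings_le (B := B) (L := L) hA (g := g) Nat.one_le_two_pow
        rw [mul_comm (4 + 3 * (κ : ℝ))]
        gcongr

theorem le_length_encodeVL (code : IntegerCode) (M : ℕ) (x : Fin A × Fin L → Bool)
    (y : Fin B → Fin A) :
    (chunks M M (blockSeq (symbols x) (blockIndex y) L) (B * L)).length ≤
        (encodeVL code M (text x y)).length ∧
      newLength [] (chunks M M (blockSeq (symbols x) (blockIndex y) L) (B * L)) ≤
        (encodeVL code M (text x y)).length := by
  have h1 := length_le_length_encodeChunksVL []
    (chunks M M (blockSeq (symbols x) (blockIndex y) L) (B * L))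
  have h2 := newLength_le_length_encodeChunksVL []
    (chunks M M (blockSeq (symbols x) (blockIndex y) L) (B * L))
  rw [encodeVL, List.length_append, text, chunksVL_slice]
  omega

/-- A short anchor makes many chunks: the disjoint windows of length `M` inside the blocks are
counted. The event that all substrings of length `q` differ ensures that the symbols are distinct. -/
theorem le_rateVL_of_short (code : IntegerCode) (hA : 0 < A)
    (hne : 0 < Fintype.card (Fin A ↪ (Fin L → Bool))) {M q : ℕ} (hM : 1 ≤ M)
    (hq : 1 ≤ q) (hqL : q ≤ L) (hqM : 2 * (A * L : ℝ) ^ 2 * 2 ^ M ≤ 2 ^ q) :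
    (B * (L / M : ℕ) : ℝ) * (1 / 2 ^ M / 2) ≤ rateVL code M A L B := by
  classical
  set I := Finset.range B ×ˢ Finset.range (L / M) with hI
  have hIk : ∀ k < L / M, k * M + M ≤ L := by
    intro k hk
    have h1 := Nat.mul_le_mul_right M (Nat.succ_le_of_lt hk)
    rw [Nat.succ_mul] at h1
    exact h1.trans (Nat.div_mul_le_self L M)
  have h1 := mean_le_expectation (A := A) (L := L) (B := B) hA hqL hne
    (f := fun s => ((encodeVL code M s).length : ℝ)) (fun s => Nat.cast_nonneg _)
    -- the subtracted term makes the lower bound nonpositive where the symbols may coincide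
    (F := fun x y => ∑ c ∈ I, (indicator (AnchorEnd (blockSeq (symbols x) (blockIndex y) L) M
      (c.1 * L + (c.2 * M + M))) - indicator (¬ DistinctSubstrings q A L (symbols x)))) (by
    intro x y hd
    rw [indicator_of_not (not_not.2 hd)]
    simp only [sub_zero]
    rw [sum_indicator]
    set J := I.filter fun c => AnchorEnd (blockSeq (symbols x) (blockIndex y) L) M
      (c.1 * L + (c.2 * M + M)) with hJ
    set W := J.image fun c => c.1 * L + c.2 * M with hW
    have hmem : ∀ c ∈ J, c.1 < B ∧ c.2 < L / M ∧
        AnchorEnd (blockSeq (symbols x) (blockIndex y) L) M (c.1 * L + (c.2 * M + M)) := by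
      intro c hc
      rw [hJ, hI, Finset.mem_filter, Finset.mem_product, Finset.mem_range, Finset.mem_range] at hc
      exact ⟨hc.1.1, hc.1.2, hc.2⟩
    have hbl : ∀ b b', b < b' → b * L + L ≤ b' * L := by
      intro b b' hbb
      rw [← Nat.succ_mul]
      exact Nat.mul_le_mul_right L hbb
    have hkk : ∀ k k', k < k' → k * M + M ≤ k' * M := by
      intro k k' hkk
      rw [← Nat.succ_mul]
      exact Nat.mul_le_mul_right M hkk
    -- the windows are disjoint
    have hsep : ∀ c ∈ J, ∀ c' ∈ J, c.1 < c'.1 ∨ c.1 = c'.1 ∧ c.2 < c'.2 →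
        c.1 * L + c.2 * M + M ≤ c'.1 * L + c'.2 * M := by
      intro c hc c' hc' hlt
      have h1 := hIk _ (hmem c hc).2.1
      rcases hlt with hlt | ⟨heq, hlt⟩
      · have := hbl _ _ hlt
        omega
      · have := hkk _ _ hlt
        rw [heq]
        omega
    have htri : ∀ c c' : ℕ × ℕ, c = c' ∨ (c.1 < c'.1 ∨ c.1 = c'.1 ∧ c.2 < c'.2) ∨
        (c'.1 < c.1 ∨ c'.1 = c.1 ∧ c'.2 < c.2) := by
      rintro ⟨b, k⟩ ⟨b', k'⟩
      rw [Prod.mk.injEq]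
      simp only
      omega
    have hcard : J.card = W.card := by
      rw [hW, Finset.card_image_of_injOn]
      intro c hc c' hc' heq
      simp only at heq
      rcases htri c c' with h2 | h2 | h2
      · exact h2
      · have := hsep c hc c' hc' h2
        omega
      · have := hsep c' hc' c hc h2
        omega
    rw [hcard]
    have h2 := card_le_length_chunks (σ := blockSeq (symbols x) (blockIndex y) L) (N := B * L) hM W
      (by
        intro p hp
        rw [hW, Finset.mem_image] at hp
        obtain ⟨c, hc, rfl⟩ := hp
        have h3 := hmem c hc
        have h4 := hbl _ _ h3.1
        have h5 := hIk _ h3.2.1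
        refine ⟨by omega, ?_⟩
        rw [Nat.add_assoc]
        exact h3.2.2) (by
        intro p hp p' hp' hlt
        rw [hW, Finset.mem_image] at hp hp'
        obtain ⟨c, hc, rfl⟩ := hp
        obtain ⟨c', hc', rfl⟩ := hp'
        rcases htri c c' with h2 | h2 | h2
        · rw [h2] at hlt
          exact absurd hlt (lt_irrefl _)
        · exact hsep c hc c' hc' h2
        · have := hsep c' hc' c hc h2
          omega)
    exact_mod_cast h2.trans (le_length_encodeVL code M x y).1) (by
    intro x y hd
    refine Finset.sum_nonpos fun c _ => ?_
    rw [indicator_of hd]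
    linarith [indicator_le_one (AnchorEnd (blockSeq (symbols x) (blockIndex y) L) M
      (c.1 * L + (c.2 * M + M)))])
  refine le_trans ?_ h1
  rw [mean_sum]
  have h2 : ∀ c ∈ I, (1 / 2 ^ M / 2 : ℝ) ≤ mean (fun (x : Fin A × Fin L → Bool)
      (y : Fin B → Fin A) => indicator (AnchorEnd (blockSeq (symbols x) (blockIndex y) L) M
        (c.1 * L + (c.2 * M + M))) - indicator (¬ DistinctSubstrings q A L (symbols x))) := by
    intro c hc
    rw [hI, Finset.mem_product, Finset.mem_range, Finset.mem_range] at hc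
    rw [mean_sub]
    have h3 := le_mean_anchorEnd (B := B) (b := c.1) hA (show M ≤ c.2 * M + M by omega)
      (hIk _ hc.2)
    have h4 := mean_not_distinctSubstrings_le (B := B) (L := L) hA hq
    have h5 : (A * L : ℝ) ^ 2 / 2 ^ q ≤ 1 / 2 ^ M / 2 := by
      rw [div_div, div_le_div_iff₀ (by positivity) (by positivity)]
      linarith
    linarith
  refine le_trans ?_ (Finset.card_nsmul_le_sum _ _ _ h2)
  rw [hI, Finset.card_product, Finset.card_range, Finset.card_range, nsmul_eq_mul]
  push_cast
  exact le_rfl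

/-- A long anchor makes long chunks across block boundaries, most of which are new. -/
theorem le_rateVL_of_long (code : IntegerCode) (hA : 0 < A)
    (hne : 0 < Fintype.card (Fin A ↪ (Fin L → Bool))) {M m q : ℕ} (hM : 1 ≤ M) (hm : m ≤ M)
    (hmL : m ≤ L) (hq : 1 ≤ q) (hqL : 2 * q ≤ L) (hqm : 16 * q ≤ 2 ^ m)
    (hqA : 4 * (A * L : ℝ) ^ 2 ≤ 2 ^ q) (hB : B = A * A) :
    (q * (B / 4 : ℕ) : ℝ) / 4 ≤ rateVL code M A L B := by
  classical
  set I := Finset.Icc 1 (B / 4) with hI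
  have hB0 : 0 < B := by
    rw [hB]
    exact Nat.mul_pos hA hA
  have hIB : ∀ b ∈ I, 1 ≤ b ∧ b < B ∧ b ≤ B / 4 := by
    intro b hb
    rw [hI, Finset.mem_Icc] at hb
    omega
  -- the boundary before block `b` is close to an anchor, or its pair of symbols is not new
  set near : ℕ → (Fin A × Fin L → Bool) → (Fin B → Fin A) → ℝ := fun b x y =>
    ∑ e ∈ Finset.Ioo (b * L - 2 * q) (b * L + 2 * q),
      indicator (AnchorEnd (blockSeq (symbols x) (blockIndex y) L) m e) with hnear
  set stale : ℕ → (Fin A × Fin L → Bool) → (Fin B → Fin A) → ℝ := fun b _ y =>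
    ∑ b' ∈ Finset.Ico 1 b, indicator (blockIndex y (b' - 1) = blockIndex y (b - 1) ∧
        blockIndex y b' = blockIndex y b) with hstale
  have hnear0 : ∀ b x y, 0 ≤ near b x y := fun b x y =>
    Finset.sum_nonneg fun _ _ => indicator_nonneg _
  have hstale0 : ∀ b x y, 0 ≤ stale b x y := fun b x y =>
    Finset.sum_nonneg fun _ _ => indicator_nonneg _
  have h1 := mean_le_expectation (A := A) (L := L) (B := B) hA (g := q) (by omega) hne
    (f := fun s => ((encodeVL code M s).length : ℝ)) (fun s => Nat.cast_nonneg _)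
    (F := fun x y => (q : ℝ) * ∑ b ∈ I, (1 - indicator (¬ DistinctSubstrings q A L (symbols x)) -
      near b x y - stale b x y)) (by
    intro x y hd
    rw [indicator_of_not (not_not.2 hd)]
    set σ := blockSeq (symbols x) (blockIndex y) L with hσ
    obtain ⟨good, hgood⟩ : ∃ good : ℕ → Prop, ∀ b, good b ↔
        (∀ e, b * L < e + 2 * q → e < b * L + 2 * q → ¬ AnchorEnd σ m e) ∧
        ∀ b', 1 ≤ b' → b' < b → ¬ (blockIndex y (b' - 1) = blockIndex y (b - 1) ∧
          blockIndex y b' = blockIndex y b) := ⟨_, fun _ => Iff.rfl⟩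
    set W := I.filter good with hW
    have hWI : ∀ b ∈ W, b ∈ I ∧ good b := fun b hb => Finset.mem_filter.1 hb
    have h2 := mul_card_le_newLength (B := B) (h := M) hM le_rfl hm hq hqL hd (blockIndex_lt hA y) W
      (fun b hb => ⟨(hIB b (hWI b hb).1).1, (hIB b (hWI b hb).1).2.1⟩)
      (fun b hb => ((hgood b).1 (hWI b hb).2).1)
      (fun b hb b' hb' hlt => ((hgood b).1 (hWI b hb).2).2 b' (hIB b' (hWI b' hb').1).1 hlt)
    have h3 : (q : ℝ) * W.card ≤ ((encodeVL code M (text x y)).length : ℝ) := by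
      exact_mod_cast h2.trans (le_length_encodeVL code M x y).2
    refine le_trans ?_ h3
    rw [hW, ← sum_indicator]
    gcongr with b hb
    by_cases hb1 : ∀ e, b * L < e + 2 * q → e < b * L + 2 * q → ¬ AnchorEnd σ m e
    · by_cases hb2 : ∀ b', 1 ≤ b' → b' < b → ¬ (blockIndex y (b' - 1) = blockIndex y (b - 1) ∧
        blockIndex y b' = blockIndex y b)
      · rw [indicator_of ((hgood b).2 ⟨hb1, hb2⟩)]
        linarith [hnear0 b x y, hstale0 b x y]
      · push Not at hb2
        obtain ⟨b', h4, h5, h6⟩ := hb2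
        have h7 : 1 ≤ stale b x y := by
          rw [← indicator_of h6, hstale]
          exact Finset.single_le_sum (f := fun b' => indicator
            (blockIndex y (b' - 1) = blockIndex y (b - 1) ∧ blockIndex y b' = blockIndex y b))
            (fun _ _ => indicator_nonneg _) (Finset.mem_Ico.2 ⟨h4, h5⟩)
        refine le_trans ?_ (indicator_nonneg _)
        linarith [hnear0 b x y]
    · push Not at hb1
      obtain ⟨e, h4, h5, h6⟩ := hb1
      have h7 : 1 ≤ near b x y := by
        rw [← indicator_of h6, hnear]
        have hbL : L ≤ b * L := Nat.le_mul_of_pos_left L (hIB b hb).1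
        exact Finset.single_le_sum (f := fun e => indicator (AnchorEnd σ m e))
          (fun _ _ => indicator_nonneg _) (Finset.mem_Ioo.2 ⟨by omega, h5⟩)
      refine le_trans ?_ (indicator_nonneg _)
      linarith [hstale0 b x y]) (by
    intro x y hd
    rw [indicator_of hd]
    refine mul_nonpos_of_nonneg_of_nonpos (Nat.cast_nonneg q) (Finset.sum_nonpos fun b _ => ?_)
    linarith [hnear0 b x y, hstale0 b x y])
  refine le_trans ?_ h1
  rw [mean_const_mul, mean_sum]
  have h2 : ∀ b ∈ I, (1 / 4 : ℝ) ≤ mean (fun (x : Fin A × Fin L → Bool) (y : Fin B → Fin A) =>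
      1 - indicator (¬ DistinctSubstrings q A L (symbols x)) - near b x y - stale b x y) := by
    intro b hb
    rw [mean_sub, mean_sub, mean_sub, mean_const hA]
    have h3 := mean_not_distinctSubstrings_le (B := B) (L := L) hA hq
    have h4 : (A * L : ℝ) ^ 2 / 2 ^ q ≤ 1 / 4 := by
      rw [div_le_div_iff₀ (by positivity) (by positivity)]
      linarith
    have h5 : mean (near b) ≤ 1 / 4 := by
      rw [hnear]
      simp only
      rw [mean_sum]
      refine (Finset.sum_le_card_nsmul _ _ _ fun e _ => mean_anchorEnd_le hA hmL).trans ?_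
      have h6 : (Finset.Ioo (b * L - 2 * q) (b * L + 2 * q)).card ≤ 4 * q := by
        rw [Nat.card_Ioo]
        omega
      have h7 : ((Finset.Ioo (b * L - 2 * q) (b * L + 2 * q)).card : ℝ) ≤ 4 * q := by
        exact_mod_cast h6
      have h8 : (16 * q : ℝ) ≤ 2 ^ m := by exact_mod_cast hqm
      rw [nsmul_eq_mul, mul_one_div, div_le_div_iff₀ (by positivity) (by positivity)]
      linarith
    have h6 : mean (stale b) ≤ 1 / 4 := by
      rw [hstale]
      simp only
      rw [mean_sum]
      refine (Finset.sum_le_card_nsmul _ _ _ fun b' hb' => mean_repeated_pair_le hA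
        (Finset.mem_Ico.1 hb').1 (Finset.mem_Ico.1 hb').2 (hIB b hb).2.1).trans ?_
      have h7 : 4 * (b - 1) ≤ A ^ 2 := by
        have := (hIB b hb).2.2
        rw [sq, ← hB]
        omega
      have h8 : (4 * (b - 1 : ℕ) : ℝ) ≤ A ^ 2 := by exact_mod_cast h7
      have h9 : (0 : ℝ) < A := by exact_mod_cast hA
      rw [nsmul_eq_mul, mul_one_div, Nat.card_Ico, div_le_div_iff₀ (by positivity) (by positivity)]
      linarith
    linarith
  have h3 := Finset.card_nsmul_le_sum _ _ _ h2
  rw [hI, Nat.card_Icc, Nat.add_sub_cancel, nsmul_eq_mul] at h3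
  rw [mul_div_assoc]
  gcongr
  linarith

end

/-! ### Square sources: `A = L = n` and `B = n * n` -/

theorem nine_mul_add_nine_le {m : ℕ} (hm : 11 ≤ m) : 9 * m + 9 ≤ 2 ^ (m - 4) := by
  induction m, hm using Nat.le_induction with
  | base => norm_num
  | succ m hm ih =>
    have : m + 1 - 4 = m - 4 + 1 := by omega
    rw [this, pow_succ]
    omega

/-- The scales of a square source with large `n`: `ν` is the integer part of `log₂ n`, and `2 ^ m`
is `√n` up to a factor `2`. -/
structure Scales (n ν m : ℕ) : Prop where
  pow_le : 2 ^ ν ≤ n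
  lt_pow : n < 2 ^ (ν + 1)
  eq_div : m = ν / 2
  large : 22 ≤ ν

namespace Scales

variable {n ν m : ℕ}

theorem exists_of_le (hn : 2 ^ 22 ≤ n) : ∃ ν m, Scales n ν m := by
  have hn0 : n ≠ 0 := by
    rintro rfl
    norm_num at hn
  exact ⟨Nat.log 2 n, Nat.log 2 n / 2, Nat.pow_log_le_self 2 hn0,
    Nat.lt_pow_succ_log_self (by norm_num) n, rfl, Nat.le_log_of_pow_le (by norm_num) hn⟩

theorem le_m (h : Scales n ν m) : 11 ≤ m := by
  have := h.eq_div
  have := h.large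
  omega

theorem sq_le (h : Scales n ν m) : 2 ^ m * 2 ^ m ≤ n := by
  rw [← pow_add]
  refine le_trans (Nat.pow_le_pow_right (by norm_num) ?_) h.pow_le
  have := h.eq_div
  omega

theorem lt_sq (h : Scales n ν m) : n < 2 ^ (2 * m + 2) := by
  refine h.lt_pow.trans_le (Nat.pow_le_pow_right (by norm_num) ?_)
  have := h.eq_div
  omega

theorem lt_four_mul_sq (h : Scales n ν m) : n < 4 * (2 ^ m * 2 ^ m) := by
  have := h.lt_sq
  have h2 : 2 ^ (2 * m + 2) = 4 * (2 ^ m * 2 ^ m) := by ring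
  omega

theorem pow_four_le (h : Scales n ν m) : (n * n) ^ 2 ≤ 2 ^ (8 * m + 8) := by
  calc (n * n) ^ 2 = n ^ 4 := by ring
    _ ≤ (2 ^ (2 * m + 2)) ^ 4 := Nat.pow_le_pow_left h.lt_sq.le 4
    _ = 2 ^ (8 * m + 8) := by
        rw [← pow_mul]
        congr 1
        ring

theorem two_pow_m_le (h : Scales n ν m) : 2 ^ m ≤ n :=
  (Nat.le_mul_of_pos_left _ (by positivity)).trans h.sq_le

theorem m_le (h : Scales n ν m) : m ≤ n := Nat.lt_two_pow_self.le.trans h.two_pow_m_le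

theorem pos (h : Scales n ν m) : 0 < n :=
  lt_of_lt_of_le (by positivity) h.pow_le

theorem two_mul_sq_le (h : Scales n ν m) : 2 * (n * n) ^ 2 ≤ 2 ^ n := by
  calc 2 * (n * n) ^ 2 ≤ 2 * 2 ^ (8 * m + 8) := Nat.mul_le_mul_left 2 h.pow_four_le
    _ = 2 ^ (8 * m + 9) := by ring
    _ ≤ 2 ^ n := Nat.pow_le_pow_right (by norm_num) (by
        have h1 := nine_mul_add_nine_le h.le_m
        have h2 : 2 ^ (m - 4) ≤ 2 ^ m := Nat.pow_le_pow_right (by norm_num) (by omega)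
        have h3 := h.two_pow_m_le
        omega)

theorem card_embedding_pos (h : Scales n ν m) :
    0 < Fintype.card (Fin n ↪ (Fin n → Bool)) := by
  have h1 := card_symbols_le_two_mul (A := n) (L := n) h.pos h.two_mul_sq_le
  have h2 := card_symbols_pos (A := n) (L := n)
  have h3 : (0 : ℝ) < Fintype.card (Fin n ↪ (Fin n → Bool)) := by linarith
  exact_mod_cast h3

theorem clog_le (h : Scales n ν m) : Nat.clog 2 (n * n * n) ≤ 6 * ν := by
  refine (Nat.clog_le_iff_le_pow (by norm_num)).2 ?_
  calc n * n * n = n ^ 3 := by ring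
    _ ≤ (2 ^ (ν + 1)) ^ 3 := Nat.pow_le_pow_left h.lt_pow.le 3
    _ = 2 ^ ((ν + 1) * 3) := (pow_mul _ _ _).symm
    _ ≤ 2 ^ (6 * ν) := Nat.pow_le_pow_right (by norm_num) (by have := h.large; omega)

/-- An outcome is described by `n ^ 2` bits of the symbols and `log n` bits for each of the `n ^ 2`
blocks. -/
theorem optimalRate_le (h : Scales n ν m) :
    optimalRate n n (n * n) ≤ 3 * (ν * (n : ℝ) ^ 2) := by
  have h1 := Dedup.optimalRate_le (B := n * n) h.pos h.card_embedding_pos h.lt_pow.le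
  have h2 : (22 : ℝ) ≤ ν := by exact_mod_cast h.large
  have h3 : (0 : ℝ) ≤ (n : ℝ) ^ 2 := by positivity
  push_cast at h1
  nlinarith

/-- For given symbols, the block indices alone have entropy `n ^ 2 * log n`. -/
theorem le_optimalRate (h : Scales n ν m) :
    ν * (n : ℝ) ^ 2 / 4 ≤ optimalRate n n (n * n) := by
  have hn := h.pos
  have h4 : 2 ≤ ν * (n * n) := by
    have h5 : 1 ≤ n * n := Nat.mul_pos hn hn
    have := Nat.mul_le_mul h.large h5
    omega
  have h1 := Dedup.le_optimalRate (B := n * n) h.pos h.card_embedding_pos h.pow_le (by omega)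
  have h2 : (2 : ℝ) ≤ ν * (n : ℝ) ^ 2 := by
    rw [sq]
    exact_mod_cast h4
  push_cast at h1
  nlinarith

theorem optimalRate_pos (h : Scales n ν m) : 0 < optimalRate n n (n * n) := by
  refine lt_of_lt_of_le ?_ h.le_optimalRate
  have h1 : (0 : ℝ) < n := by exact_mod_cast h.pos
  have h2 : (0 : ℝ) < ν := by
    have := h.large
    exact_mod_cast (by omega : 0 < ν)
  positivity

/-- With minimal chunk length and anchor frequency both of order `√n`, variable-length deduplication
pays `O(log n)` bits for each of about `n ^ 3 / √n` chunks, and `O(√n)` new bits for each block. -/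
theorem rateVL_le (h : Scales n ν m) (code : IntegerCode) :
    rateVL code m n n (n * n) ≤ 440 * (ν * (n : ℝ) ^ 2 * 2 ^ m) := by
  have hm := h.le_m
  have hn := h.pos
  have hm2 : m ≤ 2 ^ (m - 1) := by
    have : m - 1 < 2 ^ (m - 1) := Nat.lt_two_pow_self
    omega
  have h1 := Dedup.rateVL_le code hn hn (Nat.mul_pos hn hn) h.two_mul_sq_le (M := m) (by omega)
    h.m_le hm2
  refine h1.trans ?_
  push_cast
  have hn1 : (1 : ℝ) ≤ n := by exact_mod_cast hn
  have hν : (1 : ℝ) ≤ ν := by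
    have := h.large
    exact_mod_cast (by omega : 1 ≤ ν)
  have hs1 : (1 : ℝ) ≤ 2 ^ m := one_le_pow₀ (by norm_num)
  have hκ : (Nat.clog 2 (n * n * n) : ℝ) ≤ 6 * ν := by exact_mod_cast h.clog_le
  have hr : (windowLength m m : ℝ) ≤ 12 * 2 ^ m := by
    have h2 : m < 2 ^ m := Nat.lt_two_pow_self
    have h3 : windowLength m m ≤ 12 * 2 ^ m := by
      unfold windowLength
      rw [pow_add]
      omega
    exact_mod_cast h3
  have hns : (n : ℝ) ≤ 4 * (2 ^ m * 2 ^ m) := by exact_mod_cast h.lt_four_mul_sq.le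
  have hsn : (2 : ℝ) ^ m ≤ n := by exact_mod_cast h.two_pow_m_le
  generalize (Nat.clog 2 (n * n * n) : ℝ) = κ at *
  generalize (windowLength m m : ℝ) = r at *
  generalize (2 : ℝ) ^ m = s at *
  generalize (n : ℝ) = a at *
  generalize (ν : ℝ) = v at *
  have ha2 : 1 ≤ a ^ 2 := one_le_pow₀ hn1
  have hchunks : (a * a * a + 1) / s + 1 ≤ 12 * (a ^ 2 * s) := by
    have h2 : (a * a * a + 1) / s ≤ 8 * (a ^ 2 * s) := by
      rw [div_le_iff₀ (by linarith)]
      nlinarith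
    nlinarith
  have hvas : 1 ≤ v * a ^ 2 * s := by nlinarith [mul_le_mul hν ha2 (by norm_num) (by linarith)]
  have hvs : 1 ≤ v * s := by nlinarith
  have has : 1 ≤ a ^ 2 * s := by nlinarith
  have t1 : v ≤ v * a ^ 2 * s := by nlinarith
  have t2 : ((a * a * a + 1) / s + 1) * (1 + κ) ≤ 84 * (v * a ^ 2 * s) := by
    calc ((a * a * a + 1) / s + 1) * (1 + κ) ≤ 12 * (a ^ 2 * s) * (7 * v) := by
          refine (mul_le_mul_of_nonneg_left (show 1 + κ ≤ 7 * v by linarith) ?_).trans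
            (mul_le_mul_of_nonneg_right hchunks (by linarith))
          positivity
      _ = 84 * (v * a ^ 2 * s) := by ring
  have t3 : a * a ≤ v * a ^ 2 * s := by nlinarith
  have t4 : 10 * r * (a * a) ≤ 120 * (v * a ^ 2 * s) := by
    have h5 : 10 * r * (a * a) ≤ 120 * (a ^ 2 * s) := by nlinarith
    have h6 : a ^ 2 * s ≤ v * (a ^ 2 * s) := by nlinarith
    linarith
  linarith

/-- With chunks just long enough, of order `log n`, to be unique inside the symbols, multi-chunk
deduplication writes `O(1)` phrases and `O(log n)` new bits for each block. -/
theorem exists_rateMC_le (h : Scales n ν m) (code : IntegerCode) :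
    ∃ M, 1 ≤ M ∧ rateMC code M n n (n * n) ≤ 16000 * (ν * (n : ℝ) ^ 2) := by
  have hn := h.pos
  have hν22 := h.large
  -- `2 ^ u ≥ n ^ 5`, so substrings of length `u` differ up to probability `n ^ 4 / n ^ 5`; the minimal
  -- chunk length with anchor length `t + 2` is `2 * u`
  set t := Nat.clog 2 (5 * (ν + 1)) with ht
  set u := 2 ^ t with hu
  have hu1 : 5 * (ν + 1) ≤ u := Nat.le_pow_clog (by norm_num) _
  have hu2 : u ≤ 20 * ν := by
    have h1 : 2 ^ t.pred < 5 * (ν + 1) := Nat.pow_pred_clog_lt_self (by norm_num) (by omega)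
    have h2 : t = t.pred + 1 := by
      have : t ≠ 0 := by
        intro h0
        rw [hu, h0] at hu1
        omega
      rw [Nat.pred_eq_sub_one]
      omega
    rw [hu, h2, pow_succ]
    omega
  refine ⟨t + 2, by omega, ?_⟩
  have hM2 : t + 2 ≤ 2 ^ (t + 2 - 1) := by
    have : t + 1 < 2 ^ (t + 1) := Nat.lt_two_pow_self
    exact this
  have h1 := Dedup.rateMC_le code hn hn (Nat.mul_pos hn hn) h.two_mul_sq_le (M := t + 2) (by omega)
    hM2
  rw [show t + 2 - 1 = t + 1 by omega, show t + 2 - 2 = t by omega] at h1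
  refine h1.trans ?_
  clear h1
  push_cast
  have hr : windowLength (t + 2) (2 ^ (t + 1)) ≤ 780 * ν := by
    have h3 : 2 ^ (t + 1) = 2 * u := by
      rw [hu, ← pow_succ']
    have h4 : 2 ^ (t + 2 + 3) = 32 * u := by
      rw [hu]
      ring
    have h5 : t < u := Nat.lt_two_pow_self
    unfold windowLength
    rw [h3, h4]
    omega
  have hr' : (windowLength (t + 2) (2 ^ (t + 1)) : ℝ) ≤ 780 * ν := by exact_mod_cast hr
  have hκ : (Nat.clog 2 (n * n * n) : ℝ) ≤ 6 * ν := by exact_mod_cast h.clog_le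
  have hn1 : (1 : ℝ) ≤ n := by exact_mod_cast hn
  have hν : (1 : ℝ) ≤ ν := by exact_mod_cast (by omega : 1 ≤ ν)
  have hκ0 : (0 : ℝ) ≤ Nat.clog 2 (n * n * n) := Nat.cast_nonneg _
  -- coinciding substrings are too rare to contribute
  have hrare : (n * n * n : ℝ) * ((n * n) ^ 2 / 2 ^ 2 ^ t) ≤ n * n := by
    have h3 : n ^ 5 ≤ 2 ^ u := by
      calc n ^ 5 ≤ (2 ^ (ν + 1)) ^ 5 := Nat.pow_le_pow_left h.lt_pow.le 5
        _ = 2 ^ ((ν + 1) * 5) := (pow_mul _ _ _).symm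
        _ ≤ 2 ^ u := Nat.pow_le_pow_right (by norm_num) (by omega)
    have h4 : (n : ℝ) ^ 5 ≤ 2 ^ u := by exact_mod_cast h3
    rw [← hu, ← mul_div_assoc, div_le_iff₀ (by positivity)]
    calc (n : ℝ) * n * n * ((n : ℝ) * n) ^ 2 = (n : ℝ) * n * (n : ℝ) ^ 5 := by ring
      _ ≤ (n : ℝ) * n * 2 ^ u := by gcongr
  generalize (Nat.clog 2 (n * n * n) : ℝ) = κ at *
  generalize (windowLength (t + 2) (2 ^ (t + 1)) : ℝ) = r at *
  generalize (n * n * n : ℝ) * ((n * n) ^ 2 / 2 ^ 2 ^ t) = p at *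
  generalize (n : ℝ) = a at *
  generalize (ν : ℝ) = v at *
  have ha2 : 1 ≤ a ^ 2 := one_le_pow₀ hn1
  have t1 : v ≤ v * a ^ 2 := by nlinarith
  have t2 : (4 * (a * a) + 3 + p) * (4 + 3 * κ) ≤ 176 * (v * a ^ 2) := by
    calc (4 * (a * a) + 3 + p) * (4 + 3 * κ) ≤ 8 * a ^ 2 * (22 * v) :=
          mul_le_mul (by linarith [sq a]) (by linarith) (by linarith) (by linarith)
      _ = 176 * (v * a ^ 2) := by ring
  have t3 : a * a ≤ v * a ^ 2 := by nlinarith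
  have t4 : 10 * r * (a * a) ≤ 7800 * (v * a ^ 2) := by
    calc 10 * r * (a * a) = 10 * (a * a) * r := by ring
      _ ≤ 10 * (a * a) * (780 * v) :=
          mul_le_mul_of_nonneg_left hr' (mul_nonneg (by norm_num) (mul_self_nonneg a))
      _ = 7800 * (v * a ^ 2) := by ring
  linarith

/-- Short anchors make too many chunks and long anchors too many new bits. -/
theorem le_rateVL (h : Scales n ν m) (code : IntegerCode) {M : ℕ} (hM : 1 ≤ M) :
    (n : ℝ) ^ 2 * 2 ^ m / (512 * ν) ≤ rateVL code M n n (n * n) := by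
  have hn := h.pos
  have hm := h.le_m
  have hgrow := nine_mul_add_nine_le hm
  -- `16 * q = 2 ^ m`: stretches of length `4 * q` around the block boundaries rarely meet `0^m`, and
  -- substrings of length `q` differ with high probability
  set q := 2 ^ (m - 4) with hq
  have hq16 : 16 * q = 2 ^ m := by
    rw [hq]
    have : m = m - 4 + 4 := by omega
    conv_rhs => rw [this, pow_add]
    ring
  have hq1 : 1 ≤ q := Nat.one_le_two_pow
  have hmn := h.two_pow_m_le
  have hνm : 2 * m ≤ ν := by
    have := h.eq_div
    omega
  have hn1 : (1 : ℝ) ≤ n := by exact_mod_cast hn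
  have hν : (0 : ℝ) < ν := by
    have := h.large
    exact_mod_cast (by omega : 0 < ν)
  have hp4 := h.pow_four_le
  rcases Nat.lt_or_ge m M with hlt | hle
  · have h1 := le_rateVL_of_long code hn h.card_embedding_pos hM hlt.le h.m_le hq1 (by omega)
      hq16.le (by
        have h2 : 4 * (n * n) ^ 2 ≤ 2 ^ q := by
          calc 4 * (n * n) ^ 2 ≤ 4 * 2 ^ (8 * m + 8) := Nat.mul_le_mul_left 4 hp4
            _ = 2 ^ (8 * m + 10) := by ring
            _ ≤ 2 ^ q := Nat.pow_le_pow_right (by norm_num) (by omega)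
        exact_mod_cast h2) rfl
    refine le_trans ?_ h1
    have h2 : n * n ≤ 8 * (n * n / 4) := by
      have : 4 ≤ n * n := by
        have h3 : 2 ≤ n := by
          have : m < 2 ^ m := Nat.lt_two_pow_self
          omega
        exact Nat.mul_le_mul h3 h3
      omega
    have h3 : (n : ℝ) * n ≤ 8 * (n * n / 4 : ℕ) := by exact_mod_cast h2
    have h4 : (16 : ℝ) * q = 2 ^ m := by exact_mod_cast hq16
    have h5 : (22 : ℝ) ≤ ν := by exact_mod_cast h.large
    rw [← h4, div_le_iff₀ (by positivity)]
    have h6 : (0 : ℝ) ≤ q := Nat.cast_nonneg q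
    generalize ((n * n / 4 : ℕ) : ℝ) = b at *
    have h7 : (n : ℝ) ^ 2 * (16 * q) ≤ 128 * (q * b) := by nlinarith
    have h8 : 0 ≤ q * b := by
      have : 0 ≤ b := by nlinarith
      positivity
    nlinarith
  · have h1 := le_rateVL_of_short (B := n * n) code hn h.card_embedding_pos hM hq1
      (show q ≤ n by omega) (by
        have h2 : 2 * (n * n) ^ 2 * 2 ^ M ≤ 2 ^ q := by
          calc 2 * (n * n) ^ 2 * 2 ^ M ≤ 2 * 2 ^ (8 * m + 8) * 2 ^ m :=
                Nat.mul_le_mul (Nat.mul_le_mul_left 2 hp4) (Nat.pow_le_pow_right (by norm_num) hle)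
            _ = 2 ^ (9 * m + 9) := by ring
            _ ≤ 2 ^ q := Nat.pow_le_pow_right (by norm_num) hgrow
        exact_mod_cast h2)
    refine le_trans ?_ h1
    have hMn : M ≤ n := hle.trans h.m_le
    have h2 : n ≤ ν * (n / M) := by
      have h3 := Nat.lt_mul_div_succ n (show 0 < M by omega)
      have h4 : 1 ≤ n / M := Nat.div_pos hMn (by omega)
      calc n ≤ M * (n / M + 1) := h3.le
        _ ≤ M * (2 * (n / M)) := Nat.mul_le_mul_left M (by omega)
        _ = 2 * M * (n / M) := by ring
        _ ≤ ν * (n / M) := Nat.mul_le_mul_right _ (by omega)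
    have h3 : (n : ℝ) ≤ ν * (n / M : ℕ) := by exact_mod_cast h2
    have h4 : (2 : ℝ) ^ M ≤ 2 ^ m := pow_le_pow_right₀ (by norm_num) hle
    have h5 : (2 : ℝ) ^ m * 2 ^ m ≤ n := by exact_mod_cast h.sq_le
    have h6 : (0 : ℝ) < 2 ^ m := by positivity
    generalize ((n / M : ℕ) : ℝ) = d at *
    push_cast
    calc (n : ℝ) ^ 2 * 2 ^ m / (512 * ν) ≤ (n : ℝ) ^ 2 * 2 ^ m / (2 * ν) := by
          gcongr
          norm_num
      _ ≤ (n * n * d) * (1 / 2 ^ m / 2) := by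
          rw [div_div, mul_one_div, div_le_div_iff₀ (by positivity) (by positivity)]
          nlinarith [mul_le_mul_of_nonneg_left (h5.trans h3) (sq_nonneg (n : ℝ))]
      _ ≤ (n * n * d) * (1 / 2 ^ M / 2) := by
          have hd : 0 ≤ d := by
            by_contra hneg
            nlinarith
          gcongr

end Scales

/-! ### Comparison of the scales with powers of `B` -/

/-- The factor `80` is `40 / log 2`, rounded up generously. -/
theorem logb_two_le {x : ℝ} (hx : 0 ≤ x) : Real.logb 2 x ≤ 80 * x ^ (1 / 40 : ℝ) := by
  have h1 := Real.log_le_rpow_div hx (show (0 : ℝ) < 1 / 40 by norm_num)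
  have h2 := Real.log_two_gt_d9
  have h3 : 0 ≤ x ^ (1 / 40 : ℝ) := Real.rpow_nonneg hx _
  rw [Real.logb, div_le_iff₀ (by linarith)]
  nlinarith

theorem rpow_one_fifth_le {x : ℝ} (hx : 1 < x) :
    x ^ (1 / 5 : ℝ) ≤ 6400 * (x ^ (1 / 4 : ℝ) / Real.logb 2 x ^ 2) := by
  have h0 : 0 < x := by linarith
  have h1 : 0 < Real.logb 2 x := Real.logb_pos (by norm_num) hx
  have h2 := logb_two_le h0.le
  have h3 : Real.logb 2 x ^ 2 ≤ 6400 * x ^ (1 / 20 : ℝ) := by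
    calc Real.logb 2 x ^ 2 ≤ (80 * x ^ (1 / 40 : ℝ)) ^ 2 := by gcongr
      _ = 6400 * (x ^ (1 / 40 : ℝ)) ^ (2 : ℕ) := by ring
      _ = 6400 * x ^ (1 / 20 : ℝ) := by
          rw [← Real.rpow_natCast, ← Real.rpow_mul h0.le]
          norm_num
  rw [← mul_div_assoc, le_div_iff₀ (by positivity)]
  calc x ^ (1 / 5 : ℝ) * Real.logb 2 x ^ 2 ≤ x ^ (1 / 5 : ℝ) * (6400 * x ^ (1 / 20 : ℝ)) := by
        gcongr
    _ = 6400 * (x ^ (1 / 5 : ℝ) * x ^ (1 / 20 : ℝ)) := by ring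
    _ = 6400 * x ^ (1 / 4 : ℝ) := by
        rw [← Real.rpow_add h0]
        norm_num

namespace Scales

variable {n ν m : ℕ}

theorem rpow_one_fourth (n : ℕ) : ((n * n : ℕ) : ℝ) ^ (1 / 4 : ℝ) = √(n : ℝ) := by
  have h0 : (0 : ℝ) ≤ n := Nat.cast_nonneg n
  rw [Nat.cast_mul, ← sq, ← Real.rpow_natCast, ← Real.rpow_mul h0, Real.sqrt_eq_rpow]
  norm_num

theorem two_pow_le_sqrt (h : Scales n ν m) : (2 : ℝ) ^ m ≤ √(n : ℝ) := by
  refine Real.le_sqrt_of_sq_le ?_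
  rw [sq]
  exact_mod_cast h.sq_le

theorem sqrt_le (h : Scales n ν m) : √(n : ℝ) ≤ 2 * 2 ^ m := by
  refine Real.sqrt_le_iff.2 ⟨by positivity, ?_⟩
  have h1 : (n : ℝ) ≤ 4 * (2 ^ m * 2 ^ m) := by exact_mod_cast h.lt_four_mul_sq.le
  linarith [mul_pow (2 : ℝ) (2 ^ m) 2, sq ((2 : ℝ) ^ m)]

theorem le_logb (h : Scales n ν m) : (ν : ℝ) ≤ Real.logb 2 ((n * n : ℕ) : ℝ) := by
  have hn := h.pos
  have h1 : 0 < n * n := Nat.mul_pos hn hn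
  rw [Real.le_logb_iff_rpow_le (by norm_num) (by exact_mod_cast h1), Real.rpow_natCast]
  exact_mod_cast h.pow_le.trans (Nat.le_mul_of_pos_left n hn)

theorem nu_pos (h : Scales n ν m) : (0 : ℝ) < ν := by
  have := h.large
  exact_mod_cast (by omega : 0 < ν)

theorem le_rateVL_div (h : Scales n ν m) (code : IntegerCode) {M : ℕ} (hM : 1 ≤ M) :
    1 / 3072 * (((n * n : ℕ) : ℝ) ^ (1 / 4 : ℝ) / Real.logb 2 ((n * n : ℕ) : ℝ) ^ 2) ≤
      rateVL code M n n (n * n) / optimalRate n n (n * n) := by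
  have hν := h.nu_pos
  have hn : (0 : ℝ) < n := by exact_mod_cast h.pos
  rw [rpow_one_fourth]
  calc 1 / 3072 * (√(n : ℝ) / Real.logb 2 ((n * n : ℕ) : ℝ) ^ 2)
      ≤ 1 / 3072 * (2 * 2 ^ m / (ν : ℝ) ^ 2) := by
        gcongr
        · exact h.sqrt_le
        · exact h.le_logb
    _ = (n : ℝ) ^ 2 * 2 ^ m / (512 * ν) / (3 * (ν * (n : ℝ) ^ 2)) := by
        field_simp
        norm_num
    _ ≤ rateVL code M n n (n * n) / optimalRate n n (n * n) := by
        have h1 := h.le_rateVL code hM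
        have h2 : 0 ≤ rateVL code M n n (n * n) := le_trans (by positivity) h1
        exact div_le_div₀ h2 h1 h.optimalRate_pos h.optimalRate_le

theorem rateVL_div_le (h : Scales n ν m) (code : IntegerCode) :
    rateVL code m n n (n * n) / optimalRate n n (n * n) ≤
      1760 * ((n * n : ℕ) : ℝ) ^ (1 / 4 : ℝ) := by
  have hν := h.nu_pos
  rw [rpow_one_fourth, div_le_iff₀ h.optimalRate_pos]
  calc rateVL code m n n (n * n) ≤ 440 * (ν * (n : ℝ) ^ 2 * 2 ^ m) := h.rateVL_le code
    _ = 1760 * 2 ^ m * (ν * (n : ℝ) ^ 2 / 4) := by ring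
    _ ≤ 1760 * √(n : ℝ) * optimalRate n n (n * n) := by
        gcongr
        · exact h.two_pow_le_sqrt
        · exact h.le_optimalRate

theorem exists_rateMC_div_le (h : Scales n ν m) (code : IntegerCode) :
    ∃ M, 1 ≤ M ∧ rateMC code M n n (n * n) / optimalRate n n (n * n) ≤ 64000 := by
  obtain ⟨M, hM, h1⟩ := h.exists_rateMC_le code
  refine ⟨M, hM, ?_⟩
  rw [div_le_iff₀ h.optimalRate_pos]
  linarith [h.le_optimalRate]

end Scales

end Dedup

theorem mainTheorem5 :
    ∃ (c C : ℝ) (B₀ : ℕ), 0 < c ∧ 0 < C ∧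
      ∀ B A L : ℕ, B₀ ≤ B → (A : ℝ) = Real.sqrt (B : ℝ) → (L : ℝ) = Real.sqrt (B : ℝ) →
        0 < Dedup.optimalRate A L B ∧
        ∀ code : Dedup.IntegerCode,
          (∀ M : ℕ, 1 ≤ M →
            c * ((B : ℝ) ^ (1 / 4 : ℝ) / Real.logb 2 (B : ℝ) ^ 2) ≤
                Dedup.rateVL code M A L B / Dedup.optimalRate A L B ∧
            c * (B : ℝ) ^ (1 / 5 : ℝ) ≤
                Dedup.rateVL code M A L B / Dedup.optimalRate A L B) ∧
          (∃ M : ℕ, 1 ≤ M ∧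
            Dedup.rateVL code M A L B / Dedup.optimalRate A L B ≤
              C * (B : ℝ) ^ (1 / 4 : ℝ)) ∧
          (∃ M : ℕ, 1 ≤ M ∧
            Dedup.rateMC code M A L B / Dedup.optimalRate A L B ≤ C) := by
  refine ⟨1 / 3072 / 6400, 64000, 2 ^ 44, by norm_num, by norm_num, ?_⟩
  intro B n L hB hA hL
  obtain rfl : L = n := by exact_mod_cast hL.trans hA.symm
  obtain rfl : B = L * L := by
    have h1 : (B : ℝ) = L * L := by rw [hA, Real.mul_self_sqrt (Nat.cast_nonneg B)]
    exact_mod_cast h1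
  have hn : 2 ^ 22 ≤ L := by
    by_contra! hlt
    have := Nat.mul_lt_mul_of_lt_of_lt hlt hlt
    omega
  obtain ⟨ν, m, h⟩ := Dedup.Scales.exists_of_le hn
  refine ⟨h.optimalRate_pos, fun code => ⟨fun M hM => ?_, ?_, h.exists_rateMC_div_le code⟩⟩
  · have h1 := h.le_rateVL_div code hM
    have h2 : (1 : ℝ) < ((L * L : ℕ) : ℝ) := by exact_mod_cast (by omega : 1 < L * L)
    have h3 := Dedup.rpow_one_fifth_le h2
    have h4 : (0 : ℝ) ≤ ((L * L : ℕ) : ℝ) ^ (1 / 4 : ℝ) /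
        Real.logb 2 ((L * L : ℕ) : ℝ) ^ 2 := by positivity
    constructor <;> linarith
  · refine ⟨m, by have := h.le_m; omega, (h.rateVL_div_le code).trans ?_⟩
    gcongr
    norm_num
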